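/- All graphs are finite and simple. A *path in* $G$ is an induced subgraph of $G$ that is a path; its *length* is its number of edges and its *interior* $P^*$ is $P$ minus its two ends. A *hole* is an induced cycle on at least four vertices. Two disjoint vertex sets are *anticomplete* if there is no edge between them. For a path $W$ in $G$ and a vertex $v$ of $W$, let $N_W[v]$ consist of $v$ and its neighbors in $W$. A *theta* is a graph consisting of two non-adjacent vertices $a,b$ and three paths from $a$ to $b$, each of length at least two, with pairwise disjoint and pairwise anticomplete interiors. A *prism* is a graph consisting of two disjoint triangles $\{a_1,a_2,a_3\}$, $\{b_1,b_2,b_3\}$ and three pairwise disjoint paths $P_1,P_2,P_3$, where $P_i$ has ends $a_i,b_i$, and for $i\ne j$ the only edges between $P_i$ and $P_j$ are $a_ia_j$ and $b_ib_j$. An *even wheel* in $G$ is a pair $(C,v)$ where $C$ is a hole in $G$ and $v\in V(G)\setminus C$ has at least three neighbors in $C$ and an even number of them. A graph is *(theta, prism, even wheel, $K_t$)-free* if no induced subgraph of it is a theta, a prism or a complete graph on $t$ vertices, and there is no even wheel in it. For $w\ge 1$, a *$w$-kaleidoscope* in $G$ is a tuple $(a,x,y,\mathcal W)$ where $a,x,y\in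 V(G)$, the vertices $x,y$ are distinct, non-adjacent, and both adjacent to $a$; $\mathcal W$ is a set of $w$ paths in $G\setminus\{a\}$ from $x$ to $y$ with pairwise disjoint interiors; and $a$ is anticomplete to $W^*$ for every $W\in\mathcal W$. For $d\ge 1$, a vertex $z\in V(G)$ is *$d$-mirrored* by $(a,x,y,\mathcal W)$ if $z\ne a$, and for every $W\in\mathcal W$: $z\notin V(W)$, $z$ has no neighbor in $N_W[x]\cup N_W[y]$, and $z$ has at least $d$ distinct neighbors in $W$. **Theorem 4.1.** For all integers $d,t,w\ge 1$ there exists an integer $\kappa=\kappa(d,t,w)\ge 1$ with the following property. Let $G$ be a (theta, prism, even wheel, $K_t$)-free graph, let $(a,x,y,\mathcal W)$ be a $\kappa$-kaleidoscope in $G$, and let $z\in V(G)$ be $1$-mirrored by $(a,x,y,\mathcal W)$. Then there exists $\mathcal W'\subseteq\mathcal W$ with $|\mathcal W'|=w$ such that $z$ is $d$-mirrored by the $w$-kaleidoscope $(a,x,y,\mathcal W')$. -/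

import Mathlib

namespace Kaleidoscope

universe u

variable {V : Type u} {G : SimpleGraph V}

/-- A walk tracing an induced path of `G`: no repeated vertices, and the only edges of `G`
between its vertices are the edges of the walk. -/
def IsInducedPath {u v : V} (p : G.Walk u v) : Prop :=
  p.IsPath ∧ p.IsChordless

/-- The vertex set of a walk. -/
def vertices {u v : V} (p : G.Walk u v) : Set V :=
  {s | s ∈ p.support}

/-- The interior of a path: all its vertices other than its two ends. -/
def pathInterior {u v : V} (p : G.Walk u v) : Set V :=
  {s | s ∈ p.support ∧ s ≠ u ∧ s ≠ v}

/-- Two disjoint vertex sets with no edge of the graph between them. -/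
def Anticomplete (G : SimpleGraph V) (X Y : Set V) : Prop :=
  Disjoint X Y ∧ ∀ s ∈ X, ∀ t ∈ Y, ¬ G.Adj s t

/-- A closed walk tracing a hole: an induced cycle on at least four vertices. -/
def IsHole {u : V} (c : G.Walk u u) : Prop :=
  c.IsCycle ∧ c.IsChordless ∧ 4 ≤ c.length

/-- `N_X(z)`: the neighbours of `z` in the vertex set `X`. -/
def nbrsIn (G : SimpleGraph V) (z : V) (X : Set V) : Set V :=
  {s | s ∈ X ∧ G.Adj z s}

/-- `N_X[z]`: the neighbours of `z` in `X`, together with `z` itself. -/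
def closedNbrsIn (G : SimpleGraph V) (z : V) (X : Set V) : Set V :=
  insert z (nbrsIn G z X)

/-- `G` has an induced subgraph which is a theta: non-adjacent ends `a`, `b` and three paths
from `a` to `b` of length at least two, whose interiors are pairwise disjoint with no edges
between them. -/
def HasTheta (G : SimpleGraph V) : Prop :=
  ∃ (a b : V) (P : Fin 3 → G.Walk a b),
    a ≠ b ∧ ¬ G.Adj a b ∧
    (∀ i, IsInducedPath (P i) ∧ 2 ≤ (P i).length) ∧
    ∀ i j, i ≠ j → Anticomplete G (pathInterior (P i)) (pathInterior (P j))

/-- `G` has an induced subgraph which is a prism: two disjoint triangles `a 0, a 1, a 2` and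
`b 0, b 1, b 2`, and three pairwise disjoint paths `P i` from `a i` to `b i`, such that for
`i ≠ j` the only edges between `P i` and `P j` are `a i a j` and `b i b j`. -/
def HasPrism (G : SimpleGraph V) : Prop :=
  ∃ (a b : Fin 3 → V) (P : ∀ i, G.Walk (a i) (b i)),
    (∀ i j, i ≠ j → G.Adj (a i) (a j) ∧ G.Adj (b i) (b j)) ∧
    (∀ i j, a i ≠ b j) ∧
    (∀ i, IsInducedPath (P i)) ∧
    (∀ i j, i ≠ j → Disjoint (vertices (P i)) (vertices (P j))) ∧
    ∀ i j, i ≠ j → ∀ s ∈ vertices (P i), ∀ t ∈ vertices (P j), G.Adj s t →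
      (s = a i ∧ t = a j) ∨ (s = b i ∧ t = b j)

/-- `G` has an even wheel: a hole together with a vertex outside it which has at least three
neighbours, and an even number of neighbours, in the hole. -/
def HasEvenWheel (G : SimpleGraph V) : Prop :=
  ∃ (u : V) (c : G.Walk u u) (v : V),
    IsHole c ∧ v ∉ vertices c ∧
    3 ≤ (nbrsIn G v (vertices c)).ncard ∧ Even (nbrsIn G v (vertices c)).ncard

/-- `(a, x, y, 𝒲)` is a `w`-kaleidoscope in `G`. A path from `x` to `y` is given as the walk
that traverses it from `x` to `y`, so that distinct members of `𝒲` are distinct paths. -/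
structure IsKaleidoscope (G : SimpleGraph V) (w : ℕ) (a x y : V)
    (𝒲 : Finset (G.Walk x y)) : Prop where
  adj_left : G.Adj x a
  adj_right : G.Adj a y
  ne : x ≠ y
  not_adj : ¬ G.Adj x y
  card_eq : 𝒲.card = w
  isInducedPath : ∀ W ∈ 𝒲, IsInducedPath W
  notMem : ∀ W ∈ 𝒲, a ∉ vertices W
  disjoint_interior : ∀ W ∈ 𝒲, ∀ W' ∈ 𝒲, W ≠ W' → Disjoint (pathInterior W) (pathInterior W')
  anticomplete : ∀ W ∈ 𝒲, Anticomplete G {a} (pathInterior W)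

/-- The set `Z` is `d`-mirrored by `(a, x, y, 𝒲)`. -/
structure SetIsMirrored (G : SimpleGraph V) (d : ℕ) (Z : Set V) (a x y : V)
    (𝒲 : Finset (G.Walk x y)) : Prop where
  disjoint : Disjoint Z ((⋃ W ∈ 𝒲, vertices W) ∪ {a})
  subsingleton : (nbrsIn G a Z).Subsingleton
  anticomplete : ∀ z ∈ Z, ∀ W ∈ 𝒲,
    Anticomplete G {z} (closedNbrsIn G x (vertices W) ∪ closedNbrsIn G y (vertices W))
  le_ncard : ∀ z ∈ Z, ∀ W ∈ 𝒲, d ≤ (nbrsIn G z (vertices W)).ncard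

/-- The vertex `z` is `d`-mirrored by `(a, x, y, 𝒲)`. -/
def IsMirrored (G : SimpleGraph V) (d : ℕ) (z a x y : V) (𝒲 : Finset (G.Walk x y)) : Prop :=
  SetIsMirrored G d {z} a x y 𝒲

end Kaleidoscope

/-! Call a path of the kaleidoscope poor if `z` has fewer than `d` neighbours in it. It suffices to
bound the number of poor paths by some `N` depending on `d` and `t` only: then `κ = w + N` works,
because the remaining paths number at least `w`. The bound is `exists_bound_meets`, for families of
paths from `x` to `y` each of which closes to a hole through `a`.

Three facts about a hole carry the geometry. A vertex with a positive even number of neighbours on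
it has exactly two (no even wheel), and they are adjacent (no theta): it attaches to an edge,
`HoleOn.exists_atEdge`. A vertex joined to one vertex of the hole by a route away from the rest
attaches to the rest in an edge or not at all, `HoleOn.atEdge_of_link`. Two vertices that attach to
edges and are joined off the hole attach to the same edge, since otherwise there is a prism or an
even wheel, `HoleOn.atEdge_eq`.

First case, `exists_bound_edge`: `z` is not adjacent to `a` and attaches to an edge of every path.
Ramsey's theorem, excluded cliques and `exists_bound_attached` yield three paths such that the
neighbours of `z` on one do not touch the others. Removing the edge splits each path into an arm
towards `x` and an arm towards `y`. If the arms towards `x` are pairwise anticomplete before `x`,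
they form a theta with ends `z` and `x`. Otherwise the first edge between two of them closes a hole
through `z` (a clean pair), and the third arm must hit this hole in an edge. If that is the edge
where the two arms meet, the three prefixes end in a triangle and an even wheel results
(`CleanTriple.false`); if not, there is a new clean pair, and a descent on the length of a prefix
ends in a contradiction (`ThreeArms.false_of_contact`).

Second case, `exists_bound_meets_of_not_edge`. Attach to each path a bounded core, containing the
neighbours of `z`, and make the cores pairwise anticomplete. If vertices of one core touch many
other paths, a single vertex `v` touches many; a parity count over the sectors cut out by the
neighbours of `z` shows that `v` attaches to an edge of each of them (`Probe.exists_atEdge`), and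
the first case applies to `v` instead of `z`. Otherwise two paths remain on which the neighbours of
`z` form isolated consecutive pairs (`TwoHoles.runs`). If `z` is not adjacent to `a`, evenness makes
it attach to an edge, which this case excludes; if it is, then `a` takes the role of the third arm.
-/

namespace Kaleidoscope

variable {V : Type*} {G : SimpleGraph V}

/-! ### Induced paths and holes as sequences; thetas, prisms and even wheels from connectivity. -/

/-- The vertices `g 0, …, g m` are distinct and trace an induced path of `G`. -/
def IndPath (G : SimpleGraph V) (g : ℕ → V) (m : ℕ) : Prop :=
  ∀ i j, i < j → j ≤ m → g i ≠ g j ∧ (G.Adj (g i) (g j) ↔ j = i + 1)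

/-- The vertex `o` together with the induced path `g 0, …, g m` traces a hole of `G`. -/
structure HoleOn (G : SimpleGraph V) (o : V) (g : ℕ → V) (m : ℕ) : Prop where
  path : IndPath G g m
  two_le : 2 ≤ m
  ne : ∀ i ≤ m, o ≠ g i
  adj : ∀ i ≤ m, (G.Adj o (g i) ↔ i = 0 ∨ i = m)

/-- `a` and `b` are joined by a walk inside `S`. -/
def Link (G : SimpleGraph V) (S : Set V) (a b : V) : Prop :=
  Relation.ReflTransGen (fun u v => G.Adj u v ∧ u ∈ S ∧ v ∈ S) a b

/-- No vertex of `S` equals or is adjacent to a vertex of `T`. -/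
def AC (G : SimpleGraph V) (S T : Set V) : Prop :=
  ∀ u ∈ S, ∀ v ∈ T, u ≠ v ∧ ¬ G.Adj u v

/-- The number of neighbours of `c` in `S`. -/
noncomputable def deg (G : SimpleGraph V) (c : V) (S : Set V) : ℕ := (nbrsIn G c S).ncard

/-- Concatenation of the sequences `g 0, …, g m` and `h 0, h 1, …`. -/
def cat (g : ℕ → V) (m : ℕ) (h : ℕ → V) : ℕ → V :=
  fun s => if s ≤ m then g s else h (s - (m + 1))

theorem AC.symm {S T : Set V} (h : AC G S T) : AC G T S :=
  fun u hu v hv => ⟨(h v hv u hu).1.symm, fun e => (h v hv u hu).2 e.symm⟩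

namespace Link

theorem refl {S : Set V} (a : V) : Link G S a a := Relation.ReflTransGen.refl

theorem trans {S : Set V} {a b c : V} (h : Link G S a b) (h' : Link G S b c) : Link G S a c :=
  Relation.ReflTransGen.trans h h'

theorem of_adj {S : Set V} {a b : V} (h : G.Adj a b) (ha : a ∈ S) (hb : b ∈ S) : Link G S a b :=
  Relation.ReflTransGen.single ⟨h, ha, hb⟩

theorem symm {S : Set V} {a b : V} (h : Link G S a b) : Link G S b a := by
  unfold Link at *
  induction h with
  | refl => exact Relation.ReflTransGen.refl
  | tail _ h ih => exact Relation.ReflTransGen.head ⟨h.1.symm, h.2.2, h.2.1⟩ ih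

theorem mono {S T : Set V} {a b : V} (h : Link G S a b) (hST : S ⊆ T) : Link G T a b :=
  Relation.ReflTransGen.mono (fun _ _ e => ⟨e.1, hST e.2.1, hST e.2.2⟩) _ _ h

end Link

namespace IndPath

variable {g h : ℕ → V} {m n : ℕ}

theorem inj (hg : IndPath G g m) {i j : ℕ} (hi : i ≤ m) (hj : j ≤ m) (e : g i = g j) : i = j := by
  rcases lt_trichotomy i j with h | h | h
  · exact absurd e (hg i j h hj).1
  · exact h
  · exact absurd e.symm (hg j i h hi).1

theorem adj_iff (hg : IndPath G g m) {i j : ℕ} (hi : i ≤ m) (hj : j ≤ m) :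
    G.Adj (g i) (g j) ↔ j = i + 1 ∨ i = j + 1 := by
  rcases lt_trichotomy i j with h | h | h
  · rw [(hg i j h hj).2]; omega
  · subst h; simp
  · rw [G.adj_comm, (hg j i h hi).2]; omega

theorem of_iff (hi : ∀ i j, i < j → j ≤ m → g i ≠ g j)
    (ha : ∀ i j, i < j → j ≤ m → (G.Adj (g i) (g j) ↔ j = i + 1)) : IndPath G g m :=
  fun i j hij hj => ⟨hi i j hij hj, ha i j hij hj⟩

theorem sub (hg : IndPath G g m) (a : ℕ) {k : ℕ} (hk : a + k ≤ m) :
    IndPath G (fun s => g (a + s)) k := by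
  intro i j hij hj
  refine ⟨(hg _ _ (by omega) (by omega)).1, ?_⟩
  rw [(hg _ _ (by omega) (by omega)).2]; omega

theorem le (hg : IndPath G g m) {k : ℕ} (hk : k ≤ m) : IndPath G g k :=
  fun i j hij hj => hg i j hij (hj.trans hk)

theorem rev (hg : IndPath G g m) {k : ℕ} (hk : k ≤ m) : IndPath G (fun s => g (k - s)) k := by
  intro i j hij hj
  refine ⟨(hg _ _ (by omega) (by omega)).1.symm, ?_⟩
  rw [G.adj_comm, (hg _ _ (by omega) (by omega)).2]; omega

theorem cat (hg : IndPath G g m) (hh : IndPath G h n)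
    (H : ∀ i ≤ m, ∀ j ≤ n, g i ≠ h j ∧ (G.Adj (g i) (h j) ↔ i = m ∧ j = 0)) :
    IndPath G (cat g m h) (m + 1 + n) := by
  intro i j hij hj
  unfold Kaleidoscope.cat
  by_cases h1 : j ≤ m
  · rw [if_pos h1, if_pos (by omega)]; exact hg i j hij h1
  · by_cases h2 : i ≤ m
    · rw [if_neg h1, if_pos h2]
      refine ⟨(H _ h2 _ (by omega)).1, ?_⟩
      rw [(H _ h2 _ (by omega)).2]; omega
    · rw [if_neg h1, if_neg h2]
      refine ⟨(hh _ _ (by omega) (by omega)).1, ?_⟩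
      rw [(hh _ _ (by omega) (by omega)).2]; omega

theorem zero (g : ℕ → V) : IndPath G g 0 := fun i j hij hj => by omega

theorem link_le (hg : IndPath G g m) {i j : ℕ} (hij : i ≤ j) (hj : j ≤ m) {S : Set V}
    (hS : ∀ s, i ≤ s → s ≤ j → g s ∈ S) : Link G S (g i) (g j) := by
  induction j, hij using Nat.le_induction with
  | base => exact Link.refl _
  | succ k hk ih =>
    refine (ih (by omega) fun s h1 h2 => hS s h1 (by omega)).trans
      (Link.of_adj ((hg _ _ (by omega) hj).2.2 rfl) (hS _ hk (by omega)) (hS _ (by omega) le_rfl))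

theorem link_ge (hg : IndPath G g m) {i j : ℕ} (hij : i ≤ j) (hj : j ≤ m) {S : Set V}
    (hS : ∀ s, i ≤ s → s ≤ j → g s ∈ S) : Link G S (g j) (g i) :=
  (hg.link_le hij hj hS).symm

/-- The walk traced by an induced path. -/
theorem exists_walk (hg : IndPath G g m) : ∃ p : G.Walk (g 0) (g m), p.length = m ∧ p.IsPath ∧
    (∀ v, v ∈ p.support ↔ ∃ i ≤ m, v = g i) ∧
    (∀ e, e ∈ p.edges ↔ ∃ i < m, e = s(g i, g (i + 1))) := by
  induction m with
  | zero => exact ⟨.nil, rfl, .nil, by simp, by simp⟩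
  | succ k ih =>
    obtain ⟨p, hl, hp, hs, he⟩ := ih (hg.le (by omega))
    have ha : G.Adj (g k) (g (k + 1)) := (hg _ _ (by omega) le_rfl).2.2 rfl
    refine ⟨p.concat ha, by simp [hl], ?_, ?_, ?_⟩
    · refine hp.concat ?_ ha
      rw [hs]; rintro ⟨i, hi, e⟩
      exact (hg i (k + 1) (by omega) le_rfl).1 e.symm
    · intro v
      rw [SimpleGraph.Walk.support_concat]
      simp only [List.mem_append, hs, List.mem_singleton]
      constructor
      · rintro (⟨i, hi, e⟩ | e)
        · exact ⟨i, by omega, e⟩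
        · exact ⟨k + 1, le_rfl, e⟩
      · rintro ⟨i, hi, e⟩
        rcases Nat.lt_or_ge i (k + 1) with h | h
        · exact .inl ⟨i, by omega, e⟩
        · obtain rfl : i = k + 1 := by omega
          exact .inr e
    · intro e
      rw [SimpleGraph.Walk.edges_concat]
      simp only [List.concat_eq_append, List.mem_append, he, List.mem_singleton]
      constructor
      · rintro (⟨i, hi, e⟩ | e)
        · exact ⟨i, by omega, e⟩
        · exact ⟨k, by omega, e⟩
      · rintro ⟨i, hi, e⟩
        rcases Nat.lt_or_ge i k with h | h
        · exact .inl ⟨i, by omega, e⟩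
        · obtain rfl : i = k := by omega
          exact .inr e

theorem exists_inducedPath (hg : IndPath G g m) : ∃ p : G.Walk (g 0) (g m), p.length = m ∧
    IsInducedPath p ∧ ∀ v, v ∈ p.support ↔ ∃ i ≤ m, v = g i := by
  obtain ⟨p, hl, hp, hs, he⟩ := hg.exists_walk
  refine ⟨p, hl, ⟨hp, ?_⟩, hs⟩
  rw [SimpleGraph.Walk.isChordless_iff_forall_mem_edges]
  intro u v hu hv huv
  obtain ⟨i, hi, rfl⟩ := (hs _).1 hu
  obtain ⟨j, hj, rfl⟩ := (hs _).1 hv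
  rw [he]
  rcases (hg.adj_iff hi hj).1 huv with rfl | rfl
  · exact ⟨i, by omega, rfl⟩
  · exact ⟨j, by omega, Sym2.eq_swap⟩

end IndPath

/-- A linked pair of vertices is joined by an induced path. -/
theorem Link.exists_indPath {S : Set V} {a b : V} (h : Link G S a b) (hb : b ∈ S) :
    ∃ g m, IndPath G g m ∧ g 0 = a ∧ g m = b ∧ ∀ i ≤ m, g i ∈ S := by
  unfold Link at h
  induction h using Relation.ReflTransGen.head_induction_on with
  | refl => exact ⟨fun _ => b, 0, .zero _, rfl, rfl, fun _ _ => hb⟩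
  | @head a c hac _ ih =>
    obtain ⟨g, m, hg, h0, hm, hS⟩ := ih
    classical
    -- The new start `a` is joined to the path at its last contact, so that no chord is left; if
    -- that contact is `a` itself, the beginning is just cut off.
    let P : ℕ → Prop := fun k => k ≤ m ∧ (a = g k ∨ G.Adj a (g k))
    have hP0 : P 0 := ⟨by omega, .inr (h0 ▸ hac.1)⟩
    let k := Nat.findGreatest P m
    have hk : P k := Nat.findGreatest_spec (P := P) (Nat.zero_le m) hP0
    have hk' : ∀ j, k < j → j ≤ m → ¬ (a = g j ∨ G.Adj a (g j)) := fun j h1 h2 h3 =>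
      Nat.findGreatest_is_greatest (P := P) h1 h2 ⟨h2, h3⟩
    by_cases hak : a = g k
    · refine ⟨fun s => g (k + s), m - k, hg.sub k (by have := hk.1; omega), hak.symm, ?_, ?_⟩
      · simp only; rw [Nat.add_sub_cancel' hk.1]; exact hm
      · intro i hi; exact hS _ (by have := hk.1; omega)
    · have hadj := hk.2.resolve_left hak
      have h1 := hk.1
      have hc := (IndPath.zero (G := G) (fun _ => a)).cat (hg.sub k (k := m - k) (by omega)) (by
        intro i hi j hj
        rcases Nat.eq_zero_or_pos j with rfl | hj0
        · refine ⟨hak, ?_⟩; simp only [Nat.add_zero]; constructor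
          · intro _; exact ⟨by omega, trivial⟩
          · intro _; exact hadj
        · have := hk' (k + j) (by omega) (by omega)
          push Not at this
          refine ⟨this.1, ?_⟩
          constructor
          · intro h; exact absurd h this.2
          · intro h; omega)
      refine ⟨_, _, hc, by simp [cat], ?_, ?_⟩
      · simp only [cat]; rw [if_neg (by omega)]
        rw [show k + (0 + 1 + (m - k) - (0 + 1)) = m by omega]; exact hm
      · intro i hi; simp only [cat]; split_ifs
        · exact hac.2.1
        · exact hS _ (by omega)

/-- Connectivity is enough: an induced path inside each set inherits anticompleteness from the sets,
and its length is at least two because `s` and `t` are distinct and non-adjacent. -/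
theorem hasTheta_of_link {s t : V} {S₁ S₂ S₃ : Set V} (hne : s ≠ t) (hst : ¬ G.Adj s t)
    (h₁₂ : AC G S₁ S₂) (h₁₃ : AC G S₁ S₃) (h₂₃ : AC G S₂ S₃)
    (h₁ : Link G (insert s (insert t S₁)) s t) (h₂ : Link G (insert s (insert t S₂)) s t)
    (h₃ : Link G (insert s (insert t S₃)) s t) : HasTheta G := by
  have key : ∀ S : Set V, Link G (insert s (insert t S)) s t →
      ∃ p : G.Walk s t, IsInducedPath p ∧ 2 ≤ p.length ∧ pathInterior p ⊆ S := by
    intro S h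
    obtain ⟨g, m, hg, rfl, rfl, hS⟩ := h.exists_indPath (by simp)
    obtain ⟨p, hl, hp, hs⟩ := hg.exists_inducedPath
    refine ⟨p, hp, ?_, ?_⟩
    · by_contra hlt
      have : m = 0 ∨ m = 1 := by omega
      rcases this with rfl | rfl
      · exact hne rfl
      · exact hst ((hg 0 1 (by omega) le_rfl).2.2 rfl)
    · rintro v ⟨hv, h0, hm⟩
      obtain ⟨i, hi, rfl⟩ := (hs _).1 hv
      rcases hS i hi with h | h | h
      · exact absurd h h0
      · exact absurd h hm
      · exact h
  obtain ⟨p₁, hp₁, hl₁, hs₁⟩ := key _ h₁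
  obtain ⟨p₂, hp₂, hl₂, hs₂⟩ := key _ h₂
  obtain ⟨p₃, hp₃, hl₃, hs₃⟩ := key _ h₃
  have ac : ∀ {S T : Set V} {p q : G.Walk s t}, AC G S T → pathInterior p ⊆ S →
      pathInterior q ⊆ T → Anticomplete G (pathInterior p) (pathInterior q) := by
    intro S T p q h hp hq
    refine ⟨Set.disjoint_left.2 fun v hv hv' => (h v (hp hv) v (hq hv')).1 rfl, ?_⟩
    exact fun u hu v hv => (h u (hp hu) v (hq hv)).2
  refine ⟨s, t, ![p₁, p₂, p₃], hne, hst, ?_, ?_⟩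
  · intro i; fin_cases i
    · exact ⟨hp₁, hl₁⟩
    · exact ⟨hp₂, hl₂⟩
    · exact ⟨hp₃, hl₃⟩
  · intro i j hij; fin_cases i <;> fin_cases j
    · exact absurd rfl hij
    · exact ac h₁₂ hs₁ hs₂
    · exact ac h₁₃ hs₁ hs₃
    · exact ac h₁₂.symm hs₂ hs₁
    · exact absurd rfl hij
    · exact ac h₂₃ hs₂ hs₃
    · exact ac h₁₃.symm hs₃ hs₁
    · exact ac h₂₃.symm hs₃ hs₂
    · exact absurd rfl hij

/-- The sets `S`, `T` are disjoint, and `aa'`, `bb'` are the only edges between them. -/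
def TwoEdges (G : SimpleGraph V) (S T : Set V) (a a' b b' : V) : Prop :=
  ∀ u ∈ S, ∀ v ∈ T, u ≠ v ∧ (G.Adj u v → (u = a ∧ v = a') ∨ (u = b ∧ v = b'))

/-- The sets contain the ends of the paths, since the two permitted edges join ends. Disjointness of
the triangles is assumed only along each path; across different paths it is part of `TwoEdges`. -/
theorem hasPrism_of_link {a₁ a₂ a₃ b₁ b₂ b₃ : V} {S₁ S₂ S₃ : Set V}
    (ha₁₂ : G.Adj a₁ a₂) (ha₁₃ : G.Adj a₁ a₃) (ha₂₃ : G.Adj a₂ a₃)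
    (hb₁₂ : G.Adj b₁ b₂) (hb₁₃ : G.Adj b₁ b₃) (hb₂₃ : G.Adj b₂ b₃)
    (ha₁ : a₁ ∈ S₁) (ha₂ : a₂ ∈ S₂) (ha₃ : a₃ ∈ S₃)
    (hb₁ : b₁ ∈ S₁) (hb₂ : b₂ ∈ S₂) (hb₃ : b₃ ∈ S₃)
    (hn₁ : a₁ ≠ b₁) (hn₂ : a₂ ≠ b₂) (hn₃ : a₃ ≠ b₃)
    (h₁₂ : TwoEdges G S₁ S₂ a₁ a₂ b₁ b₂) (h₁₃ : TwoEdges G S₁ S₃ a₁ a₃ b₁ b₃)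
    (h₂₃ : TwoEdges G S₂ S₃ a₂ a₃ b₂ b₃)
    (h₁ : Link G S₁ a₁ b₁) (h₂ : Link G S₂ a₂ b₂) (h₃ : Link G S₃ a₃ b₃) : HasPrism G := by
  have key : ∀ (S : Set V) (a b : V), Link G S a b → b ∈ S →
      ∃ p : G.Walk a b, IsInducedPath p ∧ vertices p ⊆ S := by
    intro S a b h hb
    obtain ⟨g, m, hg, rfl, rfl, hS⟩ := h.exists_indPath hb
    obtain ⟨p, hl, hp, hs⟩ := hg.exists_inducedPath
    refine ⟨p, hp, fun v hv => ?_⟩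
    obtain ⟨i, hi, rfl⟩ := (hs _).1 hv
    exact hS i hi
  obtain ⟨p₁, hp₁, hs₁⟩ := key _ _ _ h₁ hb₁
  obtain ⟨p₂, hp₂, hs₂⟩ := key _ _ _ h₂ hb₂
  obtain ⟨p₃, hp₃, hs₃⟩ := key _ _ _ h₃ hb₃
  have flip : ∀ {S T : Set V} {a a' b b' : V}, TwoEdges G S T a a' b b' →
      TwoEdges G T S a' a b' b := by
    intro S T a a' b b' h u hu v hv
    refine ⟨(h v hv u hu).1.symm, fun e => ?_⟩
    rcases (h v hv u hu).2 e.symm with h | h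
    · exact .inl h.symm
    · exact .inr h.symm
  have dj : ∀ {S T S' T' : Set V} {a a' b b' : V}, TwoEdges G S T a a' b b' → S' ⊆ S → T' ⊆ T →
      Disjoint S' T' := fun h h1 h2 =>
    Set.disjoint_left.2 fun v hv hv' => (h v (h1 hv) v (h2 hv')).1 rfl
  refine ⟨![a₁, a₂, a₃], ![b₁, b₂, b₃], fun i => match i with
    | 0 => p₁ | 1 => p₂ | 2 => p₃, ?_, ?_, ?_, ?_, ?_⟩
  · intro i j hij
    fin_cases i <;> fin_cases j <;>
      first | exact absurd rfl hij | exact ⟨by assumption, by assumption⟩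
            | exact ⟨SimpleGraph.Adj.symm (by assumption), SimpleGraph.Adj.symm (by assumption)⟩
  · intro i j
    fin_cases i <;> fin_cases j
    · exact hn₁
    · exact (h₁₂ _ ha₁ _ hb₂).1
    · exact (h₁₃ _ ha₁ _ hb₃).1
    · exact (h₁₂ _ hb₁ _ ha₂).1.symm
    · exact hn₂
    · exact (h₂₃ _ ha₂ _ hb₃).1
    · exact (h₁₃ _ hb₁ _ ha₃).1.symm
    · exact (h₂₃ _ hb₂ _ ha₃).1.symm
    · exact hn₃
  · intro i; fin_cases i <;> assumption
  · intro i j hij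
    fin_cases i <;> fin_cases j
    · exact absurd rfl hij
    · exact dj h₁₂ hs₁ hs₂
    · exact dj h₁₃ hs₁ hs₃
    · exact dj (flip h₁₂) hs₂ hs₁
    · exact absurd rfl hij
    · exact dj h₂₃ hs₂ hs₃
    · exact dj (flip h₁₃) hs₃ hs₁
    · exact dj (flip h₂₃) hs₃ hs₂
    · exact absurd rfl hij
  · intro i j hij
    fin_cases i <;> fin_cases j
    · exact absurd rfl hij
    · exact fun u hu v hv => (h₁₂ u (hs₁ hu) v (hs₂ hv)).2
    · exact fun u hu v hv => (h₁₃ u (hs₁ hu) v (hs₃ hv)).2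
    · exact fun u hu v hv => (flip h₁₂ u (hs₂ hu) v (hs₁ hv)).2
    · exact absurd rfl hij
    · exact fun u hu v hv => (h₂₃ u (hs₂ hu) v (hs₃ hv)).2
    · exact fun u hu v hv => (flip h₁₃ u (hs₃ hu) v (hs₁ hv)).2
    · exact fun u hu v hv => (flip h₂₃ u (hs₃ hu) v (hs₂ hv)).2
    · exact absurd rfl hij

theorem HoleOn.exists_isHole {o : V} {g : ℕ → V} {m : ℕ} (h : HoleOn G o g m) :
    ∃ c : G.Walk o o, IsHole c ∧ vertices c = insert o (g '' Set.Iic m) := by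
  obtain ⟨p, hl, hp, hs, he⟩ := h.path.exists_walk
  have h2 := h.two_le
  have h0 : G.Adj o (g 0) := (h.adj 0 (by omega)).2 (.inl rfl)
  have h1 : G.Adj (g m) o := ((h.adj m le_rfl).2 (.inr rfl)).symm
  have ho : o ∉ p.support := by
    rw [hs]; rintro ⟨i, hi, e⟩; exact h.ne i hi e
  have hsup : ∀ v, v ∈ ((p.concat h1).cons h0).support ↔ v = o ∨ ∃ i ≤ m, v = g i := by
    intro v
    simp only [SimpleGraph.Walk.support_cons, SimpleGraph.Walk.support_concat,
      List.mem_cons, List.mem_append, hs, List.not_mem_nil, or_false]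
    grind
  have hed : ∀ e, e ∈ ((p.concat h1).cons h0).edges ↔
      e = s(o, g 0) ∨ e = s(g m, o) ∨ ∃ i < m, e = s(g i, g (i + 1)) := by
    intro e
    simp only [SimpleGraph.Walk.edges_cons, SimpleGraph.Walk.edges_concat, List.concat_eq_append,
      List.mem_cons, List.mem_append, he, List.not_mem_nil, or_false]
    grind
  refine ⟨(p.concat h1).cons h0, ⟨?_, ?_, ?_⟩, ?_⟩
  · rw [SimpleGraph.Walk.cons_isCycle_iff]
    refine ⟨hp.concat ho h1, ?_⟩
    simp only [SimpleGraph.Walk.edges_concat, List.concat_eq_append,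
      List.mem_append, he, List.mem_singleton, not_or]
    constructor
    · rintro ⟨i, hi, e⟩
      rw [Sym2.eq_iff] at e
      rcases e with e | e
      · exact h.ne i (by omega) e.1
      · exact h.ne (i + 1) (by omega) e.1
    · intro e
      rw [Sym2.eq_iff] at e
      rcases e with e | e
      · exact h.ne m (by omega) e.1
      · exact absurd (h.path.inj (by omega) (by omega) e.2) (by omega)
  · rw [SimpleGraph.Walk.isChordless_iff_forall_mem_edges]
    intro u v hu hv huv
    rw [hed]
    rcases (hsup u).1 hu with rfl | ⟨i, hi, rfl⟩ <;> rcases (hsup v).1 hv with rfl | ⟨j, hj, rfl⟩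
    · exact absurd huv (G.loopless.irrefl _)
    · rcases (h.adj j hj).1 huv with rfl | rfl
      · exact .inl rfl
      · exact .inr (.inl Sym2.eq_swap)
    · rcases (h.adj i hi).1 huv.symm with rfl | rfl
      · exact .inl Sym2.eq_swap
      · exact .inr (.inl rfl)
    · rcases (h.path.adj_iff hi hj).1 huv with rfl | rfl
      · exact .inr (.inr ⟨i, by omega, rfl⟩)
      · exact .inr (.inr ⟨j, by omega, Sym2.eq_swap⟩)
  · simp [hl]; omega
  · ext v
    rw [vertices, Set.mem_ofPred_eq, hsup]
    simp only [Set.mem_insert_iff, Set.mem_image, Set.mem_Iic]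
    constructor
    · rintro (h | ⟨i, hi, e⟩)
      · exact .inl h
      · exact .inr ⟨i, hi, e.symm⟩
    · rintro (h | ⟨i, hi, e⟩)
      · exact .inl h
      · exact .inr ⟨i, hi, e.symm⟩

theorem HoleOn.hasEvenWheel {o : V} {g : ℕ → V} {m : ℕ} (h : HoleOn G o g m) {c : V} (hco : c ≠ o)
    (hcg : ∀ i ≤ m, c ≠ g i) (h3 : 3 ≤ deg G c (insert o (g '' Set.Iic m)))
    (he : Even (deg G c (insert o (g '' Set.Iic m)))) : HasEvenWheel G := by
  obtain ⟨p, hp, hv⟩ := h.exists_isHole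
  refine ⟨o, p, c, hp, ?_, ?_, ?_⟩
  · rw [hv]; rintro (e | ⟨i, hi, e⟩)
    · exact hco e
    · exact hcg i hi e.symm
  · rw [hv]; exact h3
  · rw [hv]; exact he

end Kaleidoscope

/-! ### Degrees into segments, and vertices attached to an edge of a hole. -/

namespace Kaleidoscope

variable {V : Type*} {G : SimpleGraph V}

/-- The graph has no theta, no prism and no even wheel. -/
structure Good (G : SimpleGraph V) : Prop where
  theta : ¬ HasTheta G
  prism : ¬ HasPrism G
  wheel : ¬ HasEvenWheel G

/-- The vertices `g a, …, g (b - 1)`. -/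
def seg (g : ℕ → V) (a b : ℕ) : Set V := {v | ∃ s, a ≤ s ∧ s < b ∧ v = g s}

/-- On the path `g 0, …, g m`, the vertex `c` is adjacent to exactly `g i` and `g (i + 1)`. -/
def AtEdge (G : SimpleGraph V) (c : V) (g : ℕ → V) (m i : ℕ) : Prop :=
  i + 1 ≤ m ∧ ∀ s ≤ m, (G.Adj c (g s) ↔ s = i ∨ s = i + 1)

theorem mem_seg {g : ℕ → V} {a b : ℕ} {v : V} : v ∈ seg g a b ↔ ∃ s, a ≤ s ∧ s < b ∧ v = g s :=
  Iff.rfl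

theorem mem_seg_of {g : ℕ → V} {a b s : ℕ} (h1 : a ≤ s) (h2 : s < b) : g s ∈ seg g a b :=
  ⟨s, h1, h2, rfl⟩

/-- `i` or `j` exceeds `m`. -/
def Out (m i j : ℕ) : Prop := m < i ∨ m < j

/-- `i` and `j` are consecutive. -/
def Nx (i j : ℕ) : Prop := j = i + 1 ∨ i = j + 1

/-- `i` is `0` or `m`. -/
def IsEnd (m i : ℕ) : Prop := i = 0 ∨ i = m

/-- `s` lies in the half-open interval from `a` to `b`. -/
def InRange (a b s : ℕ) : Prop := a ≤ s ∧ s < b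

@[grind =] theorem out_iff {m i j : ℕ} : Out m i j ↔ m < i ∨ m < j := Iff.rfl

@[grind =] theorem nx_iff {i j : ℕ} : Nx i j ↔ j = i + 1 ∨ i = j + 1 := Iff.rfl

@[grind =] theorem isEnd_iff {m i : ℕ} : IsEnd m i ↔ i = 0 ∨ i = m := Iff.rfl

@[grind =] theorem inRange_iff {a b s : ℕ} : InRange a b s ↔ a ≤ s ∧ s < b := Iff.rfl

@[grind =] theorem mem_seg_iff {g : ℕ → V} {a b : ℕ} {v : V} :
    v ∈ seg g a b ↔ ∃ s, InRange a b s ∧ v = g s := by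
  simp only [mem_seg, InRange, and_assoc]

/-- The range conditions become an alternative `Out`, so the facts hold for arbitrary indices and
can be passed to `grind` as they stand. -/
theorem IndPath.facts {g : ℕ → V} {m : ℕ} (h : IndPath G g m) :
    (∀ i j, g i = g j → i = j ∨ Out m i j) ∧
    (∀ i j, Out m i j ∨ (G.Adj (g i) (g j) ↔ Nx i j)) ∧ (∀ a b, G.Adj a b → G.Adj b a) := by
  refine ⟨fun i j e => ?_, fun i j => ?_, fun _ _ => .symm⟩
  · by_cases hO : Out m i j
    · exact .inr hO
    · unfold Out at hO; exact .inl (h.inj (by omega) (by omega) e)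
  · by_cases hO : Out m i j
    · exact .inl hO
    · unfold Out at hO; exact .inr (h.adj_iff (by omega) (by omega))

theorem HoleOn.facts {g : ℕ → V} {m : ℕ} {o : V} (h : HoleOn G o g m) :
    (∀ i j, g i = g j → i = j ∨ Out m i j) ∧
    (∀ i j, Out m i j ∨ (G.Adj (g i) (g j) ↔ Nx i j)) ∧
    (∀ i, o = g i → Out m i i) ∧ (∀ i, Out m i i ∨ (G.Adj o (g i) ↔ IsEnd m i)) ∧
    2 ≤ m ∧ (∀ a b, G.Adj a b → G.Adj b a) := by
  refine ⟨h.path.facts.1, h.path.facts.2.1, fun i e => ?_, fun i => ?_, h.two_le, fun _ _ => .symm⟩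
  · by_contra hO; unfold Out at hO; exact h.ne i (by omega) e
  · by_cases hO : Out m i i
    · exact .inl hO
    · unfold Out at hO; exact .inr (h.adj i (by omega))

theorem exists_first {P : ℕ → Prop} {k : ℕ} (h : P k) : ∃ a ≤ k, P a ∧ ∀ s < a, ¬ P s := by
  classical
  exact ⟨Nat.find ⟨k, h⟩, Nat.find_min' _ h, Nat.find_spec ⟨k, h⟩, fun s hs => Nat.find_min _ hs⟩

theorem exists_last {P : ℕ → Prop} {k m : ℕ} (hk : k ≤ m) (h : P k) :
    ∃ b, k ≤ b ∧ b ≤ m ∧ P b ∧ ∀ s, b < s → s ≤ m → ¬ P s := by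
  classical
  exact ⟨Nat.findGreatest P m, Nat.le_findGreatest hk h, Nat.findGreatest_le m,
    Nat.findGreatest_spec hk h, fun s h1 h2 => Nat.findGreatest_is_greatest h1 h2⟩

section deg

variable [Finite V]

theorem deg_union (c : V) {S T : Set V} (h : ∀ v ∈ S, v ∉ T) :
    deg G c (S ∪ T) = deg G c S + deg G c T := by
  unfold deg
  rw [← Set.ncard_union_eq (Set.disjoint_left.2 fun v h1 h2 => h v h1.1 h2.1)
    (Set.toFinite _) (Set.toFinite _)]
  congr 1
  ext v; simp only [nbrsIn, Set.mem_union, Set.mem_ofPred_eq]; tauto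

theorem deg_insert_adj {c x : V} {S : Set V} (h : x ∉ S) (hc : G.Adj c x) :
    deg G c (insert x S) = deg G c S + 1 := by
  rw [Set.insert_eq, deg_union c (by rintro v rfl; exact h), add_comm]
  congr 1
  rw [deg, Set.ncard_eq_one]
  refine ⟨x, ?_⟩
  ext v; simp only [nbrsIn, Set.mem_singleton_iff, Set.mem_ofPred_eq]
  exact ⟨fun h => h.1, by rintro rfl; exact ⟨rfl, hc⟩⟩

omit [Finite V] in
theorem deg_insert_not_adj {c x : V} {S : Set V} (hc : ¬ G.Adj c x) :
    deg G c (insert x S) = deg G c S := by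
  unfold deg
  congr 1
  ext v; simp only [nbrsIn, Set.mem_insert_iff, Set.mem_ofPred_eq]
  constructor
  · rintro ⟨rfl | h, h'⟩
    · exact absurd h' hc
    · exact ⟨h, h'⟩
  · rintro ⟨h, h'⟩; exact ⟨.inr h, h'⟩

omit [Finite V] in
theorem deg_eq_zero {c : V} {S : Set V} (h : ∀ v ∈ S, ¬ G.Adj c v) : deg G c S = 0 := by
  unfold deg
  rw [show nbrsIn G c S = ∅ from Set.eq_empty_iff_forall_notMem.2 fun v hv => h v hv.1 hv.2,
    Set.ncard_empty]

theorem deg_ne_zero {c : V} {S : Set V} : deg G c S ≠ 0 ↔ ∃ v ∈ S, G.Adj c v := by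
  unfold deg
  rw [Ne, Set.ncard_eq_zero, ← Ne, ← Set.nonempty_iff_ne_empty]
  exact ⟨fun ⟨v, h⟩ => ⟨v, h.1, h.2⟩, fun ⟨v, h1, h2⟩ => ⟨v, h1, h2⟩⟩

omit [Finite V] in
theorem deg_eq_one {c x : V} {S : Set V} (h : ∀ v ∈ S, G.Adj c v ↔ v = x) (hx : x ∈ S) :
    deg G c S = 1 := by
  rw [deg, Set.ncard_eq_one]
  refine ⟨x, ?_⟩
  ext v; simp only [nbrsIn, Set.mem_singleton_iff, Set.mem_ofPred_eq]
  exact ⟨fun h' => (h v h'.1).1 h'.2, by rintro rfl; exact ⟨hx, (h _ hx).2 rfl⟩⟩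

omit [Finite V] in
theorem deg_eq_two {c : V} {S : Set V} (h : deg G c S = 2) : ∃ u v, u ≠ v ∧ u ∈ S ∧ v ∈ S ∧
    ∀ s ∈ S, G.Adj c s ↔ s = u ∨ s = v := by
  obtain ⟨u, v, huv, e⟩ := Set.ncard_eq_two.1 h
  have hm : ∀ s, s ∈ nbrsIn G c S ↔ s = u ∨ s = v := by intro s; rw [e]; simp
  refine ⟨u, v, huv, ((hm u).2 (.inl rfl)).1, ((hm v).2 (.inr rfl)).1, fun s hs => ?_⟩
  rw [← hm]; exact ⟨fun h => ⟨hs, h⟩, fun h => h.2⟩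

end deg

theorem seg_cat (g h : ℕ → V) (m n : ℕ) :
    seg (cat g m h) 0 (m + 1 + n) = seg g 0 (m + 1) ∪ seg h 0 n := by
  ext v
  simp only [mem_seg, Set.mem_union, cat]
  constructor
  · rintro ⟨s, -, hs, e⟩
    split_ifs at e
    · exact .inl ⟨s, by omega, by omega, e⟩
    · exact .inr ⟨s - (m + 1), by omega, by omega, e⟩
  · rintro (⟨s, -, hs, e⟩ | ⟨s, -, hs, e⟩)
    · exact ⟨s, by omega, by omega, by rw [if_pos (by omega)]; exact e⟩
    · refine ⟨s + (m + 1), by omega, by omega, ?_⟩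
      rw [if_neg (by omega), Nat.add_sub_cancel]; exact e

theorem seg_rev (g : ℕ → V) (m : ℕ) : seg (fun s => g (m - s)) 0 (m + 1) = seg g 0 (m + 1) := by
  ext v
  simp only [mem_seg]
  constructor
  · rintro ⟨s, -, hs, e⟩
    exact ⟨m - s, by omega, by omega, e⟩
  · rintro ⟨s, -, hs, e⟩
    exact ⟨m - s, by omega, by omega, by rw [show m - (m - s) = s by omega]; exact e⟩

theorem seg_shift (g : ℕ → V) (a k : ℕ) : seg (fun s => g (a + s)) 0 k = seg g a (a + k) := by
  ext v
  simp only [mem_seg]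
  constructor
  · rintro ⟨s, -, hs, e⟩
    exact ⟨a + s, by omega, by omega, e⟩
  · rintro ⟨s, h1, hs, e⟩
    exact ⟨s - a, by omega, by omega, by rw [show a + (s - a) = s by omega]; exact e⟩

theorem seg_split (g : ℕ → V) {a b c : ℕ} (h1 : a ≤ b) (h2 : b ≤ c) :
    seg g a c = seg g a b ∪ seg g b c := by
  ext v
  simp only [mem_seg, Set.mem_union]
  constructor
  · rintro ⟨s, h3, h4, e⟩
    rcases Nat.lt_or_ge s b with h | h
    · exact .inl ⟨s, h3, h, e⟩
    · exact .inr ⟨s, h, h4, e⟩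
  · rintro (⟨s, h3, h4, e⟩ | ⟨s, h3, h4, e⟩)
    · exact ⟨s, h3, by omega, e⟩
    · exact ⟨s, by omega, h4, e⟩

theorem seg_Iic (g : ℕ → V) (m : ℕ) : g '' Set.Iic m = seg g 0 (m + 1) := by
  ext v
  simp only [mem_seg, Set.mem_image, Set.mem_Iic]
  constructor
  · rintro ⟨s, h, e⟩; exact ⟨s, by omega, by omega, e.symm⟩
  · rintro ⟨s, -, h, e⟩; exact ⟨s, by omega, e.symm⟩

theorem seg_one (g : ℕ → V) (a : ℕ) : seg g a (a + 1) = {g a} := by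
  ext v
  simp only [mem_seg, Set.mem_singleton_iff]
  constructor
  · rintro ⟨s, h1, h2, e⟩; obtain rfl : s = a := by omega
    exact e
  · rintro e; exact ⟨a, le_rfl, by omega, e⟩

/-- A segment of an induced path links its ends through its interior. -/
theorem IndPath.link {g : ℕ → V} {m : ℕ} (hg : IndPath G g m) {i j : ℕ} (hij : i ≤ j) (hj : j ≤ m)
    {S : Set V} (hS : seg g (i + 1) j ⊆ S) (hi : g i ∈ S) (hj' : g j ∈ S) :
    Link G S (g i) (g j) := by
  refine hg.link_le hij hj fun s h1 h2 => ?_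
  rcases Nat.eq_or_lt_of_le h1 with rfl | h1
  · exact hi
  rcases Nat.eq_or_lt_of_le h2 with rfl | h2
  · exact hj'
  exact hS ⟨s, h1, h2, rfl⟩

theorem IndPath.ac_seg {g : ℕ → V} {m : ℕ} (hg : IndPath G g m) {a b c d : ℕ} (hbc : b < c)
    (hd : d ≤ m + 1) : AC G (seg g a b) (seg g c d) := by
  rintro _ ⟨s, h1, h2, rfl⟩ _ ⟨t, h3, h4, rfl⟩
  have := hg s t (by omega) (by omega)
  exact ⟨this.1, by rw [this.2]; omega⟩

variable [Finite V]

omit [Finite V] in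
-- An even number other than `0` and `2` is at least three, so it would make an even wheel.
theorem HoleOn.deg_ne_four (hG : Good G) {o : V} {g : ℕ → V} {m : ℕ} (h : HoleOn G o g m) {c : V}
    (hco : c ≠ o) (hcg : ∀ i ≤ m, c ≠ g i)
    (he : Even (deg G c (insert o (seg g 0 (m + 1))))) :
    deg G c (insert o (seg g 0 (m + 1))) = 0 ∨ deg G c (insert o (seg g 0 (m + 1))) = 2 := by
  by_contra hne
  refine hG.wheel (h.hasEvenWheel hco hcg ?_ ?_) <;> rw [seg_Iic]
  · obtain ⟨k, hk⟩ := he; omega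
  · exact he

/-- A vertex with an even positive number of neighbours on a hole, none of them `o`, has exactly
two, and they are adjacent. -/
theorem HoleOn.exists_atEdge (hG : Good G) {o : V} {g : ℕ → V} {m : ℕ} (h : HoleOn G o g m) {c : V}
    (hco : c ≠ o) (hcg : ∀ i ≤ m, c ≠ g i) (hno : ¬ G.Adj c o)
    (he : Even (deg G c (seg g 0 (m + 1)))) {k : ℕ} (hk : k ≤ m) (hck : G.Adj c (g k)) :
    ∃ i, AtEdge G c g m i := by
  have h2 := h.deg_ne_four hG hco hcg (by rwa [deg_insert_not_adj hno])
  rw [deg_insert_not_adj hno] at h2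
  have h0 : deg G c (seg g 0 (m + 1)) ≠ 0 := deg_ne_zero.2 ⟨_, ⟨k, by omega, by omega, rfl⟩, hck⟩
  obtain ⟨u, v, huv, ⟨i, -, hi, rfl⟩, ⟨j, -, hj, rfl⟩, hN⟩ := deg_eq_two (h2.resolve_left h0)
  wlog hij : i < j generalizing i j
  · refine this j hj i hi huv.symm (fun s hs => ?_) ?_
    · rw [hN s hs]; tauto
    · rcases Nat.lt_or_ge j i with h | h
      · exact h
      · exact absurd (congrArg g (show i = j by omega)) huv
  have hN' : ∀ s ≤ m, (G.Adj c (g s) ↔ s = i ∨ s = j) := by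
    intro s hs
    rw [hN _ ⟨s, by omega, by omega, rfl⟩]
    constructor
    · rintro (e | e)
      · exact .inl (h.path.inj hs (by omega) e)
      · exact .inr (h.path.inj hs (by omega) e)
    · rintro (rfl | rfl) <;> simp
  have hci := (hN' i (by omega)).2 (.inl rfl)
  have hcj := (hN' j (by omega)).2 (.inr rfl)
  by_cases hj' : j = i + 1
  · subst hj'; exact ⟨i, by omega, hN'⟩
  exfalso
  -- Two non-adjacent neighbours of `c` are the ends of a theta whose paths are the two arcs of the
  -- hole and the path through `c`.
  refine hG.theta (hasTheta_of_link (s := g i) (t := g j) (S₁ := seg g (i + 1) j) (S₂ := {c})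
    (S₃ := insert o (seg g 0 i ∪ seg g (j + 1) (m + 1))) huv ?_ ?_ ?_ ?_ ?_ ?_ ?_)
  · rw [h.path.adj_iff (by omega) (by omega)]; omega
  · rintro _ ⟨s, h1, h2, rfl⟩ _ rfl
    refine ⟨(hcg s (by omega)).symm, fun e => ?_⟩
    have := (hN' s (by omega)).1 e.symm; omega
  · rintro _ ⟨s, h1, h2, rfl⟩ _ (rfl | ⟨t, h3, h4, rfl⟩ | ⟨t, h3, h4, rfl⟩)
    · refine ⟨(h.ne s (by omega)).symm, fun e => ?_⟩
      have := (h.adj s (by omega)).1 e.symm; omega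
    · rw [Ne, h.path.adj_iff (by omega) (by omega)]
      exact ⟨fun e => by have := h.path.inj (by omega) (by omega) e; omega, by omega⟩
    · rw [Ne, h.path.adj_iff (by omega) (by omega)]
      exact ⟨fun e => by have := h.path.inj (by omega) (by omega) e; omega, by omega⟩
  · rintro _ rfl _ (rfl | ⟨t, h3, h4, rfl⟩ | ⟨t, h3, h4, rfl⟩)
    · exact ⟨hco, hno⟩
    · refine ⟨hcg t (by omega), fun e => ?_⟩
      have := (hN' t (by omega)).1 e; omega
    · refine ⟨hcg t (by omega), fun e => ?_⟩
      have := (hN' t (by omega)).1 e; omega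
  · exact h.path.link hij.le (by omega) (fun v hv => .inr (.inr hv)) (by simp) (by simp)
  · exact (Link.of_adj hci.symm (by simp) (by simp)).trans (Link.of_adj hcj (by simp) (by simp))
  · have e1 := (h.adj 0 (by omega)).2 (.inl rfl)
    have e2 := (h.adj m (by omega)).2 (.inr rfl)
    have m0 : g 0 ∈ insert (g i) (insert (g j) (insert o (seg g 0 i ∪ seg g (j + 1) (m + 1)))) := by
      rcases Nat.eq_zero_or_pos i with rfl | hi0
      · simp
      · exact .inr (.inr (.inr (.inl ⟨0, by omega, by omega, rfl⟩)))
    have m1 : g m ∈ insert (g i) (insert (g j) (insert o (seg g 0 i ∪ seg g (j + 1) (m + 1)))) := by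
      rcases Nat.eq_or_lt_of_le (show j ≤ m by omega) with rfl | hi0
      · simp
      · exact .inr (.inr (.inr (.inr ⟨m, by omega, by omega, rfl⟩)))
    refine (h.path.link (Nat.zero_le i) (by omega) ?_ m0 (by simp)).symm.trans
      ((Link.of_adj e1.symm m0 (by simp)).trans ((Link.of_adj e2 (by simp) m1).trans
      (h.path.link (show j ≤ m by omega) (by omega) ?_ (by simp) m1).symm))
    · rintro _ ⟨s, h1, h2, rfl⟩
      exact .inr (.inr (.inr (.inl ⟨s, by omega, by omega, rfl⟩)))
    · rintro _ ⟨s, h1, h2, rfl⟩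
      exact .inr (.inr (.inr (.inr ⟨s, by omega, by omega, rfl⟩)))

end Kaleidoscope

/-! ### Parity and attachment of a vertex linked to a hole. -/

namespace Kaleidoscope

variable {V : Type*} {G : SimpleGraph V}

theorem exists_first_last {P : ℕ → Prop} {k m : ℕ} (hk : k ≤ m) (h : P k) :
    ∃ a b, a ≤ k ∧ k ≤ b ∧ b ≤ m ∧ P a ∧ P b ∧ ∀ s ≤ m, P s → a ≤ s ∧ s ≤ b := by
  obtain ⟨a, h1, h2, h3⟩ := exists_first h
  obtain ⟨b, h4, h5, h6, h7⟩ := exists_last hk h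
  refine ⟨a, b, h1, h4, h5, h2, h6, fun s hs hP => ⟨?_, ?_⟩⟩
  · by_contra hlt; exact h3 s (by omega) hP
  · by_contra hlt; exact h7 s (by omega) hs hP

theorem HoleOn.link_left {o : V} {g : ℕ → V} {m : ℕ} (h : HoleOn G o g m) {i : ℕ} (hi : i ≤ m)
    {S : Set V} (ho : o ∈ S) (hS : ∀ s ≤ i, g s ∈ S) : Link G S o (g i) :=
  (Link.of_adj ((h.adj 0 (by omega)).2 (.inl rfl)) ho (hS 0 (by omega))).trans
    (h.path.link_le (Nat.zero_le i) hi fun s _ hs => hS s hs)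

theorem HoleOn.link_right {o : V} {g : ℕ → V} {m : ℕ} (h : HoleOn G o g m) {i : ℕ} (hi : i ≤ m)
    {S : Set V} (ho : o ∈ S) (hS : ∀ s, i ≤ s → s ≤ m → g s ∈ S) : Link G S o (g i) :=
  (Link.of_adj ((h.adj m le_rfl).2 (.inr rfl)) ho (hS m hi le_rfl)).trans
    (h.path.link_ge hi le_rfl hS)

theorem exists_of_deg_eq_one {c : V} {S : Set V} (h : deg G c S = 1) :
    ∃ u ∈ S, ∀ s ∈ S, G.Adj c s ↔ s = u := by
  obtain ⟨u, e⟩ := Set.ncard_eq_one.1 h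
  have hm : ∀ s, s ∈ nbrsIn G c S ↔ s = u := by intro s; rw [e]; simp
  exact ⟨u, ((hm u).2 rfl).1, fun s hs => by rw [← hm]; exact ⟨fun h => ⟨hs, h⟩, fun h => h.2⟩⟩

/-- Were the number odd, counting `o` would make it even, hence two. The one remaining neighbour `g
i` is not adjacent to `o`, so `o` and `g i` are the ends of a theta formed by the two arcs and `c`.
-/
theorem HoleOn.even_deg [Finite V] (hG : Good G) {o : V} {g : ℕ → V} {m : ℕ} (h : HoleOn G o g m)
    {c : V} (hcg : ∀ i ≤ m, c ≠ g i) (hco : G.Adj c o) (hc0 : ¬ G.Adj c (g 0))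
    (hcm : ¬ G.Adj c (g m)) : Even (deg G c (seg g 0 (m + 1))) := by
  by_contra hodd
  rw [Nat.not_even_iff_odd] at hodd
  have hins : deg G c (insert o (seg g 0 (m + 1))) = deg G c (seg g 0 (m + 1)) + 1 := by
    refine deg_insert_adj ?_ hco
    rintro ⟨s, -, hs, e⟩; exact h.ne s (by omega) e
  have h2 := h.deg_ne_four hG hco.ne hcg (by rw [hins]; exact hodd.add_one)
  rw [hins] at h2
  obtain ⟨_, ⟨i, -, hi, rfl⟩, hN⟩ :=
    exists_of_deg_eq_one (show deg G c (seg g 0 (m + 1)) = 1 by omega)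
  have hN' : ∀ s, Out m s s ∨ (G.Adj c (g s) ↔ s = i) := by
    intro s
    by_cases hs : s ≤ m
    · right
      rw [hN _ ⟨s, by omega, by omega, rfl⟩]
      exact ⟨h.path.inj hs (by omega), congrArg g⟩
    · grind
  have hf := h.facts
  have hn : ∀ s, c = g s → Out m s s := by grind
  clear hN hcg
  have i0 : i ≠ 0 := by grind
  have im : i ≠ m := by grind
  refine hG.theta (hasTheta_of_link (s := o) (t := g i) (S₁ := seg g 0 i)
    (S₂ := seg g (i + 1) (m + 1)) (S₃ := {c}) ?_ ?_ ?_ ?_ ?_ ?_ ?_ ?_)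
  · grind
  · grind
  · exact h.path.ac_seg (by omega) le_rfl
  · intro u hu v hv; grind
  · intro u hu v hv; grind
  · refine h.link_left (by omega) ?_ ?_ <;> grind
  · refine h.link_right (by omega) ?_ ?_ <;> grind
  · exact (Link.of_adj hco.symm (by simp) (by simp)).trans
      (Link.of_adj (by grind) (by simp) (by simp))

/-- A vertex outside a hole that is linked to the vertex `o` of the hole away from the rest of the
hole attaches to the rest of the hole in an edge, or not at all. -/
theorem HoleOn.atEdge_of_link (hG : Good G) {o : V} {g : ℕ → V} {m : ℕ} (h : HoleOn G o g m)
    {c : V} (hcg : ∀ i ≤ m, c ≠ g i) (hne : c ≠ o) (hco : ¬ G.Adj c o) (hc0 : ¬ G.Adj c (g 0))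
    (hcm : ¬ G.Adj c (g m)) {R : Set V} (hR : ∀ r ∈ R, ∀ i ≤ m, r ≠ g i ∧ ¬ G.Adj r (g i))
    (hl : Link G (insert o (insert c R)) o c) {k : ℕ} (hk : k ≤ m) (hck : G.Adj c (g k)) :
    ∃ i, AtEdge G c g m i := by
  obtain ⟨i, j, hik, hkj, hjm, hci, hcj, hN⟩ :=
    exists_first_last (P := fun s => G.Adj c (g s)) hk hck
  have hf := h.facts
  have hn : ∀ s, c = g s → Out m s s := by grind
  have hr : ∀ r ∈ R, ∀ i, (r = g i → Out m i i) ∧ (G.Adj r (g i) → Out m i i) := by grind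
  have hN' : ∀ s, G.Adj c (g s) → Out m s s ∨ InRange i (j + 1) s := by grind
  clear hcg hN hR
  have i0 : i ≠ 0 := by rintro rfl; exact hc0 hci
  have im : j ≠ m := by rintro rfl; exact hcm hcj
  -- Here `g i` and `g j` are the first and last neighbours of `c`. If they coincide, there is a
  -- theta with ends `o` and `g j`; if they are more than one step apart, there is one with ends `o`
  -- and `c`. In both, the link through `R` supplies the third path.
  by_cases hij : j = i
  · exfalso
    subst hij
    refine hG.theta (hasTheta_of_link (s := o) (t := g j) (S₁ := seg g 0 j)
      (S₂ := seg g (j + 1) (m + 1)) (S₃ := insert c R) ?_ ?_ ?_ ?_ ?_ ?_ ?_ ?_)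
    · grind
    · grind
    · exact h.path.ac_seg (by omega) le_rfl
    · intro u hu v hv; grind
    · intro u hu v hv; grind
    · refine h.link_left (by omega) ?_ ?_ <;> grind
    · refine h.link_right (by omega) ?_ ?_ <;> grind
    · exact (hl.mono (by intro v hv; grind)).trans (Link.of_adj hcj (by simp) (by simp))
  by_cases hij' : j = i + 1
  · exact ⟨i, by omega, fun s hs => ⟨by grind, by grind⟩⟩
  exfalso
  refine hG.theta (hasTheta_of_link (s := o) (t := c) (S₁ := seg g 0 (i + 1))
      (S₂ := seg g j (m + 1)) (S₃ := R) ?_ ?_ ?_ ?_ ?_ ?_ ?_ hl)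
  · exact hne.symm
  · grind
  · exact h.path.ac_seg (by omega) le_rfl
  · intro u hu v hv; grind
  · intro u hu v hv; grind
  · refine (h.link_left (i := i) (by omega) ?_ ?_).trans (Link.of_adj hci.symm ?_ ?_) <;> grind
  · refine (h.link_right (i := j) (by omega) ?_ ?_).trans (Link.of_adj hcj.symm ?_ ?_) <;> grind

/-- If the ends of an induced path with an even number, at least four, of neighbours of `z` are
linked through vertices away from `z` and from the interior of the path, there is an even wheel. -/
theorem IndPath.hasEvenWheel [Finite V] {g : ℕ → V} {m : ℕ} (hg : IndPath G g m) (hm : 2 ≤ m)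
    {z : V} (hz : ∀ i ≤ m, z ≠ g i) (h4 : 4 ≤ deg G z (seg g 0 (m + 1)))
    (he : Even (deg G z (seg g 0 (m + 1)))) {S : Set V} (hzS : ∀ v ∈ S, z ≠ v ∧ ¬ G.Adj z v)
    (hS : ∀ v ∈ S, ∀ i, 0 < i → i < m → v ≠ g i ∧ ¬ G.Adj v (g i))
    (hl : Link G (insert (g 0) (insert (g m) S)) (g 0) (g m)) : HasEvenWheel G := by
  obtain ⟨h, n, hh, h0, hn, hin⟩ := hl.exists_indPath (by simp)
  have n2 : 2 ≤ n := by
    by_contra hlt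
    have a1 := hg 0 m (by omega) le_rfl
    have : n = 0 ∨ n = 1 := by omega
    rcases this with rfl | rfl
    · grind
    · have := (hh 0 1 (by omega) le_rfl).2; grind
  have hin' : ∀ i, InRange 1 n i → h i ∈ S := by
    intro i hi
    have a := hin i (by grind)
    have b1 := (hh 0 i (by grind) (by grind)).1
    have b2 := (hh i n (by grind) (by grind)).1
    grind
  have hSS : ∀ v ∈ S, ∀ i, (v = g i ∨ G.Adj v (g i)) → i = 0 ∨ Out (m - 1) i i := by
    intro v hv i; have := hS v hv i; grind
  have f1 := hg.facts; have f2 := hh.facts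
  clear hS hin
  -- The rim, based at `g 0`: up along `g 1, …, g m` and back along `h (n - 1), …, h 1`, the
  -- interior of an induced path through `S`.
  set q : ℕ → V := Kaleidoscope.cat (fun s => g (1 + s)) (m - 1) (fun s => h (n - 1 - s)) with hq
  have hq1 : ∀ i, i ≤ m - 1 → q i = g (1 + i) := fun i hi => by simp [hq, Kaleidoscope.cat, hi]
  have hq2 : ∀ i, m - 1 < i → q i = h (n - 1 - (i - m)) := fun i hi => by
    simp only [hq, Kaleidoscope.cat]; rw [if_neg (by omega)]; congr 2; omega
  have hpath : IndPath G q (m - 1 + 1 + (n - 2)) := by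
    refine (hg.sub 1 (by omega)).cat ((hh.rev (k := n - 1) (by omega)).le (by omega)) ?_
    intro i hi j hj
    have := hin' (n - 1 - j) (by grind)
    have := hSS _ this (1 + i)
    rcases Nat.eq_or_lt_of_le hi with rfl | hi'
    · have e : g (1 + (m - 1)) = h n := by rw [hn]; congr 1; omega
      simp only [e]
      grind
    · grind
  have hhole : HoleOn G (g 0) q (m - 1 + 1 + (n - 2)) := by
    refine ⟨hpath, by omega, ?_, ?_⟩
    · intro i hi
      by_cases h' : i ≤ m - 1
      · rw [hq1 i h']; grind
      · rw [hq2 i (by omega), ← h0]; grind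
    · intro i hi
      by_cases h' : i ≤ m - 1
      · rw [hq1 i h']; grind
      · rw [hq2 i (by omega), ← h0, hh.adj_iff (by omega) (by omega)]; omega
  have hseg : insert (g 0) (seg q 0 (m - 1 + 1 + (n - 2) + 1)) =
      seg g 0 (m + 1) ∪ seg (fun s => h (n - 1 - s)) 0 (n - 1) := by
    rw [show m - 1 + 1 + (n - 2) + 1 = m - 1 + 1 + (n - 1) by omega, hq, seg_cat, seg_shift,
      ← Set.insert_union]
    congr 1
    rw [seg_split g (Nat.zero_le 1) (by omega : 1 ≤ m + 1), show seg g 0 1 = {g 0} from seg_one g 0,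
      Set.singleton_union]
    congr 2; omega
  have hdeg : deg G z (insert (g 0) (seg q 0 (m - 1 + 1 + (n - 2) + 1))) =
      deg G z (seg g 0 (m + 1)) := by
    rw [hseg, deg_union, deg_eq_zero (S := seg (fun s => h (n - 1 - s)) 0 (n - 1)), Nat.add_zero]
    · rintro _ ⟨s, h1, h2, rfl⟩
      exact (hzS _ (hin' _ (by grind))).2
    · rintro _ ⟨s, h1, h2, rfl⟩ ⟨t, h3, h4, e⟩
      have := hin' (n - 1 - t) (by grind)
      grind
  refine hhole.hasEvenWheel (c := z) (hz 0 (by omega)) ?_ ?_ ?_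
  · intro i hi
    by_cases h' : i ≤ m - 1
    · rw [hq1 i h']; exact hz _ (by omega)
    · rw [hq2 i (by omega)]; exact (hzS _ (hin' _ (by grind))).1
  · rw [seg_Iic, hdeg]; omega
  · rw [seg_Iic, hdeg]; exact he

end Kaleidoscope

/-! ### Two attachments to the same hole, and the arms at `z`. -/

namespace Kaleidoscope

variable {V : Type*} {G : SimpleGraph V}

theorem AtEdge.facts {c : V} {g : ℕ → V} {m i : ℕ} (h : AtEdge G c g m i) :
    i + 1 ≤ m ∧ G.Adj c (g i) ∧ G.Adj c (g (i + 1)) ∧ ∀ s, G.Adj c (g s) → Out m s s ∨ s = i ∨ s = i + 1 := by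
  have h1 := h.1
  have h2 := h.2
  refine ⟨h1, by grind, by grind, fun s hs => ?_⟩
  by_cases hO : s ≤ m
  · grind
  · exact .inl (by grind)

theorem IndPath.pair {g : ℕ → V} {m : ℕ} (hg : IndPath G g m) {i j : ℕ} (hi : i ≤ m) (hj : j ≤ m) :
    (g i = g j ↔ i = j) ∧ (G.Adj (g i) (g j) ↔ j = i + 1 ∨ i = j + 1) :=
  ⟨⟨hg.inj hi hj, congrArg g⟩, hg.adj_iff hi hj⟩

theorem deg_eq_four [Finite V] {c s t u v : V} {S : Set V} (hs : s ∈ S) (ht : t ∈ S) (hu : u ∈ S)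
    (hv : v ∈ S) (hst : s ≠ t) (hsu : s ≠ u) (hsv : s ≠ v) (htu : t ≠ u) (htv : t ≠ v)
    (huv : u ≠ v) (h : ∀ w ∈ S, G.Adj c w ↔ w = s ∨ w = t ∨ w = u ∨ w = v) :
    deg G c S = 4 := by
  have : nbrsIn G c S = {s, t, u, v} := by
    ext w
    simp only [nbrsIn, Set.mem_ofPred_eq, Set.mem_insert_iff, Set.mem_singleton_iff]
    grind
  rw [deg, this, Set.ncard_insert_of_notMem (by simp [*]), Set.ncard_insert_of_notMem (by simp [*]),
    Set.ncard_pair huv]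

/-- An even wheel whose centre has exactly four neighbours, consecutive in two pairs around the
vertices `s` and `t`. -/
theorem hasEvenWheel_of_link [Finite V] {c s t b b' : V} {S₁ S₂ : Set V} (hne : s ≠ t)
    (hst : ¬ G.Adj s t) (h₁₂ : AC G S₁ S₂) (h₁ : Link G (insert s (insert t S₁)) s t)
    (h₂ : Link G (insert s (insert t S₂)) s t) (hb : ∀ v ∈ S₁, G.Adj s v → v = b)
    (hb' : ∀ v ∈ S₁, G.Adj t v → v = b') (hbb : b ≠ b') (hcs : G.Adj c s) (hct : G.Adj c t)
    (hcb : G.Adj c b) (hcb' : G.Adj c b')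
    (hc₁ : ∀ v ∈ S₁, c ≠ v ∧ (G.Adj c v → v = b ∨ v = b'))
    (hc₂ : ∀ v ∈ S₂, c ≠ v ∧ ¬ G.Adj c v) : HasEvenWheel G := by
  obtain ⟨g, m, hg, h0, hm, hin⟩ := h₁.exists_indPath (by simp)
  have m2 : 2 ≤ m := by
    by_contra hlt
    have : m = 0 ∨ m = 1 := by omega
    rcases this with rfl | rfl
    · grind
    · have := (hg 0 1 (by omega) le_rfl).2; grind
  have hin' : ∀ i, InRange 1 m i → g i ∈ S₁ := by
    intro i hi
    have a := hin i (by grind)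
    have b1 := (hg 0 i (by grind) (by grind)).1
    have b2 := (hg i m (by grind) (by grind)).1
    grind
  -- The path has to leave `s` through `b` and reach `t` through `b'`, so the neighbours of `c` on
  -- it are exactly `s`, `b`, `b'`, `t`.
  have e1 : g 1 = b := by
    refine hb _ (hin' 1 (by grind)) ?_
    rw [← h0, hg.adj_iff (by omega) (by omega)]; omega
  have e2 : g (m - 1) = b' := by
    refine hb' _ (hin' (m - 1) (by grind)) ?_
    rw [← hm, hg.adj_iff (by omega) (by omega)]; omega
  have m3 : 1 < m - 1 := by
    rcases Nat.lt_or_ge 1 (m - 1) with h | h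
    · exact h
    · have : m - 1 = 1 := by omega
      rw [this] at e2; exact absurd (e1.symm.trans e2) hbb
  have n1 := (hg 0 1 (by omega) (by omega)).1
  have n2 := (hg 0 (m - 1) (by omega) (by omega)).1
  have n3 := (hg 1 m (by omega) (by omega)).1
  have n4 := (hg (m - 1) m (by omega) (by omega)).1
  have hdeg : deg G c (seg g 0 (m + 1)) = 4 := by
    refine deg_eq_four (s := s) (t := t) (u := b) (v := b') ?_ ?_ ?_ ?_ hne ?_ ?_ ?_ ?_ hbb ?_
    · rw [← h0]; exact mem_seg_of (by omega) (by omega)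
    · rw [← hm]; exact mem_seg_of (by omega) (by omega)
    · rw [← e1]; exact mem_seg_of (by omega) (by omega)
    · rw [← e2]; exact mem_seg_of (by omega) (by omega)
    · grind
    · grind
    · grind
    · grind
    · rintro _ ⟨i, -, hi, rfl⟩
      have a := hin i (by omega)
      grind
  refine hg.hasEvenWheel m2 (z := c) ?_ (by omega) (by rw [hdeg]; decide) (S := S₂) hc₂ ?_ ?_
  · intro i hi e
    have a := hin i hi
    have := hcs.ne; have := hct.ne
    grind
  · intro v hv i h1 h2
    have a := h₁₂ _ (hin' i (by grind)) v hv
    exact ⟨a.1.symm, fun e => a.2 e.symm⟩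
  · rw [h0, hm]; exact h₂

/-- Two vertices attaching to edges of a hole and linked to each other away from the hole attach
to the same edge. -/
theorem HoleOn.atEdge_eq [Finite V] (hG : Good G) {o : V} {g : ℕ → V} {m : ℕ} (h : HoleOn G o g m)
    {b b' : V} {S : Set V} (hb : ∀ i ≤ m, b ≠ g i) (hb' : ∀ i ≤ m, b' ≠ g i)
    (hbo : b ≠ o ∧ ¬ G.Adj b o) (hbo' : b' ≠ o ∧ ¬ G.Adj b' o) {a c : ℕ}
    (ha : AtEdge G b g m a) (hc : AtEdge G b' g m c)
    (hSo : ∀ v ∈ S, v ≠ o ∧ ¬ G.Adj v o) (hS : ∀ v ∈ S, ∀ i ≤ m, v ≠ g i ∧ ¬ G.Adj v (g i))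
    (hl : Link G (insert b (insert b' S)) b b') : a = c := by
  wlog hac : a < c generalizing a c b b'
  · rcases Nat.lt_or_ge c a with h' | h'
    · refine (this hb' hb hbo' hbo hc ha (hl.symm.mono (by intro v hv; grind)) h').symm
    · omega
  exfalso
  have hf := h.facts
  obtain ⟨c1, c2, c3, c4⟩ := hc.facts
  obtain ⟨a1, a2, a3, a4⟩ := ha.facts
  have n1 : ∀ i, b = g i → Out m i i := by grind
  have n2 : ∀ i, b' = g i → Out m i i := by grind
  have n3 : ∀ v ∈ S, ∀ i, (v = g i → Out m i i) ∧ (G.Adj v (g i) → Out m i i) := by grind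
  clear hb hb' hS ha hc
  have hbb : b ≠ b' := by rintro rfl; grind
  -- Disjoint edges give a prism, with one triangle on `b` and one on `b'`. Edges sharing `g (a +
  -- 1)` make that vertex the centre of an even wheel with neighbours `g a`, `b`, `b'`, `g (a + 2)`.
  rcases Nat.lt_or_ge (a + 1) c with hac' | hac'
  · refine hG.prism (hasPrism_of_link (a₁ := b) (a₂ := g (a + 1)) (a₃ := g a) (b₁ := b')
      (b₂ := g c) (b₃ := g (c + 1)) (S₁ := insert b (insert b' S)) (S₂ := seg g (a + 1) (c + 1))
      (S₃ := insert o (seg g 0 (a + 1) ∪ seg g (c + 1) (m + 1))) a3 a2 ?_ c2 c3 ?_ ?_ ?_ ?_ ?_ ?_ ?_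
      hbb ?_ ?_ ?_ ?_ ?_ hl ?_ ?_)
    · grind
    · grind
    · grind
    · grind
    · grind
    · grind
    · grind
    · grind
    · grind
    · grind
    · rintro u (rfl | rfl | hu) _ ⟨j, j1, j2, rfl⟩ <;> grind
    · rintro u (rfl | rfl | hu) _ (rfl | ⟨j, j1, j2, rfl⟩ | ⟨j, j1, j2, rfl⟩)
      · grind only
      · have := a4 j; have := n1 j; grind only [out_iff]
      · have := a4 j; have := n1 j; grind only [out_iff]
      · grind only
      · have := c4 j; have := n2 j; grind only [out_iff]
      · have := c4 j; have := n2 j; grind only [out_iff]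
      · grind only
      · have := n3 u hu j; grind only [out_iff]
      · have := n3 u hu j; grind only [out_iff]
    · rintro _ ⟨s, h1, h2, rfl⟩ _ (rfl | ⟨j, j1, j2, rfl⟩ | ⟨j, j1, j2, rfl⟩)
      · have := h.adj s (by omega); have := h.ne s (by omega); have := G.symm.symm; clear hf; grind
      · have := h.path.pair (i := s) (j := j) (by omega) (by omega); clear hf; grind
      · have := h.path.pair (i := s) (j := j) (by omega) (by omega); clear hf; grind
    · exact h.path.link_le (by omega) (by omega) (by grind)
    · refine ((h.link_left (i := a) (by omega) ?_ ?_).symm).trans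
        (h.link_right (i := c + 1) (by omega) ?_ ?_) <;> grind
  · obtain rfl : c = a + 1 := by omega
    refine hG.wheel (hasEvenWheel_of_link (c := g (a + 1)) (s := g a) (t := g (a + 2)) (b := b)
      (b' := b') (S₁ := insert b (insert b' S))
      (S₂ := insert o (seg g 0 a ∪ seg g (a + 3) (m + 1))) ?_ ?_ ?_ ?_ ?_ ?_ ?_ hbb ?_ ?_ ?_ ?_ ?_ ?_)
    · grind
    · grind
    · rintro u (rfl | rfl | hu) _ (rfl | ⟨j, j1, j2, rfl⟩ | ⟨j, j1, j2, rfl⟩)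
      · grind only
      · have := a4 j; have := n1 j; grind only [out_iff]
      · have := a4 j; have := n1 j; grind only [out_iff]
      · grind only
      · have := c4 j; have := n2 j; grind only [out_iff]
      · have := c4 j; have := n2 j; grind only [out_iff]
      · grind only
      · have := n3 u hu j; grind only [out_iff]
      · have := n3 u hu j; grind only [out_iff]
    · refine (Link.of_adj a2.symm ?_ ?_).trans ((hl.mono ?_).trans (Link.of_adj c3 ?_ ?_))
      · grind
      · grind
      · intro v hv; grind
      · grind
      · grind
    · refine ((h.link_left (i := a) (by omega) ?_ ?_).symm).trans
        (h.link_right (i := a + 2) (by omega) ?_ ?_) <;> grind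
    · intro v hv; grind
    · intro v hv; grind
    · grind
    · grind
    · grind
    · grind
    · intro v hv; grind
    · rintro _ (rfl | ⟨j, j1, j2, rfl⟩ | ⟨j, j1, j2, rfl⟩)
      · have := h.adj (a + 1) (by omega); have := h.ne (a + 1) (by omega); have := G.symm.symm; clear hf; grind
      · have := h.path.pair (i := a + 1) (j := j) (by omega) (by omega); clear hf; grind
      · have := h.path.pair (i := a + 1) (j := j) (by omega) (by omega); clear hf; grind

/-- A path through a neighbour `A 0` of `z` towards `x = A α`, and one through a neighbour
`B 0` of `z` towards `y = B β`, forming a path together; `z` has no further neighbours on the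
first, and every non-neighbour on the second is preceded by an odd number of neighbours. -/
structure Arms (G : SimpleGraph V) (z x y : V) (A : ℕ → V) (α : ℕ) (B : ℕ → V) (β : ℕ) :
    Prop where
  pathA : IndPath G A α
  pathB : IndPath G B β
  endA : A α = x
  endB : B β = y
  cross : ∀ s ≤ α, ∀ t ≤ β, A s ≠ B t ∧ (G.Adj (A s) (B t) ↔ s = 0 ∧ t = 0)
  neA : ∀ s ≤ α, z ≠ A s
  neB : ∀ t ≤ β, z ≠ B t
  adjA : ∀ s ≤ α, (G.Adj z (A s) ↔ s = 0)
  adjB : G.Adj z (B 0)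
  not_adj : ¬ G.Adj z (B β)
  one_le : 1 ≤ α
  odd : ∀ t ≤ β, ¬ G.Adj z (B t) → Odd (deg G z (seg B 0 (t + 1)))

/-- Two paths `A`, `B` from adjacent neighbours of `z` cannot attach to distinct edges of a hole
through `z`. -/
theorem HoleOn.not_twoArms (hG : Good G) {z : V} {g : ℕ → V} {m : ℕ} (h : HoleOn G z g m)
    {A B : ℕ → V} {p s a b : ℕ} (hp : 1 ≤ p) (hpA : IndPath G A p) (hpB : IndPath G B s)
    (a1 : a + 1 ≤ m) (a2 : G.Adj (A p) (g a))
    (a4 : ∀ i, G.Adj (A p) (g i) → Out m i i ∨ i = a ∨ i = a + 1)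
    (b1 : b + 1 ≤ m) (b2 : G.Adj (B s) (g b)) (b3 : G.Adj (B s) (g (b + 1)))
    (b4 : ∀ i, G.Adj (B s) (g i) → Out m i i ∨ i = b ∨ i = b + 1)
    (hzB : ∀ i, G.Adj z (B i) → i = 0 ∨ Out s i i) (hzA : ∀ i, G.Adj z (A i) → i = 0 ∨ Out p i i)
    (nA : ∀ i, z = A i → Out p i i) (nB : ∀ i, z = B i → Out s i i)
    (hAB : ∀ i j, (A i = B j → Out p i i ∨ Out s j j) ∧
      (G.Adj (A i) (B j) → Out p i i ∨ Out s j j ∨ (i = 0 ∧ j = 0)))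
    (uv : G.Adj (A 0) (B 0)) (zu : G.Adj z (A 0)) (zv : G.Adj z (B 0))
    (eA : ∀ i k, (A i = g k → Out p i i ∨ Out m k k) ∧
      (G.Adj (A i) (g k) → Out p i i ∨ Out m k k ∨ i = p))
    (eB : ∀ i k, (B i = g k → Out s i i ∨ Out m k k) ∧
      (G.Adj (B i) (g k) → Out s i i ∨ Out m k k ∨ i = s))
    (nB0 : B 0 ≠ B s) (hab : b < a) : False := by
  have adj1 : ∀ i ≤ m, ∀ j ≤ m, G.Adj (g i) (g j) ↔ j = i + 1 ∨ i = j + 1 :=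
    fun i hi j hj => h.path.adj_iff hi hj
  have inj1 : ∀ i ≤ m, ∀ j ≤ m, g i = g j → i = j := fun i hi j hj e => h.path.inj hi hj e
  have ho : ∀ i ≤ m, i < m → i ≠ 0 → ¬ G.Adj z (g i) := by
    intro i hi h1 h2; rw [h.adj i hi]; omega
  -- The triangles are `z, A 0, B 0` and `g b, g (b + 1), B s`. Because `b < a`, the arc from `z` to
  -- `g b` is disjoint from the arc from `g a` back to `g (b + 1)` which continues the arm `A`.
  refine hG.prism (hasPrism_of_link (a₁ := z) (a₂ := A 0) (a₃ := B 0) (b₁ := g b)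
    (b₂ := g (b + 1)) (b₃ := B s) (S₁ := insert z (seg g 0 (b + 1)))
    (S₂ := seg A 0 (p + 1) ∪ seg g (b + 1) (a + 1)) (S₃ := seg B 0 (s + 1)) zu zv uv
    ((h.path b (b + 1) (by omega) (by omega)).2.2 rfl) b2.symm
    b3.symm (by simp) (.inl (mem_seg_of le_rfl (by omega))) (mem_seg_of le_rfl (by omega))
    (.inr (mem_seg_of (by omega) (by omega))) (.inr (mem_seg_of (by omega) (by omega)))
    (mem_seg_of (by omega) (by omega)) (h.ne b (by omega)) ?_ nB0 ?_ ?_ ?_ ?_ ?_ ?_)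
  · have := eA 0 (b + 1); have := eA 0 a; grind
  · rintro u (rfl | ⟨i, i1, i2, rfl⟩) v (⟨j, j1, j2, rfl⟩ | ⟨j, j1, j2, rfl⟩)
    · have := hzA j; have := nA j; grind only [out_iff]
    · have := ho j (by omega) (by omega) (by omega); have := h.ne j (by omega); grind only
    · have := eA j i; have := a4 i; have := G.adj_comm (g i) (A j); grind only [out_iff]
    · have := inj1 i (by omega) j (by omega); have := adj1 i (by omega) j (by omega)
      grind only
  · rintro u (rfl | ⟨i, i1, i2, rfl⟩) v ⟨j, j1, j2, rfl⟩
    · have := hzB j; have := nB j; grind only [out_iff]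
    · have := eB j i; have := b4 i; have := G.adj_comm (g i) (B j); grind only [out_iff]
  · rintro u (⟨i, i1, i2, rfl⟩ | ⟨i, i1, i2, rfl⟩) v ⟨j, j1, j2, rfl⟩
    · have := hAB i j; grind only [out_iff]
    · have := eB j i; have := b4 i; have := G.adj_comm (g i) (B j); grind only [out_iff]
  · exact h.link_left (by omega) (by simp) fun s hs => .inr (mem_seg_of (by omega) (by omega))
  · refine (hpA.link_le (Nat.zero_le p) le_rfl
      fun s _ hs => .inl (mem_seg_of (by omega) (by omega))).trans ((Link.of_adj a2 ?_ ?_).trans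
      (h.path.link_ge (show b + 1 ≤ a by omega) (by omega)
      fun s _ hs => .inr (mem_seg_of (by omega) (by omega))))
    · exact .inl (mem_seg_of (by omega) (by omega))
    · exact .inr (mem_seg_of (by omega) (by omega))
  · exact hpB.link_le (Nat.zero_le s) le_rfl fun s _ hs => mem_seg_of (by omega) (by omega)

section Arms

variable [Finite V] {z x y : V} {A : ℕ → V} {α : ℕ} {B : ℕ → V} {β : ℕ}

/-- If the two arms attach to edges of the same hole through `z`, they attach to the same edge. -/
theorem Arms.atEdge_eq (hG : Good G) (H : Arms G z x y A α B β) {g : ℕ → V} {m : ℕ}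
    (h : HoleOn G z g m) {p s a b : ℕ} (hp : 1 ≤ p) (hpα : p ≤ α) (hs : s ≤ β)
    (hzs : ¬ G.Adj z (B s))
    (hA : ∀ i ≤ p, ∀ k ≤ m, A i ≠ g k ∧ (G.Adj (A i) (g k) → i = p))
    (hB : ∀ i ≤ s, ∀ k ≤ m, B i ≠ g k ∧ (G.Adj (B i) (g k) → i = s))
    (ha : AtEdge G (A p) g m a) (hb : AtEdge G (B s) g m b) : a = b := by
  have hodd := H.odd s hs hzs
  have s1 : 1 ≤ s := by
    rcases Nat.eq_zero_or_pos s with rfl | h'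
    · exact absurd H.adjB hzs
    · exact h'
  have hf := h.facts
  obtain ⟨a1, a2, a3, a4⟩ := ha.facts
  obtain ⟨b1, b2, b3, b4⟩ := hb.facts
  have hT : IndPath G (cat (fun i => A (p - i)) p B) (p + 1 + s) := by
    refine (H.pathA.rev hpα).cat (H.pathB.le hs) fun i hi j hj => ?_
    have := H.cross (p - i) (by omega) j (by omega)
    refine ⟨this.1, ?_⟩
    rw [this.2]; omega
  have hA1 : deg G z (seg A 0 (p + 1)) = 1 := by
    refine deg_eq_one (x := A 0) ?_ (by grind)
    rintro _ ⟨i, -, hi, rfl⟩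
    rw [H.adjA i (by omega)]
    exact ⟨fun e => by rw [e], fun e => H.pathA.inj (by omega) (by omega) e⟩
  have hdeg : deg G z (seg (cat (fun i => A (p - i)) p B) 0 (p + 1 + s + 1)) =
      1 + deg G z (seg B 0 (s + 1)) := by
    rw [show p + 1 + s + 1 = p + 1 + (s + 1) by omega, seg_cat, seg_rev, deg_union, hA1]
    rintro _ ⟨i, -, hi, rfl⟩ ⟨j, -, hj, e⟩
    exact (H.cross i (by omega) j (by omega)).1 e
  have t0 : cat (fun i => A (p - i)) p B 0 = A p := by simp [cat]
  have t1 : cat (fun i => A (p - i)) p B (p + 1 + s) = B s := by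
    simp only [cat]; rw [if_neg (by omega)]; congr 1; omega
  -- If `z` has at least three neighbours on the prefix of `B`, the one on `A` makes their number
  -- even and at least four, and the path from `A p` to `B s` closes through the hole to an even
  -- wheel. Otherwise oddness leaves `B 0` alone, and `not_twoArms` applies.
  by_cases h3 : 3 ≤ deg G z (seg B 0 (s + 1))
  · exfalso
    refine hG.wheel (hT.hasEvenWheel (by omega) (z := z) ?_ (by omega)
      (by rw [hdeg, add_comm]; exact hodd.add_one) (S := seg g 1 m) ?_ ?_ ?_)
    · intro i hi
      simp only [cat]; split_ifs
      · exact H.neA _ (by omega)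
      · exact H.neB _ (by omega)
    · rintro _ ⟨i, h1, h2, rfl⟩
      have := h.ne i (by omega); have := h.adj i (by omega)
      grind
    · rintro _ ⟨k, h1, h2, rfl⟩ i h3 h4
      simp only [cat]; split_ifs
      · have := hA (p - i) (by omega) k (by omega)
        exact ⟨this.1.symm, fun e => by have := this.2 e.symm; omega⟩
      · have := hB (i - (p + 1)) (by omega) k (by omega)
        exact ⟨this.1.symm, fun e => by have := this.2 e.symm; omega⟩
    · rw [t0, t1]
      -- The two ends of `g` are neighbours of `z` and must stay off the closing route; as `2 ≤ m`,
      -- every edge of `g` has an end in the interior.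
      obtain ⟨i, i1, i2, i3⟩ : ∃ i, 1 ≤ i ∧ i < m ∧ G.Adj (A p) (g i) := by
        rcases Nat.eq_zero_or_pos a with rfl | h0
        · exact ⟨1, by omega, by omega, a3⟩
        · exact ⟨a, by omega, by omega, a2⟩
      obtain ⟨j, j1, j2, j3⟩ : ∃ i, 1 ≤ i ∧ i < m ∧ G.Adj (B s) (g i) := by
        rcases Nat.eq_zero_or_pos b with rfl | h0
        · exact ⟨1, by omega, by omega, b3⟩
        · exact ⟨b, by omega, by omega, b2⟩
      refine (Link.of_adj i3 (by simp) ?_).trans (Link.trans ?_ (Link.of_adj j3.symm ?_ (by simp)))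
      · grind
      · rcases Nat.le_total i j with hij | hij
        · exact h.path.link_le hij (by omega) (by grind)
        · exact h.path.link_ge hij (by omega) (by grind)
      · grind
  have hone : deg G z (seg B 0 (s + 1)) = 1 := by
    obtain ⟨k, hk⟩ := hodd; omega
  have hzB : ∀ i, G.Adj z (B i) → i = 0 ∨ Out s i i := by
    intro i hi
    by_cases his : i ≤ s
    · left
      obtain ⟨_, ⟨k, -, hk, rfl⟩, h'⟩ := exists_of_deg_eq_one hone
      have e1 := (h' _ (mem_seg_of (Nat.zero_le i) (by omega))).1 hi
      have e2 := (h' _ (mem_seg_of le_rfl (by omega))).1 H.adjB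
      exact H.pathB.inj (by omega) (by omega) (e1.trans e2.symm)
    · right; grind
  have hzA : ∀ i, G.Adj z (A i) → i = 0 ∨ Out p i i := by
    intro i hi
    by_cases his : i ≤ p
    · exact .inl ((H.adjA i (by omega)).1 hi)
    · right; grind
  have nA : ∀ i, z = A i → Out p i i := by have := H.neA; grind
  have nB : ∀ i, z = B i → Out s i i := by have := H.neB; grind
  have hAB : ∀ i j, (A i = B j → Out p i i ∨ Out s j j) ∧
      (G.Adj (A i) (B j) → Out p i i ∨ Out s j j ∨ (i = 0 ∧ j = 0)) := by
    intro i j; have := H.cross i; grind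
  have uv : G.Adj (A 0) (B 0) := (H.cross 0 (by omega) 0 (by omega)).2.2 ⟨rfl, rfl⟩
  have zu : G.Adj z (A 0) := (H.adjA 0 (by omega)).2 rfl
  have zv := H.adjB
  have hpA := H.pathA.le hpα
  have hpB := H.pathB.le hs
  have eA : ∀ i k, (A i = g k → Out p i i ∨ Out m k k) ∧
      (G.Adj (A i) (g k) → Out p i i ∨ Out m k k ∨ i = p) := by
    intro i k; have := hA i; grind
  have eB : ∀ i k, (B i = g k → Out s i i ∨ Out m k k) ∧
      (G.Adj (B i) (g k) → Out s i i ∨ Out m k k ∨ i = s) := by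
    intro i k; have := hB i; grind
  have nA0 := (hpA 0 p (by omega) le_rfl).1
  have nB0 := (hpB 0 s (by omega) le_rfl).1
  clear hA hB ha hb hdeg hT hone hodd H t0 t1 hA1
  rcases lt_trichotomy a b with hab | hab | hab
  · refine (h.not_twoArms hG s1 hpB hpA b1 b2 b4 a1 a2 a3 a4 hzA hzB nB nA ?_ uv.symm zv zu eB eA
      nA0 hab).elim
    intro i j
    have := hAB j i
    have e := G.adj_comm (A j) (B i)
    grind
  · exact hab
  · exact (h.not_twoArms hG hp hpA hpB a1 a2 a4 b1 b2 b3 b4 hzB hzA nA nB hAB uv zu zv eA eB nB0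
      hab).elim

end Arms

end Kaleidoscope

/-! ### Clean pairs of arms and their prefix hole. -/

namespace Kaleidoscope

variable {V : Type*} {G : SimpleGraph V}

/-- Two sequences of vertices with their lengths. -/
structure ArmData (V : Type*) where
  /-- The arm towards `x`. -/
  A : ℕ → V
  /-- The length of the arm towards `x`. -/
  α : ℕ
  /-- The arm towards `y`. -/
  B : ℕ → V
  /-- The length of the arm towards `y`. -/
  β : ℕ

/-- `W` and `W'` meet only in their ends, and the neighbours of `z` in `W` have no neighbours
in `W'`. -/
structure Half (G : SimpleGraph V) (z : V) (W W' : ArmData V) : Prop where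
  eqAA : ∀ s ≤ W.α, ∀ t ≤ W'.α, W.A s = W'.A t → s = W.α ∧ t = W'.α
  neAB : ∀ s ≤ W.α, ∀ t ≤ W'.β, W.A s ≠ W'.B t
  eqBB : ∀ s ≤ W.β, ∀ t ≤ W'.β, W.B s = W'.B t → s = W.β ∧ t = W'.β
  tAA : ∀ t ≤ W'.α, ¬ G.Adj (W.A 0) (W'.A t)
  tAB : ∀ t ≤ W'.β, ¬ G.Adj (W.A 0) (W'.B t)
  tBA : ∀ s ≤ W.β, G.Adj z (W.B s) → ∀ t ≤ W'.α, ¬ G.Adj (W.B s) (W'.A t)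
  tBB : ∀ s ≤ W.β, G.Adj z (W.B s) → ∀ t ≤ W'.β, ¬ G.Adj (W.B s) (W'.B t)

/-- Two independent pairs of arms with the same ends. -/
structure TwoArms (G : SimpleGraph V) (z x y : V) (W W' : ArmData V) : Prop where
  arms : Arms G z x y W.A W.α W.B W.β
  arms' : Arms G z x y W'.A W'.α W'.B W'.β
  half : Half G z W W'
  half' : Half G z W' W

/-- The only edge between the first `p` vertices of the arm of `W` and the first `q` of that of
`W'` joins their last vertices. -/
structure Clean (G : SimpleGraph V) (W W' : ArmData V) (p q : ℕ) : Prop where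
  p_lt : p < W.α
  q_lt : q < W'.α
  adj : G.Adj (W.A p) (W'.A q)
  only : ∀ s ≤ p, ∀ t ≤ q, G.Adj (W.A s) (W'.A t) → s = p ∧ t = q

variable {z x y : V} {W W' : ArmData V} {p q : ℕ}

theorem TwoArms.symm (T : TwoArms G z x y W W') : TwoArms G z x y W' W :=
  ⟨T.arms', T.arms, T.half', T.half⟩

theorem Clean.symm (C : Clean G W W' p q) : Clean G W' W q p :=
  ⟨C.q_lt, C.p_lt, C.adj.symm, fun s hs t ht e => (C.only t ht s hs e.symm).symm⟩

theorem Clean.one_le (C : Clean G W W' p q) (T : TwoArms G z x y W W') : 1 ≤ p := by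
  by_contra h
  obtain rfl : p = 0 := by omega
  exact T.half.tAA q C.q_lt.le C.adj

theorem Arms.beta_pos {A B : ℕ → V} {α β : ℕ} (H : Arms G z x y A α B β) : 1 ≤ β := by
  by_contra h
  obtain rfl : β = 0 := by omega
  exact H.not_adj H.adjB

/-- The prefix hole of a clean pair. -/
def cleanPath (W W' : ArmData V) (p q : ℕ) : ℕ → V := cat W.A p fun s => W'.A (q - s)

theorem cleanPath_le {s : ℕ} (h : s ≤ p) : cleanPath W W' p q s = W.A s := by
  simp [cleanPath, cat, h]

theorem cleanPath_gt {s : ℕ} (h : p < s) : cleanPath W W' p q s = W'.A (q - (s - (p + 1))) := by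
  simp only [cleanPath, cat]; rw [if_neg (by omega)]

theorem forall_cleanPath {P : V → Prop} (h1 : ∀ s ≤ p, P (W.A s)) (h2 : ∀ t ≤ q, P (W'.A t)) :
    ∀ k ≤ p + 1 + q, P (cleanPath W W' p q k) := by
  intro k hk
  by_cases h : k ≤ p
  · rw [cleanPath_le h]; exact h1 k h
  · rw [cleanPath_gt (by omega)]; exact h2 _ (by omega)

theorem cleanPath_left {s : ℕ} (h : s ≤ p) :
    ∃ k ≤ p + 1 + q, cleanPath W W' p q k = W.A s := ⟨s, by omega, cleanPath_le h⟩

theorem cleanPath_right {t : ℕ} (h : t ≤ q) :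
    ∃ k ≤ p + 1 + q, cleanPath W W' p q k = W'.A t :=
  ⟨p + 1 + (q - t), by omega, by rw [cleanPath_gt (by omega)]; congr 1; omega⟩

/-- `z` sees only `A 0` and `A' 0` on the prefixes, and the one edge between the prefixes joins
their last vertices. Both prefixes have positive length, because `A 0` and `A' 0` do not touch the
other path. -/
theorem Clean.holeOn (C : Clean G W W' p q) (T : TwoArms G z x y W W') :
    HoleOn G z (cleanPath W W' p q) (p + 1 + q) := by
  have h1 := C.one_le T
  have h2 := C.symm.one_le T.symm
  have hp := C.p_lt
  have hq := C.q_lt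
  refine ⟨(T.arms.pathA.le hp.le).cat (T.arms'.pathA.rev hq.le) ?_, by omega, ?_, ?_⟩
  · intro i hi j hj
    refine ⟨fun e => ?_, fun e => ?_, ?_⟩
    · have := T.half.eqAA i (by omega) (q - j) (by omega) e; omega
    · have := C.only i hi (q - j) (by omega) e; omega
    · rintro ⟨rfl, rfl⟩; exact C.adj
  · exact forall_cleanPath (fun s hs => T.arms.neA s (by omega)) fun t ht => T.arms'.neA t (by omega)
  · intro k hk
    by_cases h : k ≤ p
    · rw [cleanPath_le h, T.arms.adjA k (by omega)]; omega
    · rw [cleanPath_gt (by omega), T.arms'.adjA _ (by omega)]; omega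

/-- The three positions of an edge of the prefix hole of a clean pair. -/
theorem AtEdge.cleanPath_cases {c : V} {e : ℕ} (h : AtEdge G c (cleanPath W W' p q) (p + 1 + q) e) :
    (e < p ∧ (∀ s ≤ p, G.Adj c (W.A s) ↔ s = e ∨ s = e + 1) ∧ ∀ t ≤ q, ¬ G.Adj c (W'.A t)) ∨
    (e = p ∧ (∀ s ≤ p, G.Adj c (W.A s) ↔ s = p) ∧ ∀ t ≤ q, G.Adj c (W'.A t) ↔ t = q) ∨
    (p < e ∧ ∃ f < q, (∀ s ≤ p, ¬ G.Adj c (W.A s)) ∧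
      ∀ t ≤ q, G.Adj c (W'.A t) ↔ t = f ∨ t = f + 1) := by
  have h1 := h.1
  have hl : ∀ s ≤ p, G.Adj c (W.A s) ↔ s = e ∨ s = e + 1 := by
    intro s hs
    have := h.2 s (by omega)
    rwa [cleanPath_le hs] at this
  have hr : ∀ t ≤ q, G.Adj c (W'.A t) ↔ p + 1 + (q - t) = e ∨ p + 1 + (q - t) = e + 1 := by
    intro t ht
    have := h.2 (p + 1 + (q - t)) (by omega)
    rwa [cleanPath_gt (by omega), show q - (p + 1 + (q - t) - (p + 1)) = t by omega] at this
  rcases lt_trichotomy e p with h' | h' | h'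
  · refine .inl ⟨h', hl, fun t ht => ?_⟩
    rw [hr t ht]; omega
  · refine .inr (.inl ⟨h', fun s hs => ?_, fun t ht => ?_⟩)
    · rw [hl s hs]; omega
    · rw [hr t ht]; omega
  · refine .inr (.inr ⟨h', q - (e - p), by omega, fun s hs => ?_, fun t ht => ?_⟩)
    · rw [hl s hs]; omega
    · rw [hr t ht]; omega

/-- The first contact of a path starting at a neighbour of `z` with a hole through `z` is in an
edge. -/
theorem HoleOn.first_atEdge (hG : Good G) {g : ℕ → V} {m : ℕ} (h : HoleOn G z g m) {P : ℕ → V}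
    {n : ℕ} (hP : IndPath G P n) (hz : G.Adj z (P 0)) (hPz : ∀ s ≤ n, P s ≠ z)
    (hPg : ∀ s ≤ n, ∀ k ≤ m, P s ≠ g k)
    (hends : ∀ s ≤ n, ¬ G.Adj (P s) (g 0) ∧ ¬ G.Adj (P s) (g m))
    (hcl : ∀ s ≤ n, G.Adj z (P s) → ∀ k ≤ m, ¬ G.Adj (P s) (g k))
    {s₁ k₁ : ℕ} (hs₁ : s₁ ≤ n) (hk₁ : k₁ ≤ m) (h₁ : G.Adj (P s₁) (g k₁)) :
    ∃ s ≤ s₁, ∃ e, AtEdge G (P s) g m e ∧ ∀ s' < s, ∀ k ≤ m, ¬ G.Adj (P s') (g k) := by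
  obtain ⟨s, hs, ⟨k, hk, hsk⟩, hmin⟩ :=
    exists_first (P := fun s => ∃ k ≤ m, G.Adj (P s) (g k)) ⟨k₁, hk₁, h₁⟩
  have hmin' : ∀ s' < s, ∀ k ≤ m, ¬ G.Adj (P s') (g k) := fun s' h1 k h2 h3 => hmin s' h1 ⟨k, h2, h3⟩
  have hzs : ¬ G.Adj z (P s) := fun e => hcl s (by omega) e k hk hsk
  obtain ⟨e, he⟩ := h.atEdge_of_link hG (hPg s (by omega)) (hPz s (by omega))
    (fun e => hzs e.symm) (hends s (by omega)).1 (hends s (by omega)).2 (R := seg P 0 s)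
    (by rintro _ ⟨i, -, hi, rfl⟩ k hk; exact ⟨hPg i (by omega) k hk, hmin' i hi k hk⟩)
    (by
      have h0 : P 0 ∈ insert z (insert (P s) (seg P 0 s)) := by
        rcases Nat.eq_zero_or_pos s with rfl | h0
        · simp
        · exact .inr (.inr (mem_seg_of le_rfl h0))
      exact (Link.of_adj hz (by simp) h0).trans (hP.link (Nat.zero_le s) (by omega)
        (fun v ⟨i, h1, h2, e⟩ => .inr (.inr ⟨i, by omega, h2, e⟩)) h0 (by simp))) hk hsk
  exact ⟨s, hs, e, he, hmin'⟩

section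

variable [Finite V]

/-- If the first arm attaches to an edge of a hole through `z`, then so does the first contact of
the second arm, and in the same edge. -/
theorem Arms.first_contact (hG : Good G) {A B : ℕ → V} {α β : ℕ} (H : Arms G z x y A α B β)
    {g : ℕ → V} {m : ℕ} (h : HoleOn G z g m) {p e n : ℕ} (hp : 1 ≤ p) (hpα : p ≤ α) (hn : n ≤ β)
    (hA : ∀ i ≤ p, ∀ k ≤ m, A i ≠ g k ∧ (G.Adj (A i) (g k) → i = p))
    (ha : AtEdge G (A p) g m e) (hBg : ∀ s ≤ n, ∀ k ≤ m, B s ≠ g k)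
    (hends : ∀ s ≤ n, ¬ G.Adj (B s) (g 0) ∧ ¬ G.Adj (B s) (g m))
    (hcl : ∀ s ≤ n, G.Adj z (B s) → ∀ k ≤ m, ¬ G.Adj (B s) (g k))
    {s₁ k₁ : ℕ} (hs₁ : s₁ ≤ n) (hk₁ : k₁ ≤ m) (h₁ : G.Adj (B s₁) (g k₁)) :
    ∃ s ≤ s₁, AtEdge G (B s) g m e ∧ ∀ s' < s, ∀ k ≤ m, ¬ G.Adj (B s') (g k) := by
  obtain ⟨s, hs, f, hf, hmin⟩ := h.first_atEdge hG (H.pathB.le hn) H.adjB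
    (fun s hs => (H.neB s (by omega)).symm) hBg hends hcl hs₁ hk₁ h₁
  have hfe := hf.facts
  have hzs : ¬ G.Adj z (B s) := fun e => hcl s (by omega) e f (by omega) hfe.2.1
  have := H.atEdge_eq hG h hp hpα (s := s) (by omega) hzs hA (fun i hi k hk => ⟨hBg i (by omega) k hk,
    fun e => by
      by_contra hne
      exact hmin i (by omega) k hk e⟩) ha hf
  exact ⟨s, hs, this ▸ hf, hmin⟩

/-- The neighbour `A 0` of `z` followed by the arm towards `y`. -/
def ext (W : ArmData V) : ℕ → V := cat (fun _ => W.A 0) 0 W.B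

omit [Finite V] in
theorem ext_zero : ext W 0 = W.A 0 := by simp [ext, cat]

omit [Finite V] in
theorem ext_succ (s : ℕ) : ext W (s + 1) = W.B s := by simp [ext, cat]

omit [Finite V] in
theorem Arms.path_ext (H : Arms G z x y W.A W.α W.B W.β) : IndPath G (ext W) (W.β + 1) := by
  have := (IndPath.zero (G := G) (fun _ => W.A 0)).cat H.pathB (by
    intro i hi j hj
    have := H.cross 0 (by omega) j hj
    refine ⟨this.1, ?_⟩
    rw [this.2]; omega)
  rwa [show 0 + 1 + W.β = W.β + 1 by omega] at this

theorem Arms.deg_ext (H : Arms G z x y W.A W.α W.B W.β) {s : ℕ} (hs : s ≤ W.β) :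
    deg G z (seg (ext W) 0 (s + 2)) = 1 + deg G z (seg W.B 0 (s + 1)) := by
  rw [show s + 2 = 0 + 1 + (s + 1) by omega, ext, seg_cat, seg_one, deg_union]
  · congr 1
    refine deg_eq_one (x := W.A 0) (fun v hv => ?_) rfl
    rw [Set.mem_singleton_iff.1 hv]
    exact ⟨fun _ => rfl, fun _ => (H.adjA 0 (by omega)).2 rfl⟩
  · rintro _ rfl ⟨j, -, hj, e⟩
    exact (H.cross 0 (by omega) j (by omega)).1 e

/-- The even wheel with centre `z` formed by the prefixes of the four arms of a clean pair. -/
theorem TwoArms.false_of_adj (hG : Good G) (T : TwoArms G z x y W W') (C : Clean G W W' p q)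
    {s t : ℕ} (hs : s < W.β) (ht : t ≤ W'.β) (hst : G.Adj (W.B s) (W'.B t))
    (hmin : ∀ s' ≤ s, ∀ t' ≤ t, G.Adj (W.B s') (W'.B t') → s' = s ∧ t' = t)
    (hB : ∀ s' ≤ s, ∀ k ≤ q, ¬ G.Adj (W.B s') (W'.A k))
    (hB' : ∀ t' ≤ t, ∀ k ≤ p, ¬ G.Adj (W'.B t') (W.A k)) : False := by
  have H := T.arms
  have H' := T.arms'
  have zs : ¬ G.Adj z (W.B s) := fun e => T.half.tBB s hs.le e t ht hst
  have zt : ¬ G.Adj z (W'.B t) := fun e => T.half'.tBB t ht e s hs.le hst.symm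
  have p1 := C.one_le T
  have q1 := C.symm.one_le T.symm
  have hpα := C.p_lt
  have hqα := C.q_lt
  -- The rim is `A 0, B 0, …, B s, B' t, …, B' 0, A' 0`, closed by the prefixes `A 1, …, A p` and
  -- `A' q, …, A' 1`. Each side contributes one plus an odd number of neighbours of `z`, so the
  -- total is even and at least four.
  have hE : IndPath G (cat (ext W) (s + 1) fun i => ext W' (t + 1 - i)) (s + 1 + 1 + (t + 1)) := by
    refine (H.path_ext.le (by omega)).cat (H'.path_ext.rev (by omega)) fun i hi j hj => ?_
    rcases i with _ | i
    · rw [ext_zero]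
      rcases Nat.eq_zero_or_pos (t + 1 - j) with h0 | h0
      · rw [h0, ext_zero]
        refine ⟨fun e => ?_, fun e => absurd e (T.half.tAA 0 (by omega)), fun e => by omega⟩
        have := T.half.eqAA 0 (by omega) 0 (by omega) e; omega
      · obtain ⟨r, hr⟩ : ∃ r, t + 1 - j = r + 1 := ⟨t - j, by omega⟩
        rw [hr, ext_succ]
        exact ⟨T.half.neAB 0 (by omega) r (by omega),
          fun e => absurd e (T.half.tAB r (by omega)), fun e => by omega⟩
    · rw [ext_succ]
      rcases Nat.eq_zero_or_pos (t + 1 - j) with h0 | h0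
      · rw [h0, ext_zero]
        exact ⟨(T.half'.neAB 0 (by omega) i (by omega)).symm,
          fun e => absurd e.symm (T.half'.tAB i (by omega)), fun e => by omega⟩
      · obtain ⟨r, hr⟩ : ∃ r, t + 1 - j = r + 1 := ⟨t - j, by omega⟩
        rw [hr, ext_succ]
        refine ⟨fun e => ?_, fun e => ?_, fun e => ?_⟩
        · have := T.half.eqBB i (by omega) r (by omega) e; omega
        · have := hmin i (by omega) r (by omega) e; omega
        · obtain rfl : i = s := by omega
          obtain rfl : r = t := by omega
          exact hst
  have hdeg : deg G z (seg (cat (ext W) (s + 1) fun i => ext W' (t + 1 - i)) 0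
      (s + 1 + 1 + (t + 1) + 1)) =
      (1 + deg G z (seg W.B 0 (s + 1))) + (1 + deg G z (seg W'.B 0 (t + 1))) := by
    rw [show s + 1 + 1 + (t + 1) + 1 = s + 1 + 1 + (t + 1 + 1) by omega, seg_cat,
      seg_rev (ext W') (t + 1), deg_union, H.deg_ext hs.le, H'.deg_ext ht]
    rintro _ ⟨i, -, hi, rfl⟩ ⟨j, -, hj, e⟩
    rcases i with _ | i <;> rcases j with _ | j <;> simp only [ext_zero, ext_succ] at e
    · have := T.half.eqAA 0 (by omega) 0 (by omega) e; omega
    · exact T.half.neAB 0 (by omega) j (by omega) e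
    · exact (T.half'.neAB 0 (by omega) i (by omega)).symm e
    · have := T.half.eqBB i (by omega) j (by omega) e; omega
  obtain ⟨k1, hk1⟩ := H.odd s hs.le zs
  obtain ⟨k2, hk2⟩ := H'.odd t ht zt
  have hval : ∀ i ≤ s + 1 + 1 + (t + 1), ∀ Q : V → Prop, (i = 0 → Q (W.A 0)) →
      (∀ r ≤ s, Q (W.B r)) → (∀ r ≤ t, Q (W'.B r)) → (i = s + 1 + 1 + (t + 1) → Q (W'.A 0)) →
      Q (cat (ext W) (s + 1) (fun i => ext W' (t + 1 - i)) i) := by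
    intro i hi Q q1 q2 q3 q4
    simp only [cat]
    split_ifs with h
    · rcases i with _ | i
      · rw [ext_zero]; exact q1 rfl
      · rw [ext_succ]; exact q2 i (by omega)
    · rcases Nat.eq_zero_or_pos (t + 1 - (i - (s + 1 + 1))) with h0 | h0
      · rw [h0, ext_zero]; exact q4 (by omega)
      · obtain ⟨r, hr⟩ : ∃ r, t + 1 - (i - (s + 1 + 1)) = r + 1 := ⟨t + 1 - (i - (s + 1 + 1)) - 1, by omega⟩
        rw [hr, ext_succ]; exact q3 r (by omega)
  refine hG.wheel (hE.hasEvenWheel (by omega) (z := z) ?_ (by omega) ?_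
    (S := seg W.A 1 (p + 1) ∪ seg W'.A 1 (q + 1)) ?_ ?_ ?_)
  · intro i hi
    exact hval i hi (fun v => z ≠ v) (fun _ => H.neA 0 (by omega)) (fun r hr => H.neB r (by omega))
      (fun r hr => H'.neB r (by omega)) (fun _ => H'.neA 0 (by omega))
  · rw [hdeg]; exact ⟨k1 + k2 + 2, by omega⟩
  · rintro _ (⟨i, i1, i2, rfl⟩ | ⟨i, i1, i2, rfl⟩)
    · exact ⟨H.neA i (by omega), by rw [H.adjA i (by omega)]; omega⟩
    · exact ⟨H'.neA i (by omega), by rw [H'.adjA i (by omega)]; omega⟩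
  · rintro _ (⟨k, i1, i2, rfl⟩ | ⟨k, i1, i2, rfl⟩) i h0 hm
    · refine hval i hm.le (fun v => W.A k ≠ v ∧ ¬ G.Adj (W.A k) v) (by omega) (fun r hr => ?_)
        (fun r hr => ?_) (by omega)
      · have := H.cross k (by omega) r (by omega)
        exact ⟨this.1, by rw [this.2]; omega⟩
      · exact ⟨T.half.neAB k (by omega) r (by omega), fun e => hB' r hr k (by omega) e.symm⟩
    · refine hval i hm.le (fun v => W'.A k ≠ v ∧ ¬ G.Adj (W'.A k) v) (by omega) (fun r hr => ?_)
        (fun r hr => ?_) (by omega)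
      · exact ⟨T.half'.neAB k (by omega) r (by omega), fun e => hB r hr k (by omega) e.symm⟩
      · have := H'.cross k (by omega) r (by omega)
        exact ⟨this.1, by rw [this.2]; omega⟩
  · have e0 : cat (ext W) (s + 1) (fun i => ext W' (t + 1 - i)) 0 = W.A 0 := by
      simp [cat, ext_zero]
    have e1 : cat (ext W) (s + 1) (fun i => ext W' (t + 1 - i)) (s + 1 + 1 + (t + 1)) = W'.A 0 := by
      simp only [cat]; rw [if_neg (by omega), show t + 1 - (s + 1 + 1 + (t + 1) - (s + 1 + 1)) = 0 by omega, ext_zero]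
    rw [e0, e1]
    have m1 : ∀ i, 0 ≤ i → i ≤ p → W.A i ∈ insert (W.A 0) (insert (W'.A 0)
        (seg W.A 1 (p + 1) ∪ seg W'.A 1 (q + 1))) := by
      intro i _ hi
      rcases Nat.eq_zero_or_pos i with rfl | h0
      · simp
      · exact .inr (.inr (.inl (mem_seg_of h0 (by omega))))
    have m2 : ∀ i, 0 ≤ i → i ≤ q → W'.A i ∈ insert (W.A 0) (insert (W'.A 0)
        (seg W.A 1 (p + 1) ∪ seg W'.A 1 (q + 1))) := by
      intro i _ hi
      rcases Nat.eq_zero_or_pos i with rfl | h0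
      · simp
      · exact .inr (.inr (.inr (mem_seg_of h0 (by omega))))
    exact (H.pathA.link_le (Nat.zero_le p) hpα.le m1).trans ((Link.of_adj C.adj (m1 p (by omega)
      le_rfl) (m2 q (by omega) le_rfl)).trans (H'.pathA.link_ge (Nat.zero_le q) hqα.le m2))

/-- The arms towards `y` end in the same vertex, so they come into contact. When neither sees the
prefix of the other arm towards `x`, their first edge closes the even wheel of `false_of_adj`. -/
theorem TwoArms.false_of_free (hG : Good G) (T : TwoArms G z x y W W') (C : Clean G W W' p q)
    (hB : ∀ s ≤ W.β, ∀ k ≤ q, ¬ G.Adj (W.B s) (W'.A k))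
    (hB' : ∀ t ≤ W'.β, ∀ k ≤ p, ¬ G.Adj (W'.B t) (W.A k)) : False := by
  have b1 := T.arms.beta_pos
  -- The vertex before `y` on `B` already sees `y` on `B'`, so the first contact comes strictly
  -- before `y`.
  have hex : ∃ t ≤ W'.β, G.Adj (W.B (W.β - 1)) (W'.B t) := by
    refine ⟨W'.β, le_rfl, ?_⟩
    rw [T.arms'.endB, ← T.arms.endB]
    exact (T.arms.pathB _ _ (by omega) le_rfl).2.2 (by omega)
  obtain ⟨s, hs, ⟨t₀, ht₀, hst₀⟩, hmin⟩ :=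
    exists_first (P := fun s => ∃ t ≤ W'.β, G.Adj (W.B s) (W'.B t)) hex
  obtain ⟨t, ht, hst, hmin'⟩ := exists_first (P := fun t => G.Adj (W.B s) (W'.B t)) hst₀
  refine T.false_of_adj hG C (s := s) (t := t) (by omega) (by omega) hst ?_
    (fun s' h1 => hB s' (by omega)) (fun t' h1 => hB' t' (by omega))
  intro s' h1 t' h2 e
  have e1 : s' = s := by
    by_contra hne; exact hmin s' (by omega) ⟨t', by omega, e⟩
  refine ⟨e1, ?_⟩
  subst e1
  by_contra hne; exact hmin' t' (by omega) e

end

end Kaleidoscope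

/-! ### Bypasses: a further route from `z` to `x` that avoids the prefix hole. -/

namespace Kaleidoscope

variable {V : Type*} {G : SimpleGraph V} {z x y : V} {W W' : ArmData V} {p q : ℕ}

/-- Attachments of a set `R` linking `z` to `x`, away from the prefix hole of a clean pair. -/
structure Bypass (G : SimpleGraph V) (z x : V) (W W' : ArmData V) (p q : ℕ) (o : V) (R : Set V) :
    Prop where
  mem : o ∈ R
  adj : G.Adj z o
  notMem : z ∉ R
  unique : ∀ r ∈ R, G.Adj z r → r = o
  awayA : ∀ r ∈ R, ∀ s ≤ p, ¬ G.Adj r (W.A s)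
  awayA' : ∀ r ∈ R, ∀ t ≤ q, ¬ G.Adj r (W'.A t)
  neA : ∀ r ∈ R, ∀ s ≤ W.α, r ≠ W.A s
  neA' : ∀ r ∈ R, ∀ s ≤ W'.α, r ≠ W'.A s
  neB : ∀ r ∈ R, ∀ s ≤ W.β, r ≠ W.B s
  neB' : ∀ r ∈ R, ∀ s ≤ W'.β, r ≠ W'.B s
  link : Link G (insert x R) o x
  adjB : ∀ t < W.β, ¬ G.Adj o (W.B t)
  adjB' : ∀ t < W'.β, ¬ G.Adj o (W'.B t)
  clB : ∀ t < W.β, G.Adj z (W.B t) → ∀ r ∈ R, ¬ G.Adj r (W.B t)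
  clB' : ∀ t < W'.β, G.Adj z (W'.B t) → ∀ r ∈ R, ¬ G.Adj r (W'.B t)

theorem Bypass.symm {o : V} {R : Set V} (H : Bypass G z x W W' p q o R) :
    Bypass G z x W' W q p o R :=
  ⟨H.mem, H.adj, H.notMem, H.unique, H.awayA', H.awayA, H.neA', H.neA, H.neB', H.neB, H.link,
    H.adjB', H.adjB, H.clB', H.clB⟩

/-- The last contact of an arm with the prefix hole, seen from `x`. -/
theorem Bypass.last_contact (hG : Good G) (T : TwoArms G z x y W W') (C : Clean G W W' p q)
    {o : V} {R : Set V} (H : Bypass G z x W W' p q o R) :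
    ∃ b, p < b ∧ b ≤ W.α ∧ (∃ e, AtEdge G (W.A b) (cleanPath W W' p q) (p + 1 + q) e) ∧
      ∀ i, b < i → i ≤ W.α → (∀ s ≤ p, ¬ G.Adj (W.A i) (W.A s)) ∧
        ∀ t ≤ q, ¬ G.Adj (W.A i) (W'.A t) := by
  have hp := C.p_lt
  have hq := C.q_lt
  have p1 := C.one_le T
  have h0 : ∃ k ≤ p + 1 + q, G.Adj (W.A (p + 1)) (cleanPath W W' p q k) :=
    ⟨p, by omega, by rw [cleanPath_le le_rfl]; exact ((T.arms.pathA _ _ (by omega) hp).2.2 rfl).symm⟩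
  obtain ⟨b, b1, b2, ⟨k, hk, hbk⟩, b4⟩ := exists_last
    (P := fun b => ∃ k ≤ p + 1 + q, G.Adj (W.A b) (cleanPath W W' p q k)) (m := W.α) hp h0
  have b4' : ∀ i, b < i → i ≤ W.α → ∀ k ≤ p + 1 + q, ¬ G.Adj (W.A i) (cleanPath W W' p q k) :=
    fun i h1 h2 k h3 h4 => b4 i h1 h2 ⟨k, h3, h4⟩
  have hh := C.holeOn T
  have hne : ∀ i, p < i → i ≤ W.α → ∀ k ≤ p + 1 + q, W.A i ≠ cleanPath W W' p q k := by
    intro i h1 h2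
    refine forall_cleanPath (fun s hs e => ?_) fun t ht e => ?_
    · have := T.arms.pathA.inj h2 (by omega) e; omega
    · have := T.half.eqAA i h2 t (by omega) e; omega
  have hz : ¬ G.Adj z (W.A b) := by rw [T.arms.adjA b b2]; omega
  refine ⟨b, b1, b2, ?_, ?_⟩
  -- `A b` is linked to `z` off the hole: back along the arm to `x`, which is contact-free since `b`
  -- is the last contact, and then through `R`.
  · refine hh.atEdge_of_link hG (hne b b1 b2) (T.arms.neA b b2).symm (fun e => hz e.symm) ?_ ?_
      (R := R ∪ seg W.A (b + 1) (W.α + 1)) ?_ ?_ hk hbk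
    · rw [cleanPath_le (by omega), T.arms.pathA.adj_iff b2 (by omega)]; omega
    · rw [cleanPath_gt (by omega), show q - (p + 1 + q - (p + 1)) = 0 by omega]
      exact fun e => T.half'.tAA b b2 e.symm
    · rintro r (hr | ⟨i, i1, i2, rfl⟩) k hk
      · refine ⟨forall_cleanPath (P := fun v => r ≠ v) (fun s hs => H.neA r hr s (by omega))
          (fun t ht => H.neA' r hr t (by omega)) k hk, ?_⟩
        exact forall_cleanPath (P := fun v => ¬ G.Adj r v) (H.awayA r hr) (H.awayA' r hr) k hk
      · exact ⟨hne i (by omega) (by omega) k hk, b4' i (by omega) (by omega) k hk⟩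
    · have hx : x ∈ insert z (insert (W.A b) (R ∪ seg W.A (b + 1) (W.α + 1))) := by
        rw [← T.arms.endA]
        rcases Nat.eq_or_lt_of_le b2 with e | e
        · rw [← e]; simp
        · exact .inr (.inr (.inr (mem_seg_of (by omega) (by omega))))
      refine (Link.of_adj H.adj (by simp) (.inr (.inr (.inl H.mem)))).trans
        ((H.link.mono ?_).trans ?_)
      · rintro v (rfl | hv)
        · exact hx
        · exact .inr (.inr (.inl hv))
      · rw [← T.arms.endA]
        refine T.arms.pathA.link_ge b2 le_rfl fun s s1 s2 => ?_
        rcases Nat.eq_or_lt_of_le s1 with rfl | e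
        · simp
        · exact .inr (.inr (.inr (mem_seg_of (by omega) (by omega))))
  · intro i i1 i2
    refine ⟨fun s hs => ?_, fun t ht => ?_⟩
    · obtain ⟨k, hk, e⟩ := cleanPath_left (W := W) (W' := W') (p := p) (q := q) hs
      rw [← e]; exact b4' i i1 i2 k hk
    · obtain ⟨k, hk, e⟩ := cleanPath_right (W := W) (W' := W') (p := p) (q := q) ht
      rw [← e]; exact b4' i i1 i2 k hk

/-- Exchanging the arms reverses the prefix path, whose edges are numbered `0, …, p + q`. -/
theorem AtEdge.cleanPath_symm {c : V} {e : ℕ}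
    (h : AtEdge G c (cleanPath W W' p q) (p + 1 + q) e) :
    AtEdge G c (cleanPath W' W q p) (q + 1 + p) (p + q - e) := by
  have h1 := h.1
  refine ⟨by omega, fun k hk => ?_⟩
  have h2 := h.2 (p + 1 + q - k) (by omega)
  by_cases hkq : k ≤ q
  · rw [cleanPath_le hkq]
    rw [cleanPath_gt (by omega), show q - (p + 1 + q - k - (p + 1)) = k by omega] at h2
    rw [h2]; omega
  · rw [cleanPath_gt (by omega)]
    rw [cleanPath_le (by omega), show p + 1 + q - k = p - (k - (q + 1)) by omega] at h2
    rw [h2]; omega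

variable [Finite V]

/-- With a bypass, the arm towards `y` is free of the prefix of the other arm. -/
theorem Bypass.free (hG : Good G) (T : TwoArms G z x y W W') (C : Clean G W W' p q)
    {o : V} {R : Set V} (H : Bypass G z x W W' p q o R) {b : ℕ} (hpb : p < b) (hb : b ≤ W.α)
    (hbA : ∀ s ≤ p, G.Adj (W.A b) (W.A s) ↔ s = p)
    (hbA' : ∀ t ≤ q, G.Adj (W.A b) (W'.A t) ↔ t = q)
    (hlast : ∀ i, b < i → i ≤ W.α → (∀ s ≤ p, ¬ G.Adj (W.A i) (W.A s)) ∧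
        ∀ t ≤ q, ¬ G.Adj (W.A i) (W'.A t)) :
    ∀ s ≤ W.β, ∀ k ≤ q, ¬ G.Adj (W.B s) (W'.A k) := by
  have hp := C.p_lt
  have hq := C.q_lt
  have p1 := C.one_le T
  have q1 := C.symm.one_le T.symm
  have bp : b = p + 1 := by
    have := (hbA p le_rfl).2 rfl
    rw [T.arms.pathA.adj_iff hb hp.le] at this; omega
  have hl : Link G (R ∪ seg W.A b (W.α + 1)) (W.A b) o := by
    refine (T.arms.pathA.link_le hb le_rfl fun s s1 s2 => .inr (mem_seg_of s1 (by omega))).trans ?_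
    rw [T.arms.endA]
    refine (H.link.mono ?_).symm
    rintro v (rfl | hv)
    · rw [← T.arms.endA]; exact .inr (mem_seg_of hb (by omega))
    · exact .inl hv
  -- `D` goes from `A b` to `o` inside the tail of the arm and `R`. Together with `z` and the prefix
  -- of `W'` it closes a hole on which `A p` sees exactly the edge from `A' q` to `A b`. A first
  -- contact of `B` with this hole is therefore in that edge, but no vertex of `B` sees `A b`, as
  -- `b` is positive.
  obtain ⟨D, n, hD, hD0, hDn, hDS⟩ := hl.exists_indPath (.inl H.mem)
  have hcase : ∀ k ≤ n, (D k ∈ R) ∨ ∃ i, b ≤ i ∧ i ≤ W.α ∧ D k = W.A i := by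
    intro k hk
    rcases hDS k hk with h | ⟨i, h1, h2, h3⟩
    · exact .inl h
    · exact .inr ⟨i, h1, by omega, h3⟩
  have hD00 : ∀ k ≤ n, D k = W.A b → k = 0 := fun k hk e =>
    hD.inj hk (by omega) (e.trans hD0.symm)
  have hn : 1 ≤ n := by
    by_contra hn
    obtain rfl : n = 0 := by omega
    exact H.neA o H.mem b hb (hDn.symm.trans hD0)
  have hDA' : ∀ t ≤ q, ∀ k ≤ n, W'.A t ≠ D k ∧ (G.Adj (W'.A t) (D k) ↔ t = q ∧ k = 0) := by
    intro t ht k hk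
    rcases hcase k hk with h | ⟨i, i1, i2, h⟩
    · refine ⟨(H.neA' _ h t (by omega)).symm, fun e => absurd e.symm (H.awayA' _ h t ht), ?_⟩
      rintro ⟨rfl, rfl⟩
      rw [hD0]; exact ((hbA' _ le_rfl).2 rfl).symm
    · rw [h]
      refine ⟨fun e => ?_, fun e => ?_, ?_⟩
      · have := T.half.eqAA i i2 t (by omega) e.symm; omega
      · rcases Nat.eq_or_lt_of_le i1 with rfl | i1
        · exact ⟨(hbA' t ht).1 e.symm, hD00 k hk h⟩
        · exact absurd e.symm ((hlast i i1 i2).2 t ht)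
      · rintro ⟨rfl, rfl⟩
        rw [← h, hD0]; exact ((hbA' _ le_rfl).2 rfl).symm
  have hzD : ∀ k ≤ n, z ≠ D k ∧ (G.Adj z (D k) ↔ k = n) := by
    intro k hk
    have hno : G.Adj z (D n) := by rw [hDn]; exact H.adj
    rcases hcase k hk with h | ⟨i, i1, i2, h⟩
    · refine ⟨fun e => H.notMem (by rw [e]; exact h), fun e => ?_, fun e => by rw [e]; exact hno⟩
      exact hD.inj hk le_rfl ((H.unique _ h e).trans hDn.symm)
    · refine ⟨by rw [h]; exact T.arms.neA i i2, fun e => ?_, fun e => by rw [e]; exact hno⟩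
      rw [h, T.arms.adjA i i2] at e; omega
  have hh : HoleOn G z (cat W'.A q D) (q + 1 + n) := by
    refine ⟨(T.arms'.pathA.le hq.le).cat hD hDA', by omega, fun i hi => ?_, fun i hi => ?_⟩
    · simp only [cat]; split_ifs with h
      · exact T.arms'.neA i (by omega)
      · exact (hzD _ (by omega)).1
    · simp only [cat]; split_ifs with h
      · rw [T.arms'.adjA i (by omega)]; omega
      · rw [(hzD _ (by omega)).2]; omega
  have hval : ∀ (Q : V → Prop), (∀ t ≤ q, Q (W'.A t)) → (∀ r ∈ R, Q r) →
      (∀ i, b ≤ i → i ≤ W.α → Q (W.A i)) → ∀ k ≤ q + 1 + n, Q (cat W'.A q D k) := by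
    intro Q h1 h2 h3 k hk
    simp only [cat]; split_ifs with h
    · exact h1 k h
    · rcases hcase (k - (q + 1)) (by omega) with h | ⟨i, i1, i2, h⟩
      · exact h2 _ h
      · rw [h]; exact h3 i i1 i2
  have e0 : cat W'.A q D 0 = W'.A 0 := by simp [cat]
  have e1 : cat W'.A q D (q + 1 + n) = o := by
    simp only [cat]; rw [if_neg (by omega), show q + 1 + n - (q + 1) = n by omega, hDn]
  have eq0 : cat W'.A q D q = W'.A q := by simp [cat]
  have eq1 : cat W'.A q D (q + 1) = W.A b := by simp [cat, hD0]
  by_contra hcon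
  push Not at hcon
  obtain ⟨s, hs, k, hk, hsk⟩ := hcon
  -- The vertex `y` is dealt with separately: it does not see the prefix of `W'`, while `adjB`
  -- leaves it out, because it may be adjacent to `o`, as happens for `o = a`.
  have hsβ : s ≤ W.β - 1 := by
    by_contra h
    obtain rfl : s = W.β := by omega
    rw [T.arms.endB, ← T.arms'.endB] at hsk
    have := (T.arms'.cross k (by omega) W'.β le_rfl).2.1 hsk.symm
    have := T.arms'.beta_pos; omega
  have hβ := T.arms.beta_pos
  have hApD : ∀ i ≤ p, ∀ k ≤ n, G.Adj (W.A i) (D k) → i = p ∧ k = 0 := by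
    intro i hi k hk e
    rcases hcase k hk with h | ⟨j, j1, j2, h⟩
    · exact absurd e.symm (H.awayA _ h i hi)
    · rw [h, T.arms.pathA.adj_iff (by omega) j2] at e
      obtain rfl : j = b := by omega
      exact ⟨by omega, hD00 k hk h⟩
  obtain ⟨s', hs', hedge, -⟩ := T.arms.first_contact hG hh p1 hp.le (n := W.β - 1) (e := q) (by omega)
    (by
      intro i hi k hk
      refine ⟨hval (fun v => W.A i ≠ v) ?_ ?_ ?_ k hk, ?_⟩
      · intro t ht e
        have := T.half.eqAA i (by omega) t (by omega) e; omega
      · exact fun r hr => (H.neA r hr i (by omega)).symm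
      · intro j j1 j2 e
        have := T.arms.pathA.inj (by omega) j2 e; omega
      · simp only [cat]; split_ifs with h
        · exact fun e => (C.only i hi k h e).1
        · exact fun e => (hApD i hi _ (by omega) e).1)
    (by
      refine ⟨by omega, fun k hk => ?_⟩
      simp only [cat]; split_ifs with h
      · refine ⟨fun e => .inl (C.only p le_rfl k h e).2, fun e => ?_⟩
        obtain rfl : k = q := by omega
        exact C.adj
      · refine ⟨fun e => ?_, fun e => ?_⟩
        · have := (hApD p le_rfl _ (by omega) e).2; omega
        · rw [show k - (q + 1) = 0 by omega, hD0]
          exact ((hbA p le_rfl).2 rfl).symm)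
    (by
      intro s hs
      refine hval (fun v => W.B s ≠ v) ?_ ?_ ?_
      · exact fun t ht => (T.half'.neAB t (by omega) s (by omega)).symm
      · exact fun r hr => (H.neB r hr s (by omega)).symm
      · exact fun i i1 i2 => (T.arms.cross i i2 s (by omega)).1.symm)
    (by
      intro s hs
      rw [e0, e1]
      exact ⟨fun e => T.half'.tAB s (by omega) e.symm, fun e => H.adjB s (by omega) e.symm⟩)
    (by
      intro s hs hzs
      refine hval (fun v => ¬ G.Adj (W.B s) v) ?_ ?_ ?_
      · exact fun t ht => T.half.tBA s (by omega) hzs t (by omega)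
      · exact fun r hr e => H.clB s (by omega) hzs r hr e.symm
      · intro i i1 i2 e
        have := (T.arms.cross i i2 s (by omega)).2.1 e.symm; omega)
    hsβ (k₁ := k) (by omega) (by simpa [cat, hk] using hsk)
  have := hedge.facts.2.2.1
  rw [eq1] at this
  have := (T.arms.cross b hb s' (by omega)).2.1 this.symm
  omega

/-- The last contacts of the two arms with the prefix hole are in edges and are linked through `x`,
so the edges coincide. Beyond its prefix an arm cannot see two consecutive vertices of that prefix,
which leaves the edge joining `A p` and `A' q`. Now `Bypass.free` applies on both sides and
`false_of_free` finishes. -/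
theorem Bypass.false (hG : Good G) (T : TwoArms G z x y W W') (C : Clean G W W' p q)
    {o : V} {R : Set V} (H : Bypass G z x W W' p q o R) : False := by
  have hp := C.p_lt
  have hq := C.q_lt
  have p1 := C.one_le T
  have q1 := C.symm.one_le T.symm
  obtain ⟨b, b1, b2, ⟨e, he⟩, b4⟩ := H.last_contact hG T C
  obtain ⟨b', b1', b2', ⟨e', he'⟩, b4'⟩ := H.symm.last_contact hG T.symm C.symm
  have he'' := he'.cleanPath_symm
  have hh := C.holeOn T
  have ee : e = q + p - e' := by
    refine hh.atEdge_eq hG (b := W.A b) (b' := W'.A b')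
      (S := seg W.A (b + 1) (W.α + 1) ∪ seg W'.A (b' + 1) (W'.α + 1)) ?_ ?_ ?_ ?_ he he'' ?_ ?_ ?_
    · refine forall_cleanPath (fun s hs e => ?_) fun t ht e => ?_
      · have := T.arms.pathA.inj b2 (by omega) e; omega
      · have := T.half.eqAA b b2 t (by omega) e; omega
    · refine forall_cleanPath (fun s hs e => ?_) fun t ht e => ?_
      · have := T.half'.eqAA b' b2' s (by omega) e; omega
      · have := T.arms'.pathA.inj b2' (by omega) e; omega
    · exact ⟨(T.arms.neA b b2).symm, fun e => by
        have := (T.arms.adjA b b2).1 e.symm; omega⟩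
    · exact ⟨(T.arms'.neA b' b2').symm, fun e => by
        have := (T.arms'.adjA b' b2').1 e.symm; omega⟩
    · rintro _ (⟨i, i1, i2, rfl⟩ | ⟨i, i1, i2, rfl⟩)
      · exact ⟨(T.arms.neA i (by omega)).symm, fun e => by
          have := (T.arms.adjA i (by omega)).1 e.symm; omega⟩
      · exact ⟨(T.arms'.neA i (by omega)).symm, fun e => by
          have := (T.arms'.adjA i (by omega)).1 e.symm; omega⟩
    · rintro _ (⟨i, i1, i2, rfl⟩ | ⟨i, i1, i2, rfl⟩)
      · have h4 := b4 i (by omega) (by omega)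
        refine forall_cleanPath (P := fun v => W.A i ≠ v ∧ ¬ G.Adj (W.A i) v) (fun s hs => ⟨fun e => ?_, h4.1 s hs⟩) fun t ht => ⟨fun e => ?_, h4.2 t ht⟩
        · have := T.arms.pathA.inj (by omega) (by omega) e; omega
        · have := T.half.eqAA i (by omega) t (by omega) e; omega
      · have h4 := b4' i (by omega) (by omega)
        refine forall_cleanPath (P := fun v => W'.A i ≠ v ∧ ¬ G.Adj (W'.A i) v) (fun s hs => ⟨fun e => ?_, h4.2 s hs⟩) fun t ht => ⟨fun e => ?_, h4.1 t ht⟩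
        · have := T.half'.eqAA i (by omega) s (by omega) e; omega
        · have := T.arms'.pathA.inj (by omega) (by omega) e; omega
    · have hx : W.A W.α = W'.A W'.α := T.arms.endA.trans T.arms'.endA.symm
      have l1 := T.arms.pathA.link (i := b) (j := W.α) b2 le_rfl
        (S := insert (W.A b) (insert (W'.A b') (seg W.A (b + 1) (W.α + 1) ∪ seg W'.A (b' + 1) (W'.α + 1))))
        (fun v ⟨s, s1, s2, e⟩ => .inr (.inr (.inl ⟨s, s1, by omega, e⟩))) (by simp) (by
          rcases Nat.eq_or_lt_of_le b2 with e | e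
          · rw [← e]; simp
          · exact .inr (.inr (.inl (mem_seg_of (by omega) (by omega)))))
      have l2 := T.arms'.pathA.link (i := b') (j := W'.α) b2' le_rfl
        (S := insert (W.A b) (insert (W'.A b') (seg W.A (b + 1) (W.α + 1) ∪ seg W'.A (b' + 1) (W'.α + 1))))
        (fun v ⟨s, s1, s2, e⟩ => .inr (.inr (.inr ⟨s, s1, by omega, e⟩))) (by simp) (by
          rcases Nat.eq_or_lt_of_le b2' with e | e
          · rw [← e]; simp
          · exact .inr (.inr (.inr (mem_seg_of (by omega) (by omega)))))
      rw [hx] at l1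
      exact l1.trans l2.symm
  have hep : p ≤ e := by
    rcases he.cleanPath_cases with ⟨h1, h2, -⟩ | ⟨h1, -⟩ | ⟨h1, -⟩
    · have := (h2 e (by omega)).2 (.inl rfl)
      rw [T.arms.pathA.adj_iff b2 (by omega)] at this; omega
    · omega
    · omega
  have hep' : q ≤ e' := by
    rcases he'.cleanPath_cases with ⟨h1, h2, -⟩ | ⟨h1, -⟩ | ⟨h1, -⟩
    · have := (h2 e' (by omega)).2 (.inl rfl)
      rw [T.arms'.pathA.adj_iff b2' (by omega)] at this; omega
    · omega
    · omega
  obtain rfl : e = p := by omega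
  obtain rfl : e' = q := by omega
  have c1 := he.cleanPath_cases
  have c2 := he'.cleanPath_cases
  simp only [lt_irrefl, false_and, or_false, false_or, true_and] at c1 c2
  exact T.false_of_free hG C (H.free hG T C b1 b2 c1.1 c1.2 b4)
    (H.symm.free hG T.symm C.symm b1' b2' c2.1 c2.2 b4')

end Kaleidoscope

/-! ### Three arms whose clean prefixes end in a triangle. -/

namespace Kaleidoscope

variable {V : Type*} {G : SimpleGraph V} {z x y : V} {W W' W'' : ArmData V} {p q r : ℕ}

/-- Three pairwise independent pairs of arms. -/
structure ThreeArms (G : SimpleGraph V) (z x y : V) (W W' W'' : ArmData V) : Prop where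
  t₁₂ : TwoArms G z x y W W'
  t₁₃ : TwoArms G z x y W W''
  t₂₃ : TwoArms G z x y W' W''

theorem ThreeArms.swap₁₂ (T : ThreeArms G z x y W W' W'') : ThreeArms G z x y W' W W'' :=
  ⟨T.t₁₂.symm, T.t₂₃, T.t₁₃⟩

theorem ThreeArms.swap₂₃ (T : ThreeArms G z x y W W' W'') : ThreeArms G z x y W W'' W' :=
  ⟨T.t₁₃, T.t₁₂, T.t₂₃.symm⟩

/-- A triangle formed by pairwise clean prefixes. -/
structure CleanTriple (G : SimpleGraph V) (W W' W'' : ArmData V) (p q r : ℕ) : Prop where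
  c₁₂ : Clean G W W' p q
  c₁₃ : Clean G W W'' p r
  c₂₃ : Clean G W' W'' q r

theorem CleanTriple.swap₁₂ (T : CleanTriple G W W' W'' p q r) : CleanTriple G W' W W'' q p r :=
  ⟨T.c₁₂.symm, T.c₂₃, T.c₁₃⟩

theorem CleanTriple.swap₂₃ (T : CleanTriple G W W' W'' p q r) : CleanTriple G W W'' W' p r q :=
  ⟨T.c₁₃, T.c₁₂, T.c₂₃.symm⟩

variable [Finite V]

/-- An arm of `W''` that missed the prefix hole before reaching `x` would be a bypass. So there is a
contact, and the first one is in an edge. -/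
theorem ThreeArms.exists_contact (hG : Good G) (T : ThreeArms G z x y W W' W'')
    (C : Clean G W W' p q) :
    ∃ c < W''.α, (∃ e, AtEdge G (W''.A c) (cleanPath W W' p q) (p + 1 + q) e) ∧
      ∀ s < c, (∀ i ≤ p, ¬ G.Adj (W''.A s) (W.A i)) ∧ ∀ t ≤ q, ¬ G.Adj (W''.A s) (W'.A t) := by
  have H := T.t₁₃.arms'
  have hp := C.p_lt
  have hq := C.q_lt
  have hα := H.one_le
  have hh := C.holeOn T.t₁₂
  by_cases hcon : ∃ s < W''.α, ∃ k ≤ p + 1 + q, G.Adj (W''.A s) (cleanPath W W' p q k)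
  · obtain ⟨s, hs, k, hk, hsk⟩ := hcon
    obtain ⟨c, hc, e, he, hmin⟩ := hh.first_atEdge hG (H.pathA.le (show W''.α - 1 ≤ W''.α by omega))
      ((H.adjA 0 (by omega)).2 rfl) (fun s hs => (H.neA s (by omega)).symm)
      (by
        intro s hs
        refine forall_cleanPath (fun i hi e => ?_) fun t ht e => ?_
        · have := T.t₁₃.half'.eqAA s (by omega) i (by omega) e; omega
        · have := T.t₂₃.half'.eqAA s (by omega) t (by omega) e; omega)
      (by
        intro s hs
        rw [cleanPath_le (by omega), cleanPath_gt (by omega),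
          show q - (p + 1 + q - (p + 1)) = 0 by omega]
        exact ⟨fun e => T.t₁₃.half.tAA s (by omega) e.symm,
          fun e => T.t₂₃.half.tAA s (by omega) e.symm⟩)
      (by
        intro s hs hzs
        obtain rfl := (H.adjA s (by omega)).1 hzs
        exact forall_cleanPath (P := fun v => ¬ G.Adj (W''.A 0) v)
          (fun i hi => T.t₁₃.half'.tAA i (by omega)) (fun i hi => T.t₂₃.half'.tAA i (by omega)))
      (s₁ := s) (by omega) hk hsk
    refine ⟨c, by omega, ⟨e, he⟩, fun s hs => ⟨fun i hi => ?_, fun t ht => ?_⟩⟩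
    · obtain ⟨k, hk, e⟩ := cleanPath_left (W := W) (W' := W') (p := p) (q := q) hi
      rw [← e]; exact hmin s hs k hk
    · obtain ⟨k, hk, e⟩ := cleanPath_right (W := W) (W' := W') (p := p) (q := q) ht
      rw [← e]; exact hmin s hs k hk
  · exfalso
    push Not at hcon
    refine Bypass.false (o := W''.A 0) (R := seg W''.A 0 W''.α) hG T.t₁₂ C ⟨?_, ?_, ?_, ?_, ?_, ?_, ?_, ?_, ?_, ?_, ?_, ?_, ?_, ?_, ?_⟩
    · exact mem_seg_of le_rfl (by omega)
    · exact (H.adjA 0 (by omega)).2 rfl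
    · rintro ⟨s, h1, h2, e⟩; exact H.neA s h2.le e
    · rintro _ ⟨s, h1, h2, rfl⟩ e
      rw [(H.adjA s h2.le).1 e]
    · rintro _ ⟨s, h1, h2, rfl⟩ i hi
      obtain ⟨k, hk, e⟩ := cleanPath_left (W := W) (W' := W') (p := p) (q := q) hi
      rw [← e]; exact hcon s h2 k hk
    · rintro _ ⟨s, h1, h2, rfl⟩ i hi
      obtain ⟨k, hk, e⟩ := cleanPath_right (W := W) (W' := W') (p := p) (q := q) hi
      rw [← e]; exact hcon s h2 k hk
    · rintro _ ⟨s, h1, h2, rfl⟩ i hi e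
      have := T.t₁₃.half'.eqAA s h2.le i hi e; omega
    · rintro _ ⟨s, h1, h2, rfl⟩ i hi e
      have := T.t₂₃.half'.eqAA s h2.le i hi e; omega
    · rintro _ ⟨s, h1, h2, rfl⟩ i hi
      exact T.t₁₃.half'.neAB s h2.le i hi
    · rintro _ ⟨s, h1, h2, rfl⟩ i hi
      exact T.t₂₃.half'.neAB s h2.le i hi
    · have := H.pathA.link_le (Nat.zero_le W''.α) le_rfl (S := insert x (seg W''.A 0 W''.α)) (by
        intro s _ hs
        rcases Nat.eq_or_lt_of_le hs with rfl | hs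
        · rw [H.endA]; simp
        · exact .inr (mem_seg_of (by omega) hs))
      rwa [H.endA] at this
    · exact fun t ht => T.t₁₃.half'.tAB t ht.le
    · exact fun t ht => T.t₂₃.half'.tAB t ht.le
    · rintro t ht hz _ ⟨s, h1, h2, rfl⟩ e
      exact T.t₁₃.half.tBA t ht.le hz s h2.le e.symm
    · rintro t ht hz _ ⟨s, h1, h2, rfl⟩ e
      exact T.t₂₃.half.tBA t ht.le hz s h2.le e.symm

/-- In a clean triple, the first contact of an arm towards `y` is complete to the other two
vertices of the triangle. -/
theorem CleanTriple.free_or (hG : Good G) (T : ThreeArms G z x y W W' W'')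
    (C : CleanTriple G W W' W'' p q r) :
    (∀ s ≤ W.β, (∀ k ≤ q, ¬ G.Adj (W.B s) (W'.A k)) ∧ ∀ k ≤ r, ¬ G.Adj (W.B s) (W''.A k)) ∨
    ∃ s ≤ W.β, (∀ k ≤ q, G.Adj (W.B s) (W'.A k) ↔ k = q) ∧
      (∀ k ≤ r, G.Adj (W.B s) (W''.A k) ↔ k = r) ∧
      ∀ s' < s, (∀ k ≤ q, ¬ G.Adj (W.B s') (W'.A k)) ∧ ∀ k ≤ r, ¬ G.Adj (W.B s') (W''.A k) := by
  by_cases hcon : ∃ s ≤ W.β, ∃ k ≤ q + 1 + r, G.Adj (W.B s) (cleanPath W' W'' q r k)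
  · right
    obtain ⟨s, hs, k, hk, hsk⟩ := hcon
    have hp := C.c₁₂.p_lt
    have hq := C.c₂₃.p_lt
    have hr := C.c₂₃.q_lt
    -- `A p` attaches to the edge from `A' q` to `A'' r` of the prefix hole of the other two, which
    -- forces the first contact of `B` into the same edge.
    obtain ⟨s, hs', he, hmin⟩ := T.t₁₂.arms.first_contact hG (C.c₂₃.holeOn T.t₂₃) (p := p) (e := q)
      (C.c₁₂.one_le T.t₁₂) hp.le (le_refl W.β)
      (by
        intro i hi
        refine forall_cleanPath (P := fun v => W.A i ≠ v ∧ (G.Adj (W.A i) v → i = p))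
          (fun t ht => ⟨fun e => ?_, fun e => (C.c₁₂.only i hi t ht e).1⟩)
          fun t ht => ⟨fun e => ?_, fun e => (C.c₁₃.only i hi t ht e).1⟩
        · have := T.t₁₂.half.eqAA i (by omega) t (by omega) e; omega
        · have := T.t₁₃.half.eqAA i (by omega) t (by omega) e; omega)
      (by
        refine ⟨by omega, fun k hk => ?_⟩
        by_cases h : k ≤ q
        · rw [cleanPath_le h]
          refine ⟨fun e => .inl (C.c₁₂.only p le_rfl k h e).2, fun e => ?_⟩
          obtain rfl : k = q := by omega
          exact C.c₁₂.adj
        · rw [cleanPath_gt (by omega)]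
          refine ⟨fun e => ?_, fun e => ?_⟩
          · have := (C.c₁₃.only p le_rfl _ (by omega) e).2; omega
          · rw [show r - (k - (q + 1)) = r by omega]; exact C.c₁₃.adj)
      (by
        intro s hs
        exact forall_cleanPath (fun t ht => (T.t₁₂.half'.neAB t (by omega) s hs).symm)
          fun t ht => (T.t₁₃.half'.neAB t (by omega) s hs).symm)
      (by
        intro s hs
        rw [cleanPath_le (by omega), cleanPath_gt (by omega),
          show r - (q + 1 + r - (q + 1)) = 0 by omega]
        exact ⟨fun e => T.t₁₂.half'.tAB s hs e.symm, fun e => T.t₁₃.half'.tAB s hs e.symm⟩)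
      (by
        intro s hs hz
        exact forall_cleanPath (P := fun v => ¬ G.Adj (W.B s) v)
          (fun t ht => T.t₁₂.half.tBA s hs hz t (by omega))
          fun t ht => T.t₁₃.half.tBA s hs hz t (by omega))
      hs hk hsk
    have c1 := he.cleanPath_cases
    simp only [lt_irrefl, false_and, or_false, false_or, true_and] at c1
    refine ⟨s, by omega, c1.1, c1.2, fun s' hs' => ⟨fun i hi => ?_, fun t ht => ?_⟩⟩
    · obtain ⟨k, hk, e⟩ := cleanPath_left (W := W') (W' := W'') (p := q) (q := r) hi
      rw [← e]; exact hmin s' hs' k hk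
    · obtain ⟨k, hk, e⟩ := cleanPath_right (W := W') (W' := W'') (p := q) (q := r) ht
      rw [← e]; exact hmin s' hs' k hk
  · left
    push Not at hcon
    refine fun s hs => ⟨fun i hi => ?_, fun t ht => ?_⟩
    · obtain ⟨k, hk, e⟩ := cleanPath_left (W := W') (W' := W'') (p := q) (q := r) hi
      rw [← e]; exact hcon s hs k hk
    · obtain ⟨k, hk, e⟩ := cleanPath_right (W := W') (W' := W'') (p := q) (q := r) ht
      rw [← e]; exact hcon s hs k hk

/-- The contact data of two arms towards `y` in a clean triple. -/
structure TripleContact (G : SimpleGraph V) (z : V) (W W' W'' : ArmData V) (q r s : ℕ) : Prop where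
  le : s ≤ W.β
  adj₂ : ∀ k ≤ q, G.Adj (W.B s) (W'.A k) ↔ k = q
  adj₃ : ∀ k ≤ r, G.Adj (W.B s) (W''.A k) ↔ k = r
  before : ∀ s' < s, (∀ k ≤ q, ¬ G.Adj (W.B s') (W'.A k)) ∧ ∀ k ≤ r, ¬ G.Adj (W.B s') (W''.A k)
  simple : ∀ s ≤ W.β, G.Adj z (W.B s) → s = 0

omit [Finite V] in
-- `y` does not see the prefix of `W'`, which excludes `β`; `B 0` is a neighbour of `z` and does not
-- touch the path of `W'`, which excludes `0`.
theorem TripleContact.lt {s : ℕ} (C : Clean G W W' p q) (T : TwoArms G z x y W W')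
    (H : TripleContact G z W W' W'' q r s) : s < W.β ∧ 1 ≤ s := by
  constructor
  · refine lt_of_le_of_ne H.le ?_
    rintro rfl
    have h := (H.adj₂ q le_rfl).2 rfl
    rw [T.arms.endB, ← T.arms'.endB] at h
    have := (T.arms'.cross q C.q_lt.le W'.β le_rfl).2.1 h.symm
    have := T.arms'.beta_pos; omega
  · by_contra h
    obtain rfl : s = 0 := by omega
    exact T.half.tBA 0 (by omega) T.arms.adjB q C.q_lt.le ((H.adj₂ q le_rfl).2 rfl)

omit [Finite V] in
/-- If the first contact of one arm sees the other arm before its first contact, there is a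
contradiction. -/
theorem CleanTriple.false_of_contact (hG : Good G) (T : ThreeArms G z x y W W' W'')
    (C : CleanTriple G W W' W'' p q r) {s t b : ℕ} (H : TripleContact G z W W' W'' q r s)
    (H' : TripleContact G z W' W W'' p r t)
    (hno : ∀ i < s, ∀ j < t, ¬ G.Adj (W.B i) (W'.B j)) (hb : b < t)
    (hsb : G.Adj (W.B s) (W'.B b)) : False := by
  obtain ⟨b, hb', hsb, hmin⟩ := exists_first (P := fun b => G.Adj (W.B s) (W'.B b)) hsb
  have hsβ := H.lt C.c₁₂ T.t₁₂
  have htβ := H'.lt C.c₁₂.symm T.t₁₂.symm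
  have b1 : 1 ≤ b := by
    by_contra h
    obtain rfl : b = 0 := by omega
    exact T.t₁₂.half'.tBB 0 (by omega) T.t₁₂.arms'.adjB s (by omega) hsb.symm
  have hr := C.c₁₃.q_lt
  have r1 := C.c₁₃.symm.one_le T.t₁₃.symm
  have hq := C.c₂₃.p_lt
  -- On the hole `z, B 0, …, B s, B' b, …, B' 0` the vertex `A'' r` sees `B s` only. Being linked to
  -- `z` along its own arm away from the hole, it would have to attach to an edge.
  have hh : HoleOn G z (cat W.B s fun i => W'.B (b - i)) (s + 1 + b) := by
    refine ⟨(T.t₁₂.arms.pathB.le H.le).cat (T.t₁₂.arms'.pathB.rev (by omega)) ?_, by omega, ?_, ?_⟩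
    · intro i hi j hj
      refine ⟨fun e => ?_, fun e => ?_, ?_⟩
      · have := T.t₁₂.half.eqBB i (by omega) (b - j) (by omega) e; omega
      · rcases Nat.eq_or_lt_of_le hi with rfl | hi'
        · by_contra hne
          exact hmin (b - j) (by omega) e
        · exact absurd e (hno i hi' _ (by omega))
      · rintro ⟨rfl, rfl⟩; exact hsb
    · intro i hi
      simp only [cat]; split_ifs
      · exact T.t₁₂.arms.neB i (by omega)
      · exact T.t₁₂.arms'.neB _ (by omega)
    · intro i hi
      simp only [cat]; split_ifs with h
      · refine ⟨fun e => .inl (H.simple i (by omega) e), fun e => ?_⟩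
        obtain rfl : i = 0 := by omega
        exact T.t₁₂.arms.adjB
      · refine ⟨fun e => ?_, fun e => ?_⟩
        · have := H'.simple _ (by omega) e; omega
        · rw [show b - (i - (s + 1)) = 0 by omega]; exact T.t₁₂.arms'.adjB
  have e0 : cat W.B s (fun i => W'.B (b - i)) 0 = W.B 0 := by simp [cat]
  have e1 : cat W.B s (fun i => W'.B (b - i)) (s + 1 + b) = W'.B 0 := by
    simp only [cat]; rw [if_neg (by omega)]; congr 1; omega
  have es : cat W.B s (fun i => W'.B (b - i)) s = W.B s := by simp [cat]
  have hne : ∀ j ≤ r, ∀ i ≤ s + 1 + b, W''.A j ≠ cat W.B s (fun i => W'.B (b - i)) i := by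
    intro j hj i hi
    simp only [cat]; split_ifs with h
    · exact T.t₁₃.half'.neAB j (by omega) i (by omega)
    · exact T.t₂₃.half'.neAB j (by omega) _ (by omega)
  have hcon : ∀ j ≤ r, ∀ i ≤ s + 1 + b, G.Adj (W''.A j) (cat W.B s (fun i => W'.B (b - i)) i) →
      j = r ∧ i = s := by
    intro j hj i hi
    simp only [cat]; split_ifs with h
    · intro e
      rcases Nat.eq_or_lt_of_le h with rfl | h
      · exact ⟨(H.adj₃ j hj).1 e.symm, rfl⟩
      · exact absurd e.symm ((H.before i h).2 j hj)
    · exact fun e => absurd e.symm ((H'.before _ (by omega)).2 j hj)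
  obtain ⟨e, he⟩ := hh.atEdge_of_link hG (c := W''.A r) (hne r le_rfl)
    (T.t₁₃.arms'.neA r hr.le).symm
    (fun e => by have := (T.t₁₃.arms'.adjA r hr.le).1 e.symm; omega)
    (fun e => by have := (hcon r le_rfl 0 (by omega) e).2; omega)
    (fun e => by have := (hcon r le_rfl _ (by omega) e).2; omega)
    (R := seg W''.A 0 r)
    (by rintro _ ⟨j, -, hj, rfl⟩ i hi
        exact ⟨hne j hj.le i hi, fun e => by have := (hcon j hj.le i hi e).1; omega⟩)
    ((Link.of_adj ((T.t₁₃.arms'.adjA 0 (by omega)).2 rfl) (by simp)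
      (.inr (.inr (mem_seg_of le_rfl (by omega))))).trans
      (T.t₁₃.arms'.pathA.link (Nat.zero_le r) hr.le
      (fun v ⟨i, h1, h2, e⟩ => .inr (.inr ⟨i, by omega, h2, e⟩))
      (.inr (.inr (mem_seg_of le_rfl (by omega)))) (by simp)))
    (k := s) (by omega) (by rw [es]; exact ((H.adj₃ r le_rfl).2 rfl).symm)
  obtain ⟨h1, h2, h3, -⟩ := he.facts
  have := (hcon r le_rfl e (by omega) h2).2
  have := (hcon r le_rfl (e + 1) (by omega) h3).2
  omega

/-- Up to the contacts, the only possible edge between the arms towards `y` joins `B s` and `B' t`.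
Then `A'' r` is the centre of an even wheel with neighbours `A p`, `A' q`, `B s`, `B' t`: these form
a four-cycle if `B s` and `B' t` are adjacent, and otherwise lie on a hole through `z`. -/
theorem CleanTriple.false_of_not_free (hG : Good G) (T : ThreeArms G z x y W W' W'')
    (C : CleanTriple G W W' W'' p q r) {s t : ℕ} (H : TripleContact G z W W' W'' q r s)
    (H' : TripleContact G z W' W W'' p r t) : False := by
  have hsβ := H.lt C.c₁₂ T.t₁₂
  have htβ := H'.lt C.c₁₂.symm T.t₁₂.symm
  have hr := C.c₁₃.q_lt
  have r1 := C.c₁₃.symm.one_le T.t₁₃.symm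
  have p1 := C.c₁₃.one_le T.t₁₃
  have q1 := C.c₂₃.one_le T.t₂₃
  have hp := C.c₁₂.p_lt
  have hq := C.c₂₃.p_lt
  have hno : ∀ i < s, ∀ j < t, ¬ G.Adj (W.B i) (W'.B j) := by
    intro i₀ hi₀ j₀ hj₀ h₀
    obtain ⟨i, hi, ⟨j₁, hj₁, hij₁⟩, hmin⟩ :=
      exists_first (P := fun i => ∃ j < t, G.Adj (W.B i) (W'.B j)) ⟨j₀, hj₀, h₀⟩
    obtain ⟨j, hj, hij, hmin'⟩ := exists_first (P := fun j => G.Adj (W.B i) (W'.B j)) hij₁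
    refine T.t₁₂.false_of_adj hG C.c₁₂ (s := i) (t := j) (by omega) (by omega) hij ?_
      (fun s' h1 => (H.before s' (by omega)).1) fun t' h1 => (H'.before t' (by omega)).1
    intro s' h1 t' h2 e
    have e1 : s' = i := by
      by_contra hne; exact hmin s' (by omega) ⟨t', by omega, e⟩
    refine ⟨e1, ?_⟩
    subst e1
    by_contra hne; exact hmin' t' (by omega) e
  have hno₁ : ∀ j < t, ¬ G.Adj (W.B s) (W'.B j) := fun j hj e =>
    C.false_of_contact hG T H H' hno hj e
  have hno₂ : ∀ i < s, ¬ G.Adj (W.B i) (W'.B t) := fun j hj e =>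
    C.swap₁₂.false_of_contact hG T.swap₁₂ H' H (fun i hi j hj e => hno j hj i hi e.symm) hj e.symm
  have a12 : G.Adj (W.A p) (W'.A q) := C.c₁₂.adj
  have a13 : G.Adj (W''.A r) (W.A p) := C.c₁₃.adj.symm
  have a23 : G.Adj (W''.A r) (W'.A q) := C.c₂₃.adj.symm
  have h12 : G.Adj (W.B s) (W'.A q) := (H.adj₂ q le_rfl).2 rfl
  have h13 : G.Adj (W''.A r) (W.B s) := ((H.adj₃ r le_rfl).2 rfl).symm
  have h21 : G.Adj (W'.B t) (W.A p) := (H'.adj₂ p le_rfl).2 rfl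
  have h23 : G.Adj (W''.A r) (W'.B t) := ((H'.adj₃ r le_rfl).2 rfl).symm
  have x1 := T.t₁₂.arms.cross p hp.le s H.le
  have x2 := T.t₁₂.arms'.cross q hq.le t H'.le
  have n1 : ¬ G.Adj (W.A p) (W.B s) := by rw [x1.2]; omega
  have n2 : ¬ G.Adj (W'.A q) (W'.B t) := by rw [x2.2]; omega
  have nbb : W.B s ≠ W'.B t := fun e => by
    have := T.t₁₂.half.eqBB s H.le t H'.le e; omega
  have nab : W.A p ≠ W'.B t := T.t₁₂.half.neAB p hp.le t H'.le
  have nba : W'.A q ≠ W.B s := T.t₁₂.half'.neAB q hq.le s H.le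
  by_cases hst : G.Adj (W.B s) (W'.B t)
  · let g : ℕ → V := fun i => if i = 0 then W'.A q else if i = 1 then W.B s else W'.B t
    have hh : HoleOn G (W.A p) g 2 := by
      refine ⟨?_, le_rfl, ?_, ?_⟩
      · intro i j hij hj
        have : (i = 0 ∧ j = 1) ∨ (i = 0 ∧ j = 2) ∨ (i = 1 ∧ j = 2) := by omega
        rcases this with ⟨rfl, rfl⟩ | ⟨rfl, rfl⟩ | ⟨rfl, rfl⟩
        · simp [g, nba, h12.symm]
        · simp [g, x2.1, n2]
        · simp [g, nbb, hst]
      · intro i hi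
        have : i = 0 ∨ i = 1 ∨ i = 2 := by omega
        rcases this with rfl | rfl | rfl
        · simp [g, a12.ne]
        · simp [g, x1.1]
        · simp [g, nab]
      · intro i hi
        have : i = 0 ∨ i = 1 ∨ i = 2 := by omega
        rcases this with rfl | rfl | rfl
        · simp [g, a12]
        · simp [g, n1]
        · simp [g, h21.symm]
    have hseg : ∀ v, v ∈ insert (W.A p) (g '' Set.Iic 2) ↔
        v = W.A p ∨ v = W'.A q ∨ v = W.B s ∨ v = W'.B t := by
      intro v
      rw [seg_Iic, Set.mem_insert_iff, mem_seg]
      constructor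
      · rintro (h | ⟨i, -, hi, rfl⟩)
        · exact .inl h
        · have : i = 0 ∨ i = 1 ∨ i = 2 := by omega
          rcases this with rfl | rfl | rfl <;> simp [g]
      · rintro (h | h | h | h)
        · exact .inl h
        · exact .inr ⟨0, by simp, by simp, h⟩
        · exact .inr ⟨1, by simp, by simp, h⟩
        · exact .inr ⟨2, by simp, by simp, h⟩
    have hdeg : deg G (W''.A r) (insert (W.A p) (g '' Set.Iic 2)) = 4 := by
      refine deg_eq_four ((hseg _).2 (.inl rfl)) ((hseg _).2 (.inr (.inl rfl)))
        ((hseg _).2 (.inr (.inr (.inl rfl)))) ((hseg _).2 (.inr (.inr (.inr rfl)))) a12.ne x1.1 nab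
        nba x2.1 nbb fun w hw => ⟨fun _ => (hseg w).1 hw, ?_⟩
      rintro (rfl | rfl | rfl | rfl) <;> assumption
    refine hG.wheel (hh.hasEvenWheel (c := W''.A r) a13.ne ?_ (by omega) (by rw [hdeg]; decide))
    intro i hi
    have : i = 0 ∨ i = 1 ∨ i = 2 := by omega
    rcases this with rfl | rfl | rfl
    · simpa [g] using a23.ne
    · simpa [g] using h13.ne
    · simpa [g] using h23.ne
  · refine hG.wheel (hasEvenWheel_of_link (c := W''.A r) (s := W.B s) (t := W'.B t) (b := W'.A q)
      (b' := W.A p) (S₁ := {W'.A q, W.A p}) (S₂ := insert z (seg W.B 0 s ∪ seg W'.B 0 t)) nbb hst ?_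
      ?_ ?_ ?_ ?_ a12.ne.symm h13 h23 a23 a13 ?_ ?_)
    · rintro _ (rfl | rfl) v (rfl | ⟨i, -, hi, rfl⟩ | ⟨i, -, hi, rfl⟩)
      · exact ⟨(T.t₁₂.arms'.neA q hq.le).symm, fun e => by
          have := (T.t₁₂.arms'.adjA q hq.le).1 e.symm; omega⟩
      · exact ⟨T.t₁₂.half'.neAB q hq.le i (by omega), fun e => (H.before i hi).1 q le_rfl e.symm⟩
      · have := T.t₁₂.arms'.cross q hq.le i (by omega)
        exact ⟨this.1, by rw [this.2]; omega⟩
      · exact ⟨(T.t₁₂.arms.neA p hp.le).symm, fun e => by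
          have := (T.t₁₂.arms.adjA p hp.le).1 e.symm; omega⟩
      · have := T.t₁₂.arms.cross p hp.le i (by omega)
        exact ⟨this.1, by rw [this.2]; omega⟩
      · exact ⟨T.t₁₂.half.neAB p hp.le i (by omega), fun e => (H'.before i hi).1 p le_rfl e.symm⟩
    · exact (Link.of_adj h12 (by simp) (by simp)).trans ((Link.of_adj a12.symm (by simp)
        (by simp)).trans (Link.of_adj h21.symm (by simp) (by simp)))
    · refine (T.t₁₂.arms.pathB.link_ge (Nat.zero_le s) H.le ?_).trans ((Link.of_adj
        T.t₁₂.arms.adjB.symm ?_ (by simp)).trans ((Link.of_adj T.t₁₂.arms'.adjB (by simp) ?_).trans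
        (T.t₁₂.arms'.pathB.link_le (Nat.zero_le t) H'.le ?_)))
      · intro i _ hi
        rcases Nat.eq_or_lt_of_le hi with rfl | hi
        · simp
        · exact .inr (.inr (.inr (.inl (mem_seg_of (by omega) hi))))
      · exact .inr (.inr (.inr (.inl (mem_seg_of (by omega) (by omega)))))
      · exact .inr (.inr (.inr (.inr (mem_seg_of (by omega) (by omega)))))
      · intro i _ hi
        rcases Nat.eq_or_lt_of_le hi with rfl | hi
        · simp
        · exact .inr (.inr (.inr (.inr (mem_seg_of (by omega) hi))))
    · rintro v (rfl | rfl) e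
      · rfl
      · exact absurd e.symm n1
    · rintro v (rfl | rfl) e
      · exact absurd e.symm n2
      · rfl
    · rintro v (rfl | rfl)
      · exact ⟨a23.ne, fun _ => .inl rfl⟩
      · exact ⟨a13.ne, fun _ => .inr rfl⟩
    · rintro v (rfl | ⟨i, -, hi, rfl⟩ | ⟨i, -, hi, rfl⟩)
      · exact ⟨(T.t₁₃.arms'.neA r hr.le).symm, fun e => by
          have := (T.t₁₃.arms'.adjA r hr.le).1 e.symm; omega⟩
      · exact ⟨T.t₁₃.half'.neAB r hr.le i (by omega), fun e => (H.before i hi).2 r le_rfl e.symm⟩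
      · exact ⟨T.t₂₃.half'.neAB r hr.le i (by omega), fun e => (H'.before i hi).2 r le_rfl e.symm⟩

/-- The neighbours of `z` on the second arm reduce to its first vertex. -/
def Simple (G : SimpleGraph V) (z : V) (W : ArmData V) : Prop :=
  ∀ s ≤ W.β, G.Adj z (W.B s) → s = 0

/-- By `free_or` each of the three arms towards `y` is free of the other two prefixes or touches
them at the triangle. Two arms are of the same kind, and `false_of_free` or `false_of_not_free`
applies to them. -/
theorem CleanTriple.false (hG : Good G) (T : ThreeArms G z x y W W' W'') (hz : Simple G z W)
    (hz' : Simple G z W') (hz'' : Simple G z W'') (C : CleanTriple G W W' W'' p q r) : False := by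
  rcases C.free_or hG T with h1 | ⟨s1, a1, b1, c1, d1⟩ <;>
  rcases C.swap₁₂.free_or hG T.swap₁₂ with h2 | ⟨s2, a2, b2, c2, d2⟩ <;>
  rcases C.swap₂₃.swap₁₂.free_or hG T.swap₂₃.swap₁₂ with h3 | ⟨s3, a3, b3, c3, d3⟩
  · exact T.t₁₂.false_of_free hG C.c₁₂ (fun s hs => (h1 s hs).1) fun s hs => (h2 s hs).1
  · exact T.t₁₂.false_of_free hG C.c₁₂ (fun s hs => (h1 s hs).1) fun s hs => (h2 s hs).1
  · exact T.t₁₃.false_of_free hG C.c₁₃ (fun s hs => (h1 s hs).2) fun s hs => (h3 s hs).1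
  · exact C.swap₁₂.swap₂₃.false_of_not_free hG T.swap₁₂.swap₂₃ (s := s2) (t := s3)
      ⟨a2, c2, b2, fun s hs => (d2 s hs).symm, hz'⟩ ⟨a3, c3, b3, fun s hs => (d3 s hs).symm, hz''⟩
  · exact T.t₂₃.false_of_free hG C.c₂₃ (fun s hs => (h2 s hs).2) fun s hs => (h3 s hs).2
  · exact C.swap₂₃.false_of_not_free hG T.swap₂₃ (s := s1) (t := s3)
      ⟨a1, c1, b1, fun s hs => (d1 s hs).symm, hz⟩ ⟨a3, b3, c3, d3, hz''⟩
  · exact C.false_of_not_free hG T (s := s1) (t := s2) ⟨a1, b1, c1, d1, hz⟩ ⟨a2, b2, c2, d2, hz'⟩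
  · exact C.false_of_not_free hG T (s := s1) (t := s2) ⟨a1, b1, c1, d1, hz⟩ ⟨a2, b2, c2, d2, hz'⟩

end Kaleidoscope

/-! ### The descent that excludes clean pairs, and the theta of three arms. -/

namespace Kaleidoscope

variable {V : Type*} {G : SimpleGraph V} {z x y : V} {W W' W'' : ArmData V} {p q r : ℕ}

variable [Finite V]

/-- The third arm attaches to an edge of the arm of `W`. -/
theorem Clean.centre (hG : Good G) (T : ThreeArms G z x y W W' W'') (C : Clean G W W' p q)
    {c e : ℕ} (hc : c < W''.α) (he : e < p)
    (hcA : ∀ s ≤ p, G.Adj (W''.A c) (W.A s) ↔ s = e ∨ s = e + 1)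
    (hcA' : ∀ t ≤ q, ¬ G.Adj (W''.A c) (W'.A t))
    (hbef : ∀ s < c, (∀ i ≤ p, ¬ G.Adj (W''.A s) (W.A i)) ∧ ∀ t ≤ q, ¬ G.Adj (W''.A s) (W'.A t)) :
    (∀ s ≤ W.β, ∀ k ≤ q, ¬ G.Adj (W.B s) (W'.A k)) ∧ Clean G W W'' e c ∧
      ∃ t ≤ W''.β, ∃ k ≤ e, G.Adj (W''.B t) (W.A k) := by
  have hp := C.p_lt
  have hq := C.q_lt
  have p1 := C.one_le T.t₁₂
  have q1 := C.symm.one_le T.t₁₂.symm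
  have C' : Clean G W W'' e c := by
    refine ⟨by omega, hc, ((hcA e (by omega)).2 (.inl rfl)).symm, fun s hs t ht h => ?_⟩
    rcases Nat.eq_or_lt_of_le ht with rfl | ht
    · have := (hcA s (by omega)).1 h.symm; omega
    · exact absurd h.symm ((hbef t ht).1 s (by omega))
  have e1 := C'.one_le T.t₁₃
  have c1 := C'.symm.one_le T.t₁₃.symm
  have hcc : ∀ s ≤ c, ∀ i ≤ p, e < i → G.Adj (W''.A s) (W.A i) → s = c ∧ i = e + 1 := by
    intro s hs i hi hei h
    rcases Nat.eq_or_lt_of_le hs with rfl | hs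
    · have := (hcA i hi).1 h; omega
    · exact absurd h ((hbef s hs).1 i hi)
  have hcc' : ∀ s ≤ c, ∀ t ≤ q, ¬ G.Adj (W''.A s) (W'.A t) := by
    intro s hs t ht
    rcases Nat.eq_or_lt_of_le hs with rfl | hs
    · exact hcA' t ht
    · exact (hbef s hs).2 t ht
  -- `D` is `A p, …, A (e + 1), A'' c, …, A'' 0`. Preceded by `A' 0, …, A' q` it closes a hole with
  -- `z`, on which the remaining prefix `A 0, …, A e` attaches at the edge from `A (e + 1)` to `A''
  -- c`. A contact of `B` with this hole would force a vertex of `B` to see `A (e + 1)`, which is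
  -- impossible; so `B` is free of both other prefixes.
  set D : ℕ → V := cat (fun i => W.A (p - i)) (p - e - 1) (fun i => W''.A (c - i)) with hDdef
  have hDle : ∀ k ≤ p - e - 1, D k = W.A (p - k) := fun k hk => by simp [hDdef, cat, hk]
  have hDgt : ∀ k, p - e - 1 < k → D k = W''.A (c - (k - (p - e))) := fun k hk => by
    simp only [hDdef, cat]; rw [if_neg (by omega)]; congr 2; omega
  have hD : IndPath G D (p - e - 1 + 1 + c) := by
    refine ((T.t₁₂.arms.pathA.rev hp.le).le (by omega)).cat (T.t₁₃.arms'.pathA.rev hc.le) ?_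
    intro i hi j hj
    refine ⟨fun h => ?_, fun h => ?_, ?_⟩
    · have := T.t₁₃.half.eqAA _ (by omega) _ (by omega) h; omega
    · have := hcc (c - j) (by omega) (p - i) (by omega) (by omega) h.symm; omega
    · rintro ⟨rfl, rfl⟩
      exact ((hcA _ (by omega)).2 (.inr (by omega))).symm
  have hcross : ∀ t ≤ q, ∀ k ≤ p - e - 1 + 1 + c, W'.A t ≠ D k ∧
      (G.Adj (W'.A t) (D k) ↔ t = q ∧ k = 0) := by
    intro t ht k hk
    by_cases h : k ≤ p - e - 1
    · rw [hDle k h]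
      refine ⟨fun h => ?_, fun h => ?_, ?_⟩
      · have := T.t₁₂.half'.eqAA t (by omega) _ (by omega) h; omega
      · have := C.only (p - k) (by omega) t ht h.symm; omega
      · rintro ⟨rfl, rfl⟩; exact C.adj.symm
    · rw [hDgt k (by omega)]
      refine ⟨fun h => ?_, fun h => ?_, fun h => by omega⟩
      · have := T.t₂₃.half.eqAA t (by omega) _ (by omega) h; omega
      · exact absurd h.symm (hcc' _ (by omega) t ht)
  have hval : ∀ (Q : V → Prop), (∀ t ≤ q, Q (W'.A t)) → (∀ i, e < i → i ≤ p → Q (W.A i)) →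
      (∀ s ≤ c, Q (W''.A s)) → ∀ k ≤ q + 1 + (p - e - 1 + 1 + c), Q (cat W'.A q D k) := by
    intro Q h1 h2 h3 k hk
    simp only [cat]; split_ifs with h
    · exact h1 k h
    · by_cases h' : k - (q + 1) ≤ p - e - 1
      · rw [hDle _ h']; exact h2 _ (by omega) (by omega)
      · rw [hDgt _ (by omega)]; exact h3 _ (by omega)
  have hh : HoleOn G z (cat W'.A q D) (q + 1 + (p - e - 1 + 1 + c)) := by
    refine ⟨(T.t₁₂.arms'.pathA.le hq.le).cat hD hcross, by omega, ?_, fun k hk => ?_⟩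
    · exact hval (fun v => z ≠ v) (fun t ht => T.t₁₂.arms'.neA t (by omega))
        (fun i _ hi => T.t₁₂.arms.neA i (by omega)) fun s hs => T.t₁₃.arms'.neA s (by omega)
    · simp only [cat]; split_ifs with h
      · rw [T.t₁₂.arms'.adjA k (by omega)]; omega
      · by_cases h' : k - (q + 1) ≤ p - e - 1
        · rw [hDle _ h', T.t₁₂.arms.adjA _ (by omega)]; omega
        · rw [hDgt _ (by omega), T.t₁₃.arms'.adjA _ (by omega)]; omega
  have hAg : ∀ i ≤ e, ∀ k ≤ q + 1 + (p - e - 1 + 1 + c), G.Adj (W.A i) (cat W'.A q D k) ↔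
      i = e ∧ (k = q + 1 + (p - e - 1) ∨ k = q + 1 + (p - e - 1) + 1) := by
    intro i hi k hk
    simp only [cat]; split_ifs with h
    · refine ⟨fun h' => ?_, fun h' => by omega⟩
      have := C.only i (by omega) k h h'; omega
    · by_cases h' : k - (q + 1) ≤ p - e - 1
      · rw [hDle _ h', T.t₁₂.arms.pathA.adj_iff (by omega) (by omega)]; omega
      · rw [hDgt _ (by omega)]
        refine ⟨fun h'' => ?_, fun h'' => ?_⟩
        · have := C'.only i hi _ (by omega) h''; omega
        · rw [show c - (k - (q + 1) - (p - e)) = c by omega, h''.1]; exact C'.adj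
  have e0 : cat W'.A q D 0 = W'.A 0 := by simp [cat]
  have em : cat W'.A q D (q + 1 + (p - e - 1 + 1 + c)) = W''.A 0 := by
    simp only [cat]; rw [if_neg (by omega), hDgt _ (by omega)]; congr 1; omega
  have hfree : ∀ s ≤ W.β, ∀ k ≤ q + 1 + (p - e - 1 + 1 + c), ¬ G.Adj (W.B s) (cat W'.A q D k) := by
    intro s hs k hk hsk
    obtain ⟨s', hs', hedge, -⟩ := T.t₁₂.arms.first_contact hG hh e1 (by omega) (le_refl W.β)
      (e := q + 1 + (p - e - 1))
      (by
        intro i hi k hk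
        refine ⟨hval (fun v => W.A i ≠ v) ?_ ?_ ?_ k hk, fun h => ((hAg i hi k hk).1 h).1⟩
        · intro t ht h
          have := T.t₁₂.half.eqAA i (by omega) t (by omega) h; omega
        · intro j j1 j2 h
          have := T.t₁₂.arms.pathA.inj (by omega) (by omega) h; omega
        · intro t ht h
          have := T.t₁₃.half.eqAA i (by omega) t (by omega) h; omega)
      ⟨by omega, fun k hk => by rw [hAg e le_rfl k hk]; simp⟩
      (fun s hs => hval (fun v => W.B s ≠ v)
        (fun t ht => (T.t₁₂.half'.neAB t (by omega) s hs).symm)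
        (fun i _ hi => (T.t₁₂.arms.cross i (by omega) s hs).1.symm)
        fun t ht => (T.t₁₃.half'.neAB t (by omega) s hs).symm)
      (fun s hs => by
        rw [e0, em]
        exact ⟨fun h => T.t₁₂.half'.tAB s hs h.symm, fun h => T.t₁₃.half'.tAB s hs h.symm⟩)
      (fun s hs hz => hval (fun v => ¬ G.Adj (W.B s) v)
        (fun t ht => T.t₁₂.half.tBA s hs hz t (by omega))
        (fun i i1 i2 h => by
          have := (T.t₁₂.arms.cross i (by omega) s hs).2.1 h.symm; omega)
        fun t ht => T.t₁₃.half.tBA s hs hz t (by omega))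
      hs hk hsk
    have := hedge.facts.2.1
    simp only [cat] at this
    rw [if_neg (by omega), hDle _ (by omega)] at this
    have := (T.t₁₂.arms.cross _ (by omega) s' (by omega)).2.1 this.symm; omega
  refine ⟨fun s hs k hk h => ?_, C', ?_⟩
  · refine hfree s hs k (by omega) ?_
    simpa [cat, hk] using h
  -- Since `B` is free of the prefix of `W''`, the arm `B''` cannot also be free of the shortened
  -- prefix of `W`.
  · by_contra hcon
    push Not at hcon
    refine T.t₁₃.false_of_free hG C' (fun s hs k hk h => ?_) hcon
    refine hfree s hs (q + 1 + (p - e + (c - k))) (by omega) ?_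
    simp only [cat]
    rw [if_neg (by omega), hDgt _ (by omega),
      show c - (q + 1 + (p - e + (c - k)) - (q + 1) - (p - e)) = k by omega]
    exact h

/-- The third arm hits the prefix hole in an edge. The edge between the two arms would produce a
clean triple; an edge inside one arm is handled by `Clean.centre`. The recorded contact of `B''` is
what the descent feeds on. -/
theorem ThreeArms.contact_cases (hG : Good G) (T : ThreeArms G z x y W W' W'')
    (hz : Simple G z W) (hz' : Simple G z W') (hz'' : Simple G z W'') (C : Clean G W W' p q) :
    (∃ e c, e < p ∧ Clean G W W'' e c ∧ (∃ t ≤ W''.β, ∃ k ≤ e, G.Adj (W''.B t) (W.A k))) ∨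
    ((∀ t ≤ W'.β, ∀ k ≤ p, ¬ G.Adj (W'.B t) (W.A k)) ∧ ∃ e c, Clean G W' W'' e c ∧
      ∃ t ≤ W''.β, ∃ k ≤ e, G.Adj (W''.B t) (W'.A k)) := by
  obtain ⟨c, hc, ⟨e, he⟩, hbef⟩ := T.exists_contact hG C
  rcases he.cleanPath_cases with ⟨h1, h2, h3⟩ | ⟨h1, h2, h3⟩ | ⟨h1, f, h2, h3, h4⟩
  · obtain ⟨-, h4, h5⟩ := C.centre hG T hc h1 h2 h3 hbef
    exact .inl ⟨e, c, h1, h4, h5⟩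
  · exfalso
    refine CleanTriple.false (p := p) (q := q) (r := c) hG T hz hz' hz'' ⟨C, ?_, ?_⟩
    · refine ⟨C.p_lt, hc, ((h2 p le_rfl).2 rfl).symm, fun s hs t ht h => ?_⟩
      rcases Nat.eq_or_lt_of_le ht with rfl | ht
      · exact ⟨(h2 s hs).1 h.symm, rfl⟩
      · exact absurd h.symm ((hbef t ht).1 s hs)
    · refine ⟨C.q_lt, hc, ((h3 q le_rfl).2 rfl).symm, fun s hs t ht h => ?_⟩
      rcases Nat.eq_or_lt_of_le ht with rfl | ht
      · exact ⟨(h3 s hs).1 h.symm, rfl⟩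
      · exact absurd h.symm ((hbef t ht).2 s hs)
  · obtain ⟨h5, h6, h7⟩ := C.symm.centre hG T.swap₁₂ hc h2 h4 h3 fun s hs => (hbef s hs).symm
    exact .inr ⟨h5, f, c, h6, h7⟩

/-- Descent on `p`: the contact of `B'` contradicts the second case of `contact_cases`, and the
first case reproduces all hypotheses with `W'` and `W''` exchanged and `e < p`. -/
theorem ThreeArms.false_of_contact (hG : Good G) (p : ℕ) : ∀ {W W' W'' : ArmData V} {q : ℕ},
    ThreeArms G z x y W W' W'' → Simple G z W → Simple G z W' → Simple G z W'' →
    Clean G W W' p q → (∃ t ≤ W'.β, ∃ k ≤ p, G.Adj (W'.B t) (W.A k)) → False := by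
  induction p using Nat.strong_induction_on with
  | _ p ih =>
    intro W W' W'' q T hz hz' hz'' C hcon
    rcases T.contact_cases hG hz hz' hz'' C with ⟨e, c, h1, h2, h3⟩ | ⟨h1, -⟩
    · exact ih e h1 T.swap₂₃ hz hz'' hz' h2 h3
    · obtain ⟨t, ht, k, hk, h⟩ := hcon
      exact h1 t ht k hk h

/-- No pair of three independent pairs of arms is clean. -/
theorem ThreeArms.not_clean (hG : Good G) (T : ThreeArms G z x y W W' W'') (hz : Simple G z W)
    (hz' : Simple G z W') (hz'' : Simple G z W'') (C : Clean G W W' p q) : False := by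
  rcases T.contact_cases hG hz hz' hz'' C with ⟨e, c, h1, h2, h3⟩ | ⟨-, e, c, h2, h3⟩
  · exact ThreeArms.false_of_contact hG e T.swap₂₃ hz hz'' hz' h2 h3
  · exact ThreeArms.false_of_contact hG e T.swap₁₂.swap₂₃ hz' hz'' hz h2 h3

omit [Finite V] in
/-- Two arms have no edges between them apart from their common end, or contain a clean pair. -/
theorem TwoArms.exists_clean {s t : ℕ} (hs : s < W.α) (ht : t < W'.α)
    (h : G.Adj (W.A s) (W'.A t)) : ∃ p q, Clean G W W' p q := by
  obtain ⟨p, hp, ⟨t, ht, hpt⟩, hmin⟩ :=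
    exists_first (P := fun s => ∃ t < W'.α, G.Adj (W.A s) (W'.A t)) ⟨t, ht, h⟩
  obtain ⟨q, hq, hpq, hmin'⟩ := exists_first (P := fun t => G.Adj (W.A p) (W'.A t)) hpt
  refine ⟨p, q, by omega, by omega, hpq, fun s' h1 t' h2 e => ?_⟩
  have e1 : s' = p := by
    by_contra hne; exact hmin s' (by omega) ⟨t', by omega, e⟩
  refine ⟨e1, ?_⟩
  subst e1
  by_contra hne; exact hmin' t' (by omega) e

omit [Finite V] in
theorem Arms.link (H : Arms G z x y W.A W.α W.B W.β) {S : Set V} (hz : z ∈ S) (hx : x ∈ S)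
    (hS : ∀ s < W.α, W.A s ∈ S) : Link G S z x := by
  have := H.one_le
  refine (Link.of_adj ((H.adjA 0 (by omega)).2 rfl) hz (hS 0 (by omega))).trans ?_
  have := H.pathA.link_le (Nat.zero_le W.α) le_rfl (S := S) (by
    intro s _ hs
    rcases Nat.eq_or_lt_of_le hs with rfl | hs
    · rwa [H.endA]
    · exact hS s hs)
  rwa [H.endA] at this

omit [Finite V] in
theorem TwoArms.ac (T : TwoArms G z x y W W') (hC : ∀ p q, ¬ Clean G W W' p q) :
    AC G (seg W.A 0 W.α) (seg W'.A 0 W'.α) := by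
  rintro _ ⟨s, -, hs, rfl⟩ _ ⟨t, -, ht, rfl⟩
  refine ⟨fun e => ?_, fun e => ?_⟩
  · have := T.half.eqAA s hs.le t ht.le e; omega
  · obtain ⟨p, q, h⟩ := TwoArms.exists_clean hs ht e
    exact hC p q h

/-- Three independent pairs of arms do not exist if the neighbours of `z` in each form a single
edge. -/
theorem ThreeArms.false (hG : Good G) (T : ThreeArms G z x y W W' W'') (hz : Simple G z W)
    (hz' : Simple G z W') (hz'' : Simple G z W'') : False := by
  have hzx : z ≠ x := by rw [← T.t₁₂.arms.endA]; exact T.t₁₂.arms.neA _ le_rfl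
  have hzx' : ¬ G.Adj z x := by
    have := T.t₁₂.arms.one_le
    rw [← T.t₁₂.arms.endA, T.t₁₂.arms.adjA _ le_rfl]; omega
  refine hG.theta (hasTheta_of_link hzx hzx'
    (T.t₁₂.ac fun p q C => T.not_clean hG hz hz' hz'' C)
    (T.t₁₃.ac fun p q C => T.swap₂₃.not_clean hG hz hz'' hz' C)
    (T.t₂₃.ac fun p q C => T.swap₁₂.swap₂₃.not_clean hG hz' hz'' hz C)
    (T.t₁₂.arms.link (by simp) (by simp) fun s hs => .inr (.inr (mem_seg_of (by omega) hs)))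
    (T.t₁₂.arms'.link (by simp) (by simp) fun s hs => .inr (.inr (mem_seg_of (by omega) hs)))
    (T.t₁₃.arms'.link (by simp) (by simp) fun s hs => .inr (.inr (mem_seg_of (by omega) hs))))

end Kaleidoscope

/-! ### Ramsey's theorem, and stable sets of vertices attached to a hole. -/

namespace Kaleidoscope

variable {V : Type*} {G : SimpleGraph V}

section Ramsey

/-- Take the least element, keep a large class of the others on which the colour with it is
constant, and repeat; the colour of a pair then depends on its smaller element only. -/
theorem exists_endHomogeneous (K : Type*) [Finite K] (n : ℕ) : ∃ N : ℕ, ∀ (c : ℕ → ℕ → K)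
    (S : Finset ℕ), N ≤ S.card → ∃ (e : ℕ → ℕ) (k : ℕ → K), (∀ i < n, e i ∈ S) ∧
      ∀ i j, i < j → j < n → e i < e j ∧ c (e i) (e j) = k i := by
  classical
  have := Fintype.ofFinite K
  induction n with
  | zero =>
    rcases isEmpty_or_nonempty K with hK | ⟨⟨k⟩⟩
    · exact ⟨0, fun c => (hK.false (c 0 0)).elim⟩
    · exact ⟨0, fun c S _ => ⟨fun _ => 0, fun _ => k, by simp, by intro i j _ h; omega⟩⟩
  | succ n ih =>
    obtain ⟨N, hN⟩ := ih
    refine ⟨Fintype.card K * N + 2, fun c S hS => ?_⟩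
    have hne : S.Nonempty := Finset.card_pos.1 (by omega)
    set m := S.min' hne
    have hm : m ∈ S := S.min'_mem hne
    have hcard : (S.erase m).card = S.card - 1 := Finset.card_erase_of_mem hm
    obtain ⟨k, -, hk⟩ := Finset.exists_lt_card_fiber_of_mul_lt_card_of_maps_to
      (s := S.erase m) (t := Finset.univ) (f := fun j => c m j) (n := N) (by simp)
      (by rw [hcard, Finset.card_univ]; omega)
    obtain ⟨e, k', he, hek⟩ := hN c _ hk.le
    have he' : ∀ i < n, m < e i ∧ c m (e i) = k ∧ e i ∈ S := by
      intro i hi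
      have := he i hi
      simp only [Finset.mem_filter, Finset.mem_erase] at this
      exact ⟨lt_of_le_of_ne (S.min'_le _ this.1.2) (Ne.symm this.1.1), this.2, this.1.2⟩
    refine ⟨fun i => if i = 0 then m else e (i - 1), fun i => if i = 0 then k else k' (i - 1), ?_, ?_⟩
    · intro i hi
      simp only; split_ifs with h
      · exact hm
      · exact (he' _ (by omega)).2.2
    · intro i j hij hj
      simp only
      rw [if_neg (by omega : j ≠ 0)]
      split_ifs with h
      · exact ⟨(he' _ (by omega)).1, by rw [(he' _ (by omega)).2.1]⟩
      · exact hek _ _ (by omega) (by omega)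

/-- Ramsey's theorem for pairs and finitely many colours. -/
theorem exists_homogeneous (K : Type*) [Finite K] (n : ℕ) : ∃ N : ℕ, ∀ c : ℕ → ℕ → K,
    ∃ (e : ℕ → ℕ) (k : K), (∀ i < n, e i < N) ∧
      ∀ i j, i < j → j < n → e i < e j ∧ c (e i) (e j) = k := by
  classical
  have := Fintype.ofFinite K
  obtain ⟨N, hN⟩ := exists_endHomogeneous K (Fintype.card K * n + 1)
  refine ⟨N, fun c => ?_⟩
  obtain ⟨e, k, he, hek⟩ := hN c (Finset.range N) (by simp)
  obtain ⟨k₀, -, hk₀⟩ := Finset.exists_lt_card_fiber_of_mul_lt_card_of_maps_to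
    (s := Finset.range (Fintype.card K * n + 1)) (t := Finset.univ) (f := k) (n := n) (by simp)
    (by simp)
  set F := (Finset.range (Fintype.card K * n + 1)).filter fun i => k i = k₀ with hF
  have hmem : ∀ i (hi : i < n), F.orderEmbOfCardLe hk₀.le ⟨i, hi⟩ ∈ F := fun i hi =>
    Finset.orderEmbOfCardLe_mem F hk₀.le _
  have hmem' : ∀ i (hi : i < n), F.orderEmbOfCardLe hk₀.le ⟨i, hi⟩ < Fintype.card K * n + 1 ∧
      k (F.orderEmbOfCardLe hk₀.le ⟨i, hi⟩) = k₀ := by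
    intro i hi
    have := Finset.mem_filter.1 (hmem i hi)
    exact ⟨Finset.mem_range.1 this.1, this.2⟩
  refine ⟨fun i => if hi : i < n then e (F.orderEmbOfCardLe hk₀.le ⟨i, hi⟩) else 0, k₀, ?_, ?_⟩
  · intro i hi
    simp only [hi, dif_pos]
    exact Finset.mem_range.1 (he _ (hmem' i hi).1)
  · intro i j hij hj
    have hi : i < n := by omega
    simp only [hi, hj, dif_pos]
    have hlt : F.orderEmbOfCardLe hk₀.le ⟨i, hi⟩ < F.orderEmbOfCardLe hk₀.le ⟨j, hj⟩ :=
      (F.orderEmbOfCardLe hk₀.le).strictMono hij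
    have := hek _ _ hlt (hmem' j hj).1
    exact ⟨this.1, by rw [this.2]; exact (hmem' i hi).2⟩

end Ramsey

section

variable [Finite V]

theorem IndPath.deg_seg_split {f : ℕ → V} {m : ℕ} (hf : IndPath G f m) (c : V) {i j k : ℕ}
    (hij : i ≤ j) (hjk : j ≤ k) (hk : k ≤ m + 1) :
    deg G c (seg f i k) = deg G c (seg f i j) + deg G c (seg f j k) := by
  rw [seg_split f hij hjk, deg_union]
  rintro _ ⟨s, h1, h2, rfl⟩ ⟨t, h3, h4, e⟩
  have := hf.inj (by omega) (by omega) e; omega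

omit [Finite V] in
theorem deg_singleton {c v : V} (h : ¬ G.Adj c v) : deg G c {v} = 0 :=
  deg_eq_zero (by rintro _ rfl; exact h)

/-- The degree into a path is even if it is even on all sectors cut out by a set of vertices of the
path that are not neighbours. -/
theorem IndPath.even_deg_of_sectors {f : ℕ → V} {m : ℕ} (hf : IndPath G f m) {c : V} {A : ℕ → Prop}
    {k : ℕ} (hk : k ≤ m) (hAk : A k) (hA : ∀ i ≤ m, A i → ¬ G.Adj c (f i))
    (low : ∀ i ≤ m, A i → (∀ s < i, ¬ A s) → Even (deg G c (seg f 0 (i + 1))))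
    (high : ∀ i ≤ m, A i → (∀ s, i < s → s ≤ m → ¬ A s) → Even (deg G c (seg f i (m + 1))))
    (gap : ∀ i j, i + 2 ≤ j → j ≤ m → A i → A j → (∀ s, i < s → s < j → ¬ A s) →
      Even (deg G c (seg f i (j + 1)))) : Even (deg G c (seg f 0 (m + 1))) := by
  have key : ∀ n ≤ m, A n → Even (deg G c (seg f 0 (n + 1))) := by
    intro n
    induction n using Nat.strong_induction_on with
    | _ n ih =>
      intro hn hAn
      by_cases h : ∃ s < n, A s
      · obtain ⟨s, hs, hAs⟩ := h
        obtain ⟨a, h1, h2, h3, h4⟩ := exists_last (P := A) (k := s) (m := n - 1) (by omega) hAs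
        have e1 := ih a (by omega) (by omega) h3
        have e2 := hf.deg_seg_split c (Nat.zero_le a) (show a ≤ n + 1 by omega) (by omega)
        have e3 := hf.deg_seg_split c (Nat.zero_le a) (show a ≤ a + 1 by omega) (by omega)
        rw [seg_one, deg_singleton (hA a (by omega) h3)] at e3
        have e4 : Even (deg G c (seg f a (n + 1))) := by
          rcases Nat.lt_or_ge n (a + 2) with h | h
          · obtain rfl : n = a + 1 := by omega
            have := hf.deg_seg_split c (show a ≤ a + 1 by omega) (show a + 1 ≤ a + 1 + 1 by omega) (by omega)
            rw [seg_one, seg_one, deg_singleton (hA a (by omega) h3), deg_singleton (hA _ hn hAn)] at this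
            rw [this]; exact Even.zero
          · exact gap a n h hn h3 hAn fun s h5 h6 => h4 s h5 (by omega)
        rw [e2]
        rw [e3] at e1
        exact e1.add e4
      · push Not at h
        exact low n hn hAn h
  obtain ⟨a, h1, h2, h3, h4⟩ := exists_last (P := A) hk hAk
  have e1 := key a h2 h3
  have e2 := hf.deg_seg_split c (Nat.zero_le a) (show a ≤ m + 1 by omega) le_rfl
  have e3 := hf.deg_seg_split c (Nat.zero_le a) (show a ≤ a + 1 by omega) (by omega)
  rw [seg_one, deg_singleton (hA a (by omega) h3)] at e3
  rw [e2]
  rw [e3] at e1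
  exact e1.add (high a h2 h3 h4)

omit [Finite V] in
theorem AtEdge.deg_eq {c : V} {g : ℕ → V} {m i : ℕ} (hg : IndPath G g m) (h : AtEdge G c g m i) :
    deg G c (seg g 0 (m + 1)) = 2 := by
  have h1 := h.1
  have : nbrsIn G c (seg g 0 (m + 1)) = {g i, g (i + 1)} := by
    ext v
    simp only [nbrsIn, Set.mem_ofPred_eq, Set.mem_insert_iff, Set.mem_singleton_iff]
    constructor
    · rintro ⟨⟨s, -, hs, rfl⟩, hv⟩
      rcases (h.2 s (by omega)).1 hv with rfl | rfl <;> simp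
    · rintro (rfl | rfl)
      · exact ⟨mem_seg_of (by omega) (by omega), (h.2 i (by omega)).2 (.inl rfl)⟩
      · exact ⟨mem_seg_of (by omega) (by omega), (h.2 _ h1).2 (.inr rfl)⟩
  rw [deg, this, Set.ncard_pair]
  exact (hg i (i + 1) (by omega) h1).1

omit [Finite V] in
theorem HoleOn.even_deg_of_link (hG : Good G) {o : V} {g : ℕ → V} {m : ℕ} (h : HoleOn G o g m)
    {c : V} (hcg : ∀ i ≤ m, c ≠ g i) (hne : c ≠ o) (hco : ¬ G.Adj c o) (hc0 : ¬ G.Adj c (g 0))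
    (hcm : ¬ G.Adj c (g m)) {R : Set V} (hR : ∀ r ∈ R, ∀ i ≤ m, r ≠ g i ∧ ¬ G.Adj r (g i))
    (hl : Link G (insert o (insert c R)) o c) : Even (deg G c (seg g 0 (m + 1))) := by
  by_cases hcon : ∃ k ≤ m, G.Adj c (g k)
  · obtain ⟨k, hk, hck⟩ := hcon
    obtain ⟨i, hi⟩ := h.atEdge_of_link hG hcg hne hco hc0 hcm hR hl hk hck
    rw [hi.deg_eq h.path]; exact even_two
  · push Not at hcon
    rw [deg_eq_zero]
    · exact Even.zero
    · rintro _ ⟨s, -, hs, rfl⟩; exact hcon s (by omega)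

omit [Finite V] in
-- Any interior vertex can serve as base of the hole. The traversal `f (k - 1), …, f 0, o, f n, …, f
-- (k + 1)` has the two neighbours of `f k` at its ends.
theorem HoleOn.rotate {o : V} {f : ℕ → V} {n k : ℕ} (h : HoleOn G o f n) (hk : 0 < k) (hkn : k < n) :
    HoleOn G (f k) (fun s => if s < k then f (k - 1 - s) else if s = k then o else f (n + k + 1 - s))
      n := by
  refine ⟨?_, h.two_le, ?_, ?_⟩
  · intro i j hij hj
    simp only
    rcases lt_trichotomy i k with hi | hi | hi <;> rcases lt_trichotomy j k with hj' | hj' | hj'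
    · rw [if_pos hi, if_pos hj']
      have := h.path.pair (i := k - 1 - i) (j := k - 1 - j) (by omega) (by omega)
      rw [Ne, this.1, this.2]; omega
    · rw [if_pos hi, if_neg (by omega), if_pos hj', G.adj_comm, h.adj _ (by omega)]
      exact ⟨(h.ne _ (by omega)).symm, by omega⟩
    · rw [if_pos hi, if_neg (by omega), if_neg (by omega)]
      have := h.path.pair (i := k - 1 - i) (j := n + k + 1 - j) (by omega) (by omega)
      rw [Ne, this.1, this.2]; omega
    · omega
    · omega
    · rw [if_neg (by omega), if_pos hi, if_neg (by omega), if_neg (by omega), h.adj _ (by omega)]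
      exact ⟨h.ne _ (by omega), by omega⟩
    · omega
    · omega
    · rw [if_neg (by omega), if_neg (by omega), if_neg (by omega), if_neg (by omega)]
      have := h.path.pair (i := n + k + 1 - i) (j := n + k + 1 - j) (by omega) (by omega)
      rw [Ne, this.1, this.2]; omega
  · intro i hi
    split_ifs
    · exact fun e => by have := h.path.inj (by omega) (by omega) e; omega
    · exact (h.ne k (by omega)).symm
    · exact fun e => by have := h.path.inj (by omega) (by omega) e; omega
  · intro i hi
    split_ifs
    · rw [h.path.adj_iff (by omega) (by omega)]; omega
    · rw [G.adj_comm, h.adj _ (by omega)]; omega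
    · rw [h.path.adj_iff (by omega) (by omega)]; omega

/-- A vertex `w` that is adjacent to `z` and attaches to a path closing a hole with `u`, where `z`
is adjacent to `u` and to the last vertex of the path. -/
structure Attached (G : SimpleGraph V) (z u : V) (π : ℕ → V) (M : ℕ) (w : V) : Prop where
  adj : G.Adj z w
  not_adj : ¬ G.Adj w u
  not_adj_last : ¬ G.Adj w (π M)
  ne : w ≠ u
  ne_path : ∀ i ≤ M, w ≠ π i
  contact : ∃ i ≤ M, G.Adj w (π i)

/-- Suppose there is none. The neighbours of `w` cut the path into sectors, each closing to a hole
through `w`; the two outer ones also use `z`. On each of these `w'` has an even number of neighbours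
in the sector, because it is adjacent to `z`. So the total is even, `w'` attaches to an edge of the
given hole, and there is a prism with the triangles `z, u, π M` and `w', π b, π (b + 1)`. -/
theorem Attached.exists_common (hG : Good G) {z u : V} {π : ℕ → V} {M : ℕ} (h : HoleOn G u π M)
    (hzu : G.Adj z u) (hzπ : ∀ i ≤ M, z ≠ π i ∧ (G.Adj z (π i) ↔ i = M)) {w w' : V}
    (hw : Attached G z u π M w) (hw' : Attached G z u π M w') (hne : w ≠ w') (hww : ¬ G.Adj w w') :
    ∃ k < M, G.Adj w (π k) ∧ G.Adj w' (π k) := by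
  by_contra hcon
  push Not at hcon
  have hM := h.two_le
  have hlt : ∀ {v i}, Attached G z u π M v → i ≤ M → G.Adj v (π i) → i < M := by
    intro v i hv hi e
    rcases Nat.eq_or_lt_of_le hi with rfl | hi
    · exact absurd e hv.not_adj_last
    · exact hi
  obtain ⟨k, hk, hwk⟩ := hw.contact
  obtain ⟨k', hk', hwk'⟩ := hw'.contact
  have heven : Even (deg G w' (seg π 0 (M + 1))) := by
    refine h.path.even_deg_of_sectors (A := fun i => G.Adj w (π i)) hk hwk ?_ ?_ ?_ ?_
    · intro i hi e e'
      exact hcon i (hlt hw hi e) e e'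
    · intro a ha hwa hmin
      have ha' := hlt hw ha hwa
      have hp : IndPath G (cat (fun _ => u) 0 (cat π a fun _ => w)) (0 + 1 + (a + 1 + 0)) := by
        refine (IndPath.zero _).cat ((h.path.le ha).cat (IndPath.zero _) ?_) ?_
        · intro i hi j hj
          refine ⟨(hw.ne_path i (by omega)).symm, ?_⟩
          rw [G.adj_comm]
          constructor
          · intro e
            refine ⟨?_, by omega⟩
            by_contra hne'
            exact hmin i (by omega) e
          · rintro ⟨rfl, -⟩; exact hwa
        · intro i hi j hj
          simp only [cat]; split_ifs with h'
          · refine ⟨h.ne j (by omega), ?_⟩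
            rw [h.adj j (by omega)]; omega
          · refine ⟨hw.ne.symm, ?_⟩
            rw [G.adj_comm]
            exact ⟨fun e => absurd e hw.not_adj, by omega⟩
      have hval : ∀ Q : V → Prop, Q u → (∀ i ≤ a, Q (π i)) → Q w → ∀ i ≤ 0 + 1 + (a + 1 + 0),
          Q (cat (fun _ => u) 0 (cat π a fun _ => w) i) := by
        intro Q q1 q2 q3 i hi
        simp only [cat]; split_ifs
        · exact q1
        · exact q2 _ (by omega)
        · exact q3
      have e0 : cat (fun _ => u) 0 (cat π a fun _ => w) 0 = u := by simp [cat]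
      have e1 : cat (fun _ => u) 0 (cat π a fun _ => w) (0 + 1 + (a + 1 + 0)) = w := by
        simp only [cat]; rw [if_neg (by omega), if_neg (by omega)]
      have hh : HoleOn G z (cat (fun _ => u) 0 (cat π a fun _ => w)) (0 + 1 + (a + 1 + 0)) := by
        refine ⟨hp, by omega, hval (fun v => z ≠ v) hzu.ne (fun i hi => (hzπ i (by omega)).1)
          hw.adj.ne, fun i hi => ?_⟩
        simp only [cat]; split_ifs
        · exact ⟨fun _ => .inl (by omega), fun _ => hzu⟩
        · rw [(hzπ _ (by omega)).2]; omega
        · exact ⟨fun _ => .inr (by omega), fun _ => hw.adj⟩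
      have hd := hh.even_deg hG (c := w') (hval (fun v => w' ≠ v) hw'.ne
        (fun i hi => hw'.ne_path i (by omega)) hne.symm) hw'.adj.symm (by rw [e0]; exact hw'.not_adj)
        (by rw [e1]; exact fun e => hww e.symm)
      rw [show 0 + 1 + (a + 1 + 0) + 1 = 0 + 1 + (a + 1 + 1) by omega, seg_cat, seg_one, deg_union,
        deg_singleton hw'.not_adj, seg_cat, seg_one, deg_union, deg_singleton (fun e => hww e.symm)] at hd
      · simpa using hd
      · rintro _ ⟨i, -, hi, rfl⟩ e
        exact hw.ne_path i (by omega) e.symm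
      · rintro _ rfl ⟨j, -, hj, e⟩
        have := hval (fun v => w' ≠ v) hw'.ne (fun i hi => hw'.ne_path i (by omega)) hne.symm
        simp only [cat] at e
        split_ifs at e
        · exact h.ne j (by omega) e
        · exact hw.ne e.symm
    · intro a ha hwa hmax
      have ha' := hlt hw ha hwa
      have hp : IndPath G (cat (fun _ => w) 0 fun s => π (a + s)) (0 + 1 + (M - a)) := by
        refine (IndPath.zero _).cat (h.path.sub a (by omega)) ?_
        intro i hi j hj
        refine ⟨hw.ne_path _ (by omega), fun e => ⟨by omega, ?_⟩, ?_⟩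
        · by_contra hne'
          exact hmax (a + j) (by omega) (by omega) e
        · rintro ⟨-, rfl⟩; exact hwa
      have hval : ∀ Q : V → Prop, Q w → (∀ i ≤ M, Q (π i)) → ∀ i ≤ 0 + 1 + (M - a),
          Q (cat (fun _ => w) 0 (fun s => π (a + s)) i) := by
        intro Q q1 q2 i hi
        simp only [cat]; split_ifs
        · exact q1
        · exact q2 _ (by omega)
      have e0 : cat (fun _ => w) 0 (fun s => π (a + s)) 0 = w := by simp [cat]
      have e1 : cat (fun _ => w) 0 (fun s => π (a + s)) (0 + 1 + (M - a)) = π M := by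
        simp only [cat]; rw [if_neg (by omega)]; congr 1; omega
      have hh : HoleOn G z (cat (fun _ => w) 0 fun s => π (a + s)) (0 + 1 + (M - a)) := by
        refine ⟨hp, by omega, hval (fun v => z ≠ v) hw.adj.ne fun i hi => (hzπ i hi).1,
          fun i hi => ?_⟩
        simp only [cat]; split_ifs
        · exact ⟨fun _ => .inl (by omega), fun _ => hw.adj⟩
        · rw [(hzπ _ (by omega)).2]; omega
      have hd := hh.even_deg hG (c := w') (hval (fun v => w' ≠ v) hne.symm hw'.ne_path)
        hw'.adj.symm (by rw [e0]; exact fun e => hww e.symm) (by rw [e1]; exact hw'.not_adj_last)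
      rw [show 0 + 1 + (M - a) + 1 = 0 + 1 + (M - a + 1) by omega, seg_cat, seg_one, deg_union,
        deg_singleton (fun e => hww e.symm), seg_shift] at hd
      · rw [show a + (M - a + 1) = M + 1 by omega] at hd
        simpa using hd
      · rintro _ rfl ⟨j, -, hj, e⟩
        exact hw.ne_path _ (by omega) e
    · intro a b hab hb hwa hwb hgap
      have hb' := hlt hw hb hwb
      have hh : HoleOn G w (fun s => π (a + s)) (b - a) := by
        refine ⟨h.path.sub a (by omega), by omega, fun i hi => hw.ne_path _ (by omega),
          fun i hi => ⟨fun e => ?_, ?_⟩⟩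
        · by_contra hne'
          exact hgap (a + i) (by omega) (by omega) e
        · rintro (rfl | rfl)
          · exact hwa
          · rw [show a + (b - a) = b by omega]; exact hwb
      have hd := hh.even_deg_of_link hG (c := w') (R := {z}) (fun i hi => hw'.ne_path _ (by omega))
        hne.symm (fun e => hww e.symm) (hcon a (by omega) hwa)
        (by rw [show a + (b - a) = b by omega]; exact hcon b (by omega) hwb)
        (by
          rintro _ rfl i hi
          refine ⟨(hzπ _ (by omega)).1, ?_⟩
          rw [(hzπ _ (by omega)).2]; omega)
        ((Link.of_adj hw.adj.symm (by simp) (by simp)).trans (Link.of_adj hw'.adj (by simp) (by simp)))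
      rwa [seg_shift, show a + (b - a + 1) = b + 1 by omega] at hd
  obtain ⟨b, hb⟩ := h.exists_atEdge hG hw'.ne hw'.ne_path hw'.not_adj heven hk' hwk'
  obtain ⟨b1, b2, b3, b4⟩ := hb.facts
  have b5 := hlt hw' b1 b3
  refine hG.prism (hasPrism_of_link (a₁ := z) (a₂ := u) (a₃ := π M) (b₁ := w') (b₂ := π b)
    (b₃ := π (b + 1)) (S₁ := {z, w'}) (S₂ := insert u (seg π 0 (b + 1))) (S₃ := seg π (b + 1) (M + 1))
    hzu ((hzπ M le_rfl).2.2 rfl) ((h.adj M le_rfl).2 (.inr rfl)) b2 b3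
    ((h.path b (b + 1) (by omega) (by omega)).2.2 rfl) (by simp) (by simp)
    (mem_seg_of (by omega) (by omega)) (by simp) (.inr (mem_seg_of (by omega) (by omega)))
    (mem_seg_of (by omega) (by omega)) hw'.adj.ne (h.ne b (by omega))
    (fun e => by have := h.path.inj le_rfl (by omega) e; omega) ?_ ?_ ?_
    (Link.of_adj hw'.adj (by simp) (by simp)) ?_ ?_)
  · rintro _ (rfl | rfl) _ (rfl | ⟨i, -, hi, rfl⟩)
    · exact ⟨hzu.ne, fun _ => .inl ⟨rfl, rfl⟩⟩
    · refine ⟨(hzπ i (by omega)).1, fun e => ?_⟩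
      have := (hzπ i (by omega)).2.1 e; omega
    · exact ⟨hw'.ne, fun e => absurd e hw'.not_adj⟩
    · refine ⟨hw'.ne_path i (by omega), fun e => .inr ⟨rfl, ?_⟩⟩
      have := (hb.2 i (by omega)).1 e
      congr 1; omega
  · rintro _ (rfl | rfl) _ ⟨i, i1, hi, rfl⟩
    · refine ⟨(hzπ i (by omega)).1, fun e => .inl ⟨rfl, ?_⟩⟩
      rw [(hzπ i (by omega)).2.1 e]
    · refine ⟨hw'.ne_path i (by omega), fun e => .inr ⟨rfl, ?_⟩⟩
      have := (hb.2 i (by omega)).1 e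
      congr 1; omega
  · rintro _ (rfl | ⟨i, -, hi, rfl⟩) _ ⟨j, j1, hj, rfl⟩
    · refine ⟨h.ne j (by omega), fun e => .inl ⟨rfl, ?_⟩⟩
      have := (h.adj j (by omega)).1 e
      congr 1; omega
    · have := h.path.pair (i := i) (j := j) (by omega) (by omega)
      refine ⟨fun e => by have := this.1.1 e; omega, fun e => .inr ⟨?_, ?_⟩⟩
      · have := this.2.1 e; congr 1; omega
      · have := this.2.1 e; congr 1; omega
  · exact h.link_left (by omega) (by simp) fun s hs => .inr (mem_seg_of (by omega) (by omega))
  · exact h.path.link_ge (by omega) le_rfl fun s s1 s2 => mem_seg_of s1 (by omega)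

/-- A stable set of attached vertices has bounded size. -/
theorem exists_bound_attached : ∃ N : ℕ, ∀ {V : Type*} [Finite V] {G : SimpleGraph V} {z u : V}
    {π : ℕ → V} {M : ℕ} (w : ℕ → V), Good G → HoleOn G u π M → G.Adj z u →
    (∀ i ≤ M, z ≠ π i ∧ (G.Adj z (π i) ↔ i = M)) → (∀ i < N, Attached G z u π M (w i)) →
    (∀ i j, i < j → j < N → w i ≠ w j ∧ ¬ G.Adj (w i) (w j)) → False := by
  obtain ⟨N, hN⟩ := exists_homogeneous Prop 4
  refine ⟨N, ?_⟩
  intro V _ G z u π M w hG h hzu hzπ hw hww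
  have hcom : ∀ i j, ∃ k, i < j → j < N → k < M ∧ G.Adj (w i) (π k) ∧ G.Adj (w j) (π k) := by
    intro i j
    by_cases hij : i < j ∧ j < N
    · obtain ⟨k, hk⟩ := (hw i (by omega)).exists_common hG h hzu hzπ (hw j (by omega))
        (hww i j hij.1 hij.2).1 (hww i j hij.1 hij.2).2
      exact ⟨k, fun _ _ => hk⟩
    · exact ⟨0, fun h1 h2 => absurd ⟨h1, h2⟩ hij⟩
  choose κ hκ using hcom
  have hM := h.two_le
  -- Three of the stable vertices with a common neighbour `π k` form a theta with ends `z` and `π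
  -- k`; hence common neighbours of different pairs differ.
  have htwo : ∀ k < M, ∀ i < N, ∀ j < N, ∀ l < N, i ≠ j → i ≠ l → j ≠ l → G.Adj (w i) (π k) →
      G.Adj (w j) (π k) → G.Adj (w l) (π k) → False := by
    intro k hk i hi j hj l hl hij hil hjl a b c
    have ac : ∀ i < N, ∀ j < N, i ≠ j → AC G {w i} {w j} := by
      rintro i hi j hj hij _ rfl _ rfl
      rcases Nat.lt_or_ge i j with h' | h'
      · exact hww i j h' hj
      · have := hww j i (by omega) hi
        exact ⟨this.1.symm, fun e => this.2 e.symm⟩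
    have li : ∀ i < N, G.Adj (w i) (π k) → Link G (insert z (insert (π k) {w i})) z (π k) :=
      fun i hi a => (Link.of_adj (hw i hi).adj (by simp) (by simp)).trans
        (Link.of_adj a (by simp) (by simp))
    refine hG.theta (hasTheta_of_link (hzπ k hk.le).1 ?_ (ac i hi j hj hij) (ac i hi l hl hil)
      (ac j hj l hl hjl) (li i hi a) (li j hj b) (li l hl c))
    rw [(hzπ k hk.le).2]; omega
  -- Pairs are coloured by the parity of `κ`: distinct positions of equal parity are not
  -- consecutive, so the common neighbours are pairwise non-adjacent.
  obtain ⟨e, P, he, heP⟩ := hN fun i j => κ i j % 2 = 0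
  have hcol : ∀ i j i' j', i < j → j < 4 → i' < j' → j' < 4 →
      κ (e i) (e j) % 2 = κ (e i') (e j') % 2 := by
    intro i j i' j' h1 h2 h3 h4
    have a := (heP i j h1 h2).2
    have b := (heP i' j' h3 h4).2
    have : (κ (e i) (e j) % 2 = 0) = (κ (e i') (e j') % 2 = 0) := a.trans b.symm
    rcases Nat.mod_two_eq_zero_or_one (κ (e i) (e j)) with h5 | h5 <;>
    rcases Nat.mod_two_eq_zero_or_one (κ (e i') (e j')) with h6 | h6 <;> simp [h5, h6] at this ⊢
  have hinj : ∀ i < 4, ∀ j < 4, e i = e j → i = j := by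
    intro i hi j hj h'
    rcases lt_trichotomy i j with h'' | h'' | h''
    · have := (heP i j h'' hj).1; omega
    · exact h''
    · have := (heP j i h'' hi).1; omega
  let a : ℕ → V := fun i => w (e i)
  have haa : ∀ i < 4, ∀ j < 4, i ≠ j → a i ≠ a j ∧ ¬ G.Adj (a i) (a j) := by
    intro i hi j hj hij
    rcases Nat.lt_or_ge i j with h' | h'
    · exact hww _ _ (heP i j h' hj).1 (he j hj)
    · have := hww _ _ (heP j i (by omega) hi).1 (he i hi)
      exact ⟨this.1.symm, fun e => this.2 e.symm⟩
  have hκ' : ∀ i j, i < j → j < 4 → κ (e i) (e j) < M ∧ G.Adj (a i) (π (κ (e i) (e j))) ∧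
      G.Adj (a j) (π (κ (e i) (e j))) := fun i j hij hj =>
    hκ _ _ (heP i j hij hj).1 (he j hj)
  have hadj : ∀ i j, i < j → j < 4 → ∀ l < 4, G.Adj (a l) (π (κ (e i) (e j))) → l = i ∨ l = j := by
    intro i j hij hj l hl hal
    by_contra hne
    push Not at hne
    obtain ⟨h1, h2, h3⟩ := hκ' i j hij hj
    refine htwo _ h1 (e i) (he i (by omega)) (e j) (he j hj) (e l) (he l hl) ?_ ?_ ?_ h2 h3 hal
    · exact fun h' => by have := hinj i (by omega) j hj h'; omega
    · exact fun h' => hne.1 (hinj i (by omega) l hl h').symm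
    · exact fun h' => hne.2 (hinj j hj l hl h').symm
  have hκne : ∀ i j i' j', i < j → j < 4 → i' < j' → j' < 4 → (i, j) ≠ (i', j') →
      κ (e i) (e j) ≠ κ (e i') (e j') := by
    intro i j i' j' h1 h2 h3 h4 hne h5
    obtain ⟨c1, c2, c3⟩ := hκ' i' j' h3 h4
    rw [← h5] at c2 c3
    have d1 := hadj i j h1 h2 i' (by omega) c2
    have d2 := hadj i j h1 h2 j' h4 c3
    apply hne
    have : i = i' ∧ j = j' := by omega
    rw [this.1, this.2]
  have hπ : ∀ i j i' j', i < j → j < 4 → i' < j' → j' < 4 → (i, j) ≠ (i', j') →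
      π (κ (e i) (e j)) ≠ π (κ (e i') (e j')) ∧
      ¬ G.Adj (π (κ (e i) (e j))) (π (κ (e i') (e j'))) := by
    intro i j i' j' h1 h2 h3 h4 hne
    have n1 := hκne i j i' j' h1 h2 h3 h4 hne
    have n2 := hcol i j i' j' h1 h2 h3 h4
    have n3 := (hκ' i j h1 h2).1
    have n4 := (hκ' i' j' h3 h4).1
    have := h.path.pair (i := κ (e i) (e j)) (j := κ (e i') (e j')) n3.le n4.le
    rw [Ne, this.1, this.2]; omega
  have haπ : ∀ l < 4, ∀ i j, i < j → j < 4 → a l ≠ π (κ (e i) (e j)) := fun l hl i j hij hj =>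
    (hw _ (he l hl)).ne_path _ (hκ' i j hij hj).1.le
  have hzκ : ∀ i j, i < j → j < 4 → z ≠ π (κ (e i) (e j)) ∧ ¬ G.Adj z (π (κ (e i) (e j))) := by
    intro i j hij hj
    have := (hκ' i j hij hj).1
    refine ⟨(hzπ _ this.le).1, ?_⟩
    rw [(hzπ _ this.le).2]; omega
  -- The path `a 0, a 1, a 2, a 3` with a common neighbour inserted between consecutive terms. The
  -- common neighbour of `a 0` and `a 3` closes it to a hole on which `z` has exactly these four
  -- neighbours.
  let g : ℕ → V := fun i => if i % 2 = 0 then a (i / 2) else π (κ (e (i / 2)) (e (i / 2 + 1)))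
  have hg0 : ∀ i, g (2 * i) = a i := fun i => by
    simp only [g]; rw [if_pos (by omega)]; congr 1; omega
  have hg1 : ∀ i, g (2 * i + 1) = π (κ (e i) (e (i + 1))) := fun i => by
    simp only [g]; rw [if_neg (by omega), show (2 * i + 1) / 2 = i by omega]
  have hpar : ∀ i ≤ 6, (∃ j < 4, i = 2 * j) ∨ ∃ j < 3, i = 2 * j + 1 := by
    intro i hi
    rcases Nat.mod_two_eq_zero_or_one i with h' | h'
    · exact .inl ⟨i / 2, by omega, by omega⟩
    · exact .inr ⟨i / 2, by omega, by omega⟩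
  have haκ : ∀ l < 4, ∀ j < 3, G.Adj (a l) (π (κ (e j) (e (j + 1)))) ↔ l = j ∨ l = j + 1 := by
    intro l hl j hj
    refine ⟨hadj j (j + 1) (by omega) (by omega) l hl, ?_⟩
    rintro (rfl | rfl)
    · exact (hκ' l (l + 1) (by omega) (by omega)).2.1
    · exact (hκ' j (j + 1) (by omega) (by omega)).2.2
  have hg : IndPath G g 6 := by
    intro i j hij hj
    rcases hpar i (by omega) with ⟨i, hi', rfl⟩ | ⟨i, hi', rfl⟩ <;>
    rcases hpar j hj with ⟨j, hj', rfl⟩ | ⟨j, hj', rfl⟩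
    · rw [hg0, hg0]
      have := haa i hi' j hj' (by omega)
      exact ⟨this.1, fun e => absurd e this.2, by omega⟩
    · rw [hg0, hg1]
      refine ⟨haπ i hi' j (j + 1) (by omega) (by omega), ?_⟩
      rw [haκ i hi' j hj']; omega
    · rw [hg1, hg0, G.adj_comm]
      refine ⟨(haπ j hj' i (i + 1) (by omega) (by omega)).symm, ?_⟩
      rw [haκ j hj' i hi']; omega
    · rw [hg1, hg1]
      have := hπ i (i + 1) j (j + 1) (by omega) (by omega) (by omega) (by omega)
        (fun e => by have := (Prod.mk.inj e).1; omega)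
      exact ⟨this.1, fun e => absurd e this.2, by omega⟩
  have hdeg : deg G z (seg g 0 (6 + 1)) = 4 := by
    refine deg_eq_four (s := a 0) (t := a 1) (u := a 2) (v := a 3) ?_ ?_ ?_ ?_
      (haa 0 (by omega) 1 (by omega) (by omega)).1 (haa 0 (by omega) 2 (by omega) (by omega)).1
      (haa 0 (by omega) 3 (by omega) (by omega)).1 (haa 1 (by omega) 2 (by omega) (by omega)).1
      (haa 1 (by omega) 3 (by omega) (by omega)).1 (haa 2 (by omega) 3 (by omega) (by omega)).1 ?_
    · rw [← hg0]; exact mem_seg_of (by omega) (by omega)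
    · rw [← hg0]; exact mem_seg_of (by omega) (by omega)
    · rw [← hg0]; exact mem_seg_of (by omega) (by omega)
    · rw [← hg0]; exact mem_seg_of (by omega) (by omega)
    · rintro _ ⟨i, -, hi, rfl⟩
      rcases hpar i (by omega) with ⟨i, hi', rfl⟩ | ⟨i, hi', rfl⟩
      · rw [hg0]
        refine ⟨fun _ => ?_, fun _ => (hw _ (he i hi')).adj⟩
        have : i = 0 ∨ i = 1 ∨ i = 2 ∨ i = 3 := by omega
        rcases this with rfl | rfl | rfl | rfl <;> simp
      · rw [hg1]
        have hn := haπ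
        refine ⟨fun e => absurd e (hzκ i (i + 1) (by omega) (by omega)).2, ?_⟩
        rintro (e | e | e | e)
        · exact absurd e.symm (hn 0 (by omega) i (i + 1) (by omega) (by omega))
        · exact absurd e.symm (hn 1 (by omega) i (i + 1) (by omega) (by omega))
        · exact absurd e.symm (hn 2 (by omega) i (i + 1) (by omega) (by omega))
        · exact absurd e.symm (hn 3 (by omega) i (i + 1) (by omega) (by omega))
  have g0 : g 0 = a 0 := hg0 0
  have g6 : g 6 = a 3 := hg0 3
  refine hG.wheel (hg.hasEvenWheel (by omega) (z := z) ?_ (by omega) (by rw [hdeg]; decide)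
    (S := {π (κ (e 0) (e 3))}) ?_ ?_ ?_)
  · intro i hi
    rcases hpar i hi with ⟨i, hi', rfl⟩ | ⟨i, hi', rfl⟩
    · rw [hg0]; exact (hw _ (he i hi')).adj.ne
    · rw [hg1]; exact (hzκ i (i + 1) (by omega) (by omega)).1
  · rintro _ rfl; exact hzκ 0 3 (by omega) (by omega)
  · rintro _ rfl i h1 h2
    rcases hpar i (by omega) with ⟨i, hi', rfl⟩ | ⟨i, hi', rfl⟩
    · rw [hg0]
      refine ⟨(haπ i hi' 0 3 (by omega) (by omega)).symm, fun e => ?_⟩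
      have := hadj 0 3 (by omega) (by omega) i hi' e.symm; omega
    · rw [hg1]
      exact hπ 0 3 i (i + 1) (by omega) (by omega) (by omega) (by omega)
        (fun e => by have := Prod.mk.inj e; omega)
  · rw [g0, g6]
    obtain ⟨-, h1, h2⟩ := hκ' 0 3 (by omega) (by omega)
    exact (Link.of_adj h1 (by simp) (by simp)).trans (Link.of_adj h2.symm (by simp) (by simp))

end

end Kaleidoscope

/-! ### Families of paths, and the case where `z` attaches to an edge of each. -/

namespace Kaleidoscope

variable {V : Type*} {G : SimpleGraph V}

/-- Past the cardinality the enumeration repeats a fixed element, so all its values lie in `S`. -/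
theorem exists_enum {S : Set V} (hfin : S.Finite) (hne : S.Nonempty) {s : ℕ} (hs : S.ncard ≤ s) :
    ∃ p : ℕ → V, (∀ r, p r ∈ S) ∧ ∀ v ∈ S, ∃ r < s, p r = v := by
  classical
  obtain ⟨v₀, hv₀⟩ := hne
  have hf := hfin.fintype
  have hc : Fintype.card S = S.ncard := by rw [← Nat.card_coe_set_eq, Nat.card_eq_fintype_card]
  let e := Fintype.equivFin S
  refine ⟨fun r => if h : r < Fintype.card S then (e.symm ⟨r, h⟩ : V) else v₀, fun r => ?_,
    fun v hv => ⟨e ⟨v, hv⟩, by have := (e ⟨v, hv⟩).2; omega, ?_⟩⟩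
  · dsimp only; split_ifs
    · exact (e.symm _).2
    · exact hv₀
  · dsimp only; rw [dif_pos (e ⟨v, hv⟩).2]; simp

/-- Among many small pairwise disjoint sets of vertices, many are pairwise anticomplete. -/
theorem exists_anticomplete (t s n : ℕ) : ∃ N : ℕ, ∀ {V : Type*} [Finite V] {G : SimpleGraph V}
    (A : ℕ → Set V), Good G → G.CliqueFree t → (∀ i < N, (A i).Nonempty ∧ (A i).ncard ≤ s) →
    (∀ i < N, ∀ j < N, i ≠ j → Disjoint (A i) (A j)) →
    ∃ e : ℕ → ℕ, (∀ i < n, e i < N) ∧ ∀ i j, i < j → j < n → e i < e j ∧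
      ∀ v ∈ A (e i), ∀ w ∈ A (e j), ¬ G.Adj v w := by
  -- The colour of two sets is the adjacency pattern between their enumerations. The length leaves
  -- room for the `n` sets wanted, for a clique on `t` vertices and for five sets carrying a theta.
  obtain ⟨N, hN⟩ := exists_homogeneous (Fin s → Fin s → Prop) (n + t + 5)
  refine ⟨N, ?_⟩
  intro V _ G A hG ht hA hdis
  have hp : ∀ i, ∃ p : ℕ → V, i < N → (∀ r, p r ∈ A i) ∧ ∀ v ∈ A i, ∃ r < s, p r = v := by
    intro i
    by_cases hi : i < N
    · obtain ⟨p, hp⟩ := exists_enum (Set.toFinite _) (hA i hi).1 (hA i hi).2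
      exact ⟨p, fun _ => hp⟩
    · by_cases hV : Nonempty V
      · exact ⟨fun _ => hV.some, fun h => absurd h hi⟩
      · rcases Nat.eq_zero_or_pos N with h0 | h0
        · have := hN (fun _ _ _ _ => True)
          obtain ⟨e, -, he, -⟩ := this
          have := he 0 (by omega); omega
        · exact absurd ⟨(hA 0 h0).1.some⟩ hV
  choose p hp using hp
  obtain ⟨e, k, he, hek⟩ := hN fun i j r r' => G.Adj (p i r) (p j r')
  have hadj : ∀ i j, i < j → j < n + t + 5 → ∀ r r' : Fin s,
      (G.Adj (p (e i) r) (p (e j) r') ↔ k r r') := by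
    intro i j hij hj r r'
    have := congrFun (congrFun (hek i j hij hj).2 r) r'
    exact this ▸ Iff.rfl
  have hne : ∀ i < n + t + 5, ∀ j < n + t + 5, i ≠ j → ∀ r r', p (e i) r ≠ p (e j) r' := by
    intro i hi j hj hij r r' h
    have hee : e i ≠ e j := by
      rcases Nat.lt_or_ge i j with h' | h'
      · exact (hek i j h' hj).1.ne
      · exact (hek j i (by omega) hi).1.ne'
    exact Set.disjoint_left.1 (hdis _ (he i hi) _ (he j hj) hee) ((hp _ (he i hi)).1 r)
      (h ▸ (hp _ (he j hj)).1 r')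
  -- A position adjacent to itself throughout would give a clique on `t` vertices.
  have hdiag : ∀ r, ¬ k r r := by
    intro r hr
    have hadj' : ∀ i j : Fin t, i ≠ j → G.Adj (p (e i) r) (p (e j) r) := by
      intro i j hij
      have : (i : ℕ) ≠ j := fun h => hij (Fin.ext h)
      rcases Nat.lt_or_ge i j with h | h
      · exact (hadj i j h (by omega) r r).2 hr
      · exact ((hadj j i (by omega) (by omega) r r).2 hr).symm
    refine SimpleGraph.not_cliqueFree_iff_top_isContained t |>.2
      ⟨⟨⟨fun i => p (e i) r, fun h => hadj' _ _ h.ne⟩, fun i j h => ?_⟩⟩ ht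
    by_contra hij
    exact (hadj' i j hij).ne h
  -- Position `r` in the sets `0`, `1` and position `r'` in the sets `2`, `3`, `4` would induce a
  -- complete bipartite graph with parts of sizes two and three, which is a theta.
  have hoff : ∀ r r', ¬ k r r' := by
    intro r r' hk
    have ac : ∀ i j, i < j → j < 5 → AC G {p (e i) r'} {p (e j) r'} := by
      rintro i j hij hj _ rfl _ rfl
      exact ⟨hne i (by omega) j (by omega) (by omega) _ _, fun h =>
        hdiag r' ((hadj i j hij (by omega) _ _).1 h)⟩
    have li : ∀ i, 2 ≤ i → i < 5 →
        Link G (insert (p (e 0) r) (insert (p (e 1) r) {p (e i) r'})) (p (e 0) r) (p (e 1) r) := by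
      intro i h1 h2
      exact (Link.of_adj ((hadj 0 i (by omega) (by omega) _ _).2 hk) (by simp) (by simp)).trans
        (Link.of_adj ((hadj 1 i (by omega) (by omega) _ _).2 hk).symm (by simp) (by simp))
    exact hG.theta (hasTheta_of_link (hne 0 (by omega) 1 (by omega) (by omega) _ _)
      (fun h => hdiag r ((hadj 0 1 (by omega) (by omega) _ _).1 h))
      (ac 2 3 (by omega) (by omega)) (ac 2 4 (by omega) (by omega)) (ac 3 4 (by omega) (by omega))
      (li 2 (by omega) (by omega)) (li 3 (by omega) (by omega)) (li 4 (by omega) (by omega)))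
  refine ⟨e, fun i hi => he i (by omega), fun i j hij hj => ⟨(hek i j hij (by omega)).1, ?_⟩⟩
  intro v hv w hw h
  obtain ⟨r, hr, rfl⟩ := (hp _ (he i (by omega))).2 v hv
  obtain ⟨r', hr', rfl⟩ := (hp _ (he j (by omega))).2 w hw
  exact hoff ⟨r, hr⟩ ⟨r', hr'⟩ ((hadj i j hij (by omega) ⟨r, hr⟩ ⟨r', hr'⟩).1 h)

/-- A family of `N` holes through `a`, whose paths share the ends `x`, `y` only. -/
structure Family (G : SimpleGraph V) (a x y : V) (f : ℕ → ℕ → V) (n : ℕ → ℕ) (N : ℕ) : Prop where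
  hole : ∀ i < N, HoleOn G a (f i) (n i)
  start : ∀ i < N, f i 0 = x
  finish : ∀ i < N, f i (n i) = y
  eq : ∀ i < N, ∀ j < N, i ≠ j → ∀ s ≤ n i, ∀ t ≤ n j, f i s = f j t →
    (s = 0 ∧ t = 0) ∨ (s = n i ∧ t = n j)

theorem Family.reindex {a x y : V} {f : ℕ → ℕ → V} {n : ℕ → ℕ} {N M : ℕ} (F : Family G a x y f n N)
    {e : ℕ → ℕ} (he : ∀ i < M, e i < N) (hlt : ∀ i j, i < j → j < M → e i < e j) :
    Family G a x y (fun i => f (e i)) (fun i => n (e i)) M := by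
  refine ⟨fun i hi => F.hole _ (he i hi), fun i hi => F.start _ (he i hi),
    fun i hi => F.finish _ (he i hi), fun i hi j hj hij => F.eq _ (he i hi) _ (he j hj) ?_⟩
  rcases Nat.lt_or_ge i j with h | h
  · exact (hlt i j h hj).ne
  · exact (hlt j i (by omega) hi).ne'

/-- The two arms obtained from a path by deleting the edge from position `k` to `k + 1`. -/
def armData (f : ℕ → V) (n k : ℕ) : ArmData V :=
  ⟨fun s => f (k - s), k, fun s => f (k + 1 + s), n - k - 1⟩

theorem Arms.of_path {z : V} {f : ℕ → V} {n k : ℕ} (hf : IndPath G f n) (hne : ∀ s ≤ n, z ≠ f s)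
    (hk : 1 ≤ k) (hkn : k + 1 ≤ n) (h₀ : G.Adj z (f k)) (h₁ : G.Adj z (f (k + 1)))
    (hlt : ∀ s < k, ¬ G.Adj z (f s)) (hn : ¬ G.Adj z (f n))
    (hodd : ∀ t, k + 1 ≤ t → t ≤ n → ¬ G.Adj z (f t) → Odd (deg G z (seg f (k + 1) (t + 1)))) :
    Arms G z (f 0) (f n) (armData f n k).A (armData f n k).α (armData f n k).B (armData f n k).β := by
  simp only [armData]
  refine ⟨hf.rev (by omega), hf.sub (k + 1) (by omega), by simp, by congr 1; omega, ?_,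
    fun s hs => hne _ (by omega), fun s hs => hne _ (by omega), ?_, by simpa using h₁,
    by rwa [show k + 1 + (n - k - 1) = n by omega], hk, ?_⟩
  · intro s hs t ht
    have := hf.pair (i := k - s) (j := k + 1 + t) (by omega) (by omega)
    rw [Ne, this.1, this.2]; omega
  · intro s hs
    refine ⟨fun h => ?_, ?_⟩
    · by_contra h'
      exact hlt (k - s) (by omega) h
    · rintro rfl; simpa using h₀
  · intro t ht h
    rw [seg_shift]
    exact hodd (k + 1 + t) (by omega) (by omega) h

theorem Half.of_path {z : V} {f g : ℕ → V} {n m k l : ℕ} (hk : k + 1 < n) (hl : l + 1 < m)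
    (heq : ∀ s ≤ n, ∀ t ≤ m, f s = g t → (s = 0 ∧ t = 0) ∨ (s = n ∧ t = m)) (h₀ : G.Adj z (f k))
    (htouch : ∀ s ≤ n, G.Adj z (f s) → ∀ t ≤ m, ¬ G.Adj (f s) (g t)) :
    Half G z (armData f n k) (armData g m l) := by
  simp only [armData]
  constructor
  · intro s hs t ht e
    have := heq _ (by dsimp only at *; omega) _ (by dsimp only at *; omega) e
    dsimp only at *; omega
  · intro s hs t ht e
    have := heq _ (by dsimp only at *; omega) _ (by dsimp only at *; omega) e
    dsimp only at *; omega
  · intro s hs t ht e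
    have := heq _ (by dsimp only at *; omega) _ (by dsimp only at *; omega) e
    dsimp only at *; omega
  · intro t ht
    exact htouch _ (by omega) (by simpa using h₀) _ (by dsimp only at *; omega)
  · intro t ht
    exact htouch _ (by omega) (by simpa using h₀) _ (by dsimp only at *; omega)
  · intro s hs e t ht
    exact htouch _ (by dsimp only at *; omega) e _ (by dsimp only at *; omega)
  · intro s hs e t ht
    exact htouch _ (by dsimp only at *; omega) e _ (by dsimp only at *; omega)

/-- A bounded number of vertices can be attached to a hole at whose edge `f k`, `f (k + 1)` the
common neighbour `z` attaches. -/
theorem exists_bound_attached_hole : ∃ N : ℕ, ∀ {V : Type*} [Finite V] {G : SimpleGraph V}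
    {z a : V} {f : ℕ → V} {n k : ℕ} (w : ℕ → V), Good G → HoleOn G a f n → ¬ G.Adj z a → z ≠ a →
    (∀ s ≤ n, z ≠ f s ∧ (G.Adj z (f s) ↔ s = k ∨ s = k + 1)) → 0 < k → k < n →
    (∀ i < N, G.Adj z (w i) ∧ ¬ G.Adj (w i) (f k) ∧ ¬ G.Adj (w i) (f (k + 1)) ∧ w i ≠ a ∧
      (∀ s ≤ n, w i ≠ f s) ∧ ∃ s ≤ n, G.Adj (w i) (f s)) →
    (∀ i j, i < j → j < N → w i ≠ w j ∧ ¬ G.Adj (w i) (w j)) → False := by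
  obtain ⟨N, hN⟩ := exists_bound_attached
  refine ⟨N, ?_⟩
  intro V _ G z a f n k w hG h hza hza' hzf hk hkn hw hww
  -- Based at `f k`, the hole has `f (k + 1)` as its last vertex, which is the other neighbour of
  -- `z`.
  have hr := h.rotate hk hkn
  refine hN w hG hr ((hzf k hkn.le).2.2 (.inl rfl)) ?_ ?_ hww
  · intro i hi
    split_ifs with h1 h2
    · refine ⟨(hzf _ (by omega)).1, ?_⟩
      rw [(hzf _ (by omega)).2]; omega
    · exact ⟨hza', fun e => absurd e hza, by omega⟩
    · refine ⟨(hzf _ (by omega)).1, ?_⟩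
      rw [(hzf _ (by omega)).2]; omega
  · intro i hi
    obtain ⟨h1, h2, h3, h4, h5, s, hs, h6⟩ := hw i hi
    refine ⟨h1, h2, ?_, h5 k hkn.le, ?_, ?_⟩
    · rw [if_neg (by omega), if_neg (by omega), show n + k + 1 - n = k + 1 by omega]
      exact h3
    · intro j hj
      split_ifs
      · exact h5 _ (by omega)
      · exact h4
      · exact h5 _ (by omega)
    · rcases lt_trichotomy s k with h' | rfl | h'
      · refine ⟨k - 1 - s, by omega, ?_⟩
        rw [if_pos (by omega), show k - 1 - (k - 1 - s) = s by omega]; exact h6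
      · exact absurd h6 h2
      · refine ⟨n + k + 1 - s, by omega, ?_⟩
        rw [if_neg (by omega), if_neg (by omega), show n + k + 1 - (n + k + 1 - s) = s by omega]
        exact h6

/-- A vertex non-adjacent to `a` attaches to edges of boundedly many paths of a family. -/
theorem exists_bound_edge (t : ℕ) : ∃ N : ℕ, ∀ {V : Type*} [Finite V] {G : SimpleGraph V}
    {a x y z : V} {f : ℕ → ℕ → V} {n k : ℕ → ℕ}, Good G → G.CliqueFree t → Family G a x y f n N →
    z ≠ a → ¬ G.Adj z a → (∀ i < N, 2 ≤ k i ∧ k i + 3 ≤ n i ∧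
      ∀ s ≤ n i, z ≠ f i s ∧ (G.Adj z (f i s) ↔ s = k i ∨ s = k i + 1)) → False := by
  obtain ⟨N₀, h₀⟩ := exists_bound_attached_hole
  -- The colour records which neighbours of `z` on either path touch the other path. The length
  -- allows for one path touched from `N₀` others, and for the three paths of `ThreeArms.false`.
  obtain ⟨N₁, h₁⟩ := exists_homogeneous (Prop × Prop × Prop × Prop) (N₀ + 3)
  obtain ⟨N, hN⟩ := exists_anticomplete t 2 N₁
  refine ⟨N, ?_⟩
  intro V _ G a x y z f n k hG ht F hza hza' hz
  have hne' : ∀ i < N, ∀ j < N, i ≠ j → ∀ s ≤ n j, ∀ b < 2, f i (k i + b) ≠ f j s := by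
    intro i hi j hj hij s hs b hb e
    have h1 := hz i hi
    have := F.eq i hi j hj hij _ (by omega) s hs e; omega
  obtain ⟨e, he, hac⟩ := hN (fun i => {f i (k i), f i (k i + 1)}) hG ht
    (fun i hi => ⟨⟨_, Set.mem_insert _ _⟩, (Set.ncard_insert_le _ _).trans (by simp)⟩) (by
      intro i hi j hj hij
      have h2 := hz j hj
      have e1 := fun s hs b hb => hne' i hi j hj hij s hs b hb
      rw [Set.disjoint_left]
      rintro _ (rfl | rfl) (e | e)
      · exact e1 _ (by omega) 0 (by omega) e
      · exact e1 _ (by omega) 0 (by omega) e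
      · exact e1 _ (by omega) 1 (by omega) e
      · exact e1 _ (by omega) 1 (by omega) e)
  obtain ⟨e', K, he', hK⟩ := h₁ fun i j =>
    (∃ s ≤ n (e j), G.Adj (f (e i) (k (e i))) (f (e j) s),
     ∃ s ≤ n (e j), G.Adj (f (e i) (k (e i) + 1)) (f (e j) s),
     ∃ s ≤ n (e i), G.Adj (f (e j) (k (e j))) (f (e i) s),
     ∃ s ≤ n (e i), G.Adj (f (e j) (k (e j) + 1)) (f (e i) s))
  have F' := F.reindex (M := N₀ + 3) (e := fun i => e (e' i)) (fun i hi => he _ (he' i hi))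
    (fun i j hij hj => (hac _ _ (hK i j hij hj).1 (he' j hj)).1)
  have hac' : ∀ i < N₀ + 3, ∀ j < N₀ + 3, i ≠ j → ∀ b < 2, ∀ c < 2,
      ¬ G.Adj (f (e (e' i)) (k (e (e' i)) + b)) (f (e (e' j)) (k (e (e' j)) + c)) := by
    have key : ∀ i j, i < j → j < N₀ + 3 → ∀ b < 2, ∀ c < 2,
        ¬ G.Adj (f (e (e' i)) (k (e (e' i)) + b)) (f (e (e' j)) (k (e (e' j)) + c)) := by
      intro i j hij hj b hb c hc
      refine (hac _ _ (hK i j hij hj).1 (he' j hj)).2 _ ?_ _ ?_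
      · obtain rfl | rfl : b = 0 ∨ b = 1 := by omega
        · exact .inl rfl
        · exact .inr rfl
      · obtain rfl | rfl : c = 0 ∨ c = 1 := by omega
        · exact .inl rfl
        · exact .inr rfl
    intro i hi j hj hij b hb c hc h
    rcases Nat.lt_or_ge i j with h' | h'
    · exact key i j h' hj b hb c hc h
    · exact key j i (by omega) hi c hc b hb h.symm
  have hz' := fun i (hi : i < N₀ + 3) => hz _ (he _ (he' i hi))
  have hK' := fun i j hij hj => (hK i j hij hj).2
  clear hac hK hz F hne'
  generalize hfe : (fun i => f (e (e' i))) = f' at *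
  generalize hne : (fun i => n (e (e' i))) = n' at *
  generalize hke : (fun i => k (e (e' i))) = k' at *
  have hf : ∀ i, f (e (e' i)) = f' i := fun i => congrFun hfe i
  have hn : ∀ i, n (e (e' i)) = n' i := fun i => congrFun hne i
  have hk : ∀ i, k (e (e' i)) = k' i := fun i => congrFun hke i
  simp only [hf, hn, hk] at hac' hz' hK'
  have hne' : ∀ i < N₀ + 3, ∀ j < N₀ + 3, i ≠ j → ∀ s ≤ n' j, ∀ b < 2,
      f' i (k' i + b) ≠ f' j s := by
    intro i hi j hj hij s hs b hb e
    have h1 := hz' i hi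
    have := F'.eq i hi j hj hij _ (by omega) s hs e; omega
  have touch : ∀ j < N₀ + 3, ∀ b < 2, ∀ ι : ℕ → ℕ, (∀ i < N₀, ι i < N₀ + 3 ∧ ι i ≠ j) →
      (∀ i i', i < i' → i' < N₀ → ι i ≠ ι i') →
      (∀ i < N₀, ∃ s ≤ n' j, G.Adj (f' (ι i) (k' (ι i) + b)) (f' j s)) → False := by
    intro j hj b hb ι hι hι' ht
    obtain ⟨z1, z2, z3⟩ := hz' j hj
    refine h₀ (fun i => f' (ι i) (k' (ι i) + b)) hG (F'.hole j hj) hza' hza z3 (by omega) (by omega)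
      (fun i hi => ?_) fun i i' hi hi' => ?_
    · obtain ⟨i1, i2⟩ := hι i hi
      obtain ⟨y1, y2, y3⟩ := hz' _ i1
      exact ⟨(y3 _ (by omega)).2.2 (by omega), hac' _ i1 _ hj i2 b hb 0 (by omega),
        hac' _ i1 _ hj i2 b hb 1 (by omega), ((F'.hole _ i1).ne _ (by omega)).symm,
        fun s hs => hne' _ i1 _ hj i2 s hs b hb, ht i hi⟩
    · obtain ⟨i1, i2⟩ := hι i (by omega)
      obtain ⟨i3, i4⟩ := hι i' hi'
      have := hz' _ i3
      exact ⟨hne' _ i1 _ i3 (hι' _ _ hi hi') _ (by omega) b hb,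
        hac' _ i1 _ i3 (hι' _ _ hi hi') b hb b hb⟩
  -- A colour that is constantly true makes the last path touched by the `N₀` first ones, or the
  -- first path by the `N₀` next ones, and the touching vertices are attached to its hole.
  have hP : ¬ K.1 ∧ ¬ K.2.1 ∧ ¬ K.2.2.1 ∧ ¬ K.2.2.2 := by
    refine ⟨fun h => ?_, fun h => ?_, fun h => ?_, fun h => ?_⟩
    · refine touch N₀ (by omega) 0 (by omega) (fun i => i) (fun i hi => by omega)
        (fun i i' h _ => by omega) fun i hi => ?_
      rw [← hK' i N₀ hi (by omega)] at h; exact h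
    · refine touch N₀ (by omega) 1 (by omega) (fun i => i) (fun i hi => by omega)
        (fun i i' h _ => by omega) fun i hi => ?_
      rw [← hK' i N₀ hi (by omega)] at h; exact h
    · refine touch 0 (by omega) 0 (by omega) (fun i => i + 1) (fun i hi => by omega)
        (fun i i' h _ => by omega) fun i hi => ?_
      rw [← hK' 0 (i + 1) (by omega) (by omega)] at h; exact h
    · refine touch 0 (by omega) 1 (by omega) (fun i => i + 1) (fun i hi => by omega)
        (fun i i' h _ => by omega) fun i hi => ?_
      rw [← hK' 0 (i + 1) (by omega) (by omega)] at h; exact h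
  have hno : ∀ i < N₀ + 3, ∀ j < N₀ + 3, i ≠ j → ∀ s ≤ n' i, G.Adj z (f' i s) → ∀ t ≤ n' j,
      ¬ G.Adj (f' i s) (f' j t) := by
    intro i hi j hj hij s hs hzs t ht hst
    rcases ((hz' i hi).2.2 s hs).2.1 hzs with rfl | rfl <;> rcases Nat.lt_or_ge i j with h | h
    · exact hP.1 (by rw [← hK' i j h hj]; exact ⟨t, ht, hst⟩)
    · exact hP.2.2.1 (by rw [← hK' j i (by omega) hi]; exact ⟨t, ht, hst⟩)
    · exact hP.2.1 (by rw [← hK' i j h hj]; exact ⟨t, ht, hst⟩)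
    · exact hP.2.2.2 (by rw [← hK' j i (by omega) hi]; exact ⟨t, ht, hst⟩)
  have arms : ∀ i < N₀ + 3, Arms G z x y (armData (f' i) (n' i) (k' i)).A
      (armData (f' i) (n' i) (k' i)).α (armData (f' i) (n' i) (k' i)).B
      (armData (f' i) (n' i) (k' i)).β := by
    intro i hi
    obtain ⟨z1, z2, z3⟩ := hz' i hi
    rw [← F'.start i hi, ← F'.finish i hi]
    refine Arms.of_path (F'.hole i hi).path (fun s hs => (z3 s hs).1) (by omega) (by omega)
      ((z3 _ (by omega)).2.2 (.inl rfl)) ((z3 _ (by omega)).2.2 (.inr rfl)) ?_ ?_ ?_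
    · intro s hs
      rw [(z3 _ (by omega)).2]; omega
    · rw [(z3 _ (by omega)).2]; omega
    · intro t ht1 ht2 _
      rw [deg_eq_one (x := f' i (k' i + 1)) ?_ (mem_seg_of (by omega) (by omega))]
      · exact odd_one
      · rintro _ ⟨s, s1, s2, rfl⟩
        rw [(z3 _ (by omega)).2, ((F'.hole i hi).path.pair (by omega) (by omega)).1]; omega
  have half : ∀ i < N₀ + 3, ∀ j < N₀ + 3, i ≠ j →
      Half G z (armData (f' i) (n' i) (k' i)) (armData (f' j) (n' j) (k' j)) := by
    intro i hi j hj hij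
    obtain ⟨z1, z2, z3⟩ := hz' i hi
    obtain ⟨y1, y2, y3⟩ := hz' j hj
    exact Half.of_path (by omega) (by omega) (F'.eq i hi j hj hij)
      ((z3 _ (by omega)).2.2 (.inl rfl)) (hno i hi j hj hij)
  have two : ∀ i < N₀ + 3, ∀ j < N₀ + 3, i ≠ j →
      TwoArms G z x y (armData (f' i) (n' i) (k' i)) (armData (f' j) (n' j) (k' j)) :=
    fun i hi j hj hij => ⟨arms i hi, arms j hj, half i hi j hj hij, half j hj i hi hij.symm⟩
  have simple : ∀ i < N₀ + 3, Simple G z (armData (f' i) (n' i) (k' i)) := by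
    intro i hi s hs h
    obtain ⟨z1, z2, z3⟩ := hz' i hi
    simp only [armData] at hs h
    rw [(z3 _ (by omega)).2] at h; omega
  exact ThreeArms.false hG ⟨two 0 (by omega) 1 (by omega) (by omega),
    two 0 (by omega) 2 (by omega) (by omega), two 1 (by omega) 2 (by omega) (by omega)⟩
    (simple 0 (by omega)) (simple 1 (by omega)) (simple 2 (by omega))

end Kaleidoscope

/-! ### Probes: parity over the sectors cut out by the neighbours of `z`. -/

namespace Kaleidoscope

variable {V : Type*} {G : SimpleGraph V}

theorem HoleOn.rev {o : V} {f : ℕ → V} {n : ℕ} (h : HoleOn G o f n) :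
    HoleOn G o (fun s => f (n - s)) n :=
  ⟨h.path.rev le_rfl, h.two_le, fun i hi => h.ne _ (by omega), fun i hi => by
    rw [h.adj _ (by omega)]; omega⟩

section

variable [Finite V]

theorem HoleOn.even_deg_of_link_or (hG : Good G) {o : V} {g : ℕ → V} {m : ℕ} (h : HoleOn G o g m)
    {c : V} (hcg : ∀ i ≤ m, c ≠ g i) (hne : c ≠ o) (hc0 : ¬ G.Adj c (g 0)) (hcm : ¬ G.Adj c (g m))
    {R : Set V} (hR : ∀ r ∈ R, ∀ i ≤ m, r ≠ g i ∧ ¬ G.Adj r (g i))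
    (hl : Link G (insert o (insert c R)) o c) : Even (deg G c (seg g 0 (m + 1))) := by
  by_cases hco : G.Adj c o
  · exact h.even_deg hG hcg hco hc0 hcm
  · exact h.even_deg_of_link hG hcg hne hco hc0 hcm hR hl

variable {a z c : V} {f : ℕ → V} {n : ℕ} {R : Set V}

/-- `c` is joined to `z` through `R`, avoiding the hole and the neighbours of `z` in it. -/
structure Probe (G : SimpleGraph V) (a z c : V) (f : ℕ → V) (n : ℕ) (R : Set V) : Prop where
  hole : HoleOn G a f n
  ne : z ≠ a
  ne_path : ∀ s ≤ n, z ≠ f s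
  ne' : c ≠ a
  not_adj : ¬ G.Adj c a
  ne_path' : ∀ s ≤ n, c ≠ f s
  not_adj_path : ∀ s ≤ n, G.Adj z (f s) → ¬ G.Adj c (f s)
  awayR : ∀ r ∈ R, r ≠ a ∧ ¬ G.Adj r a
  awayR_path : ∀ r ∈ R, ∀ s ≤ n, r ≠ f s ∧ ¬ G.Adj r (f s)
  link : Link G (insert z (insert c R)) z c
  range : ∀ s ≤ n, G.Adj z (f s) → 2 ≤ s ∧ s + 2 ≤ n

omit [Finite V] in
theorem Probe.rev (H : Probe G a z c f n R) : Probe G a z c (fun s => f (n - s)) n R :=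
  ⟨H.hole.rev, H.ne, fun s _ => H.ne_path _ (by omega), H.ne', H.not_adj,
    fun s _ => H.ne_path' _ (by omega), fun s _ => H.not_adj_path _ (by omega), H.awayR,
    fun r hr s _ => H.awayR_path r hr _ (by omega), H.link, fun s hs h => by
      have := H.range _ (by omega) h; omega⟩

/-- The part of the path up to the first neighbour of `z` closes to a hole through `a` and `z`.
Since `c` is linked to `z` off this hole, its degree is even; `a` does not contribute. -/
theorem Probe.even_low (hG : Good G) (H : Probe G a z c f n R) (hza : G.Adj z a) {i : ℕ}
    (hi : i ≤ n) (hzi : G.Adj z (f i)) (hmin : ∀ s < i, ¬ G.Adj z (f s)) :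
    Even (deg G c (seg f 0 (i + 1))) := by
  have hr := H.range i hi hzi
  have hp : IndPath G (cat (fun _ => a) 0 f) (0 + 1 + i) := by
    refine (IndPath.zero _).cat (H.hole.path.le hi) ?_
    intro _ hi0 j hj
    refine ⟨H.hole.ne j (by omega), ?_⟩
    rw [H.hole.adj j (by omega)]; omega
  have hval : ∀ Q : V → Prop, Q a → (∀ s ≤ i, Q (f s)) → ∀ s ≤ 0 + 1 + i,
      Q (cat (fun _ => a) 0 f s) := by
    intro Q q1 q2 s hs
    simp only [cat]; split_ifs
    · exact q1
    · exact q2 _ (by omega)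
  have e1 : cat (fun _ => a) 0 f (0 + 1 + i) = f i := by
    simp only [cat]; rw [if_neg (by omega)]; congr 1; omega
  have hh : HoleOn G z (cat (fun _ => a) 0 f) (0 + 1 + i) := by
    refine ⟨hp, by omega, hval (fun v => z ≠ v) H.ne fun s hs => H.ne_path s (by omega),
      fun s hs => ?_⟩
    simp only [cat]; split_ifs
    · exact ⟨fun _ => .inl (by omega), fun _ => hza⟩
    · refine ⟨fun e => ?_, fun e => ?_⟩
      · by_contra hne
        exact hmin _ (by omega) e
      · rw [show s - (0 + 1) = i by omega]; exact hzi
  have := hh.even_deg_of_link_or hG (c := c) (hval (fun v => c ≠ v) H.ne' fun s hs =>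
    H.ne_path' s (by omega)) (fun e => ?_) (by simpa [cat] using H.not_adj)
    (by rw [e1]; exact H.not_adj_path i hi hzi) (R := R) (fun r hr => hval (fun v => r ≠ v ∧ ¬ G.Adj r v)
      (H.awayR r hr) fun s hs => H.awayR_path r hr s (by omega)) H.link
  · rw [show 0 + 1 + i + 1 = 0 + 1 + (i + 1) by omega, seg_cat, seg_one, deg_union,
      deg_singleton H.not_adj] at this
    · simpa using this
    · rintro _ rfl ⟨s, -, hs, e⟩
      exact H.hole.ne s (by omega) e
  · exact H.not_adj (e ▸ hza)

theorem Probe.even_high (hG : Good G) (H : Probe G a z c f n R) (hza : G.Adj z a) {i : ℕ}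
    (hi : i ≤ n) (hzi : G.Adj z (f i)) (hmax : ∀ s, i < s → s ≤ n → ¬ G.Adj z (f s)) :
    Even (deg G c (seg f i (n + 1))) := by
  have hr := H.range i hi hzi
  have := H.rev.even_low hG hza (i := n - i) (by omega)
    (by rwa [show n - (n - i) = i by omega]) (fun s hs => hmax _ (by omega) (by omega))
  have e : seg (fun s => f (n - s)) 0 (n - i + 1) = seg f i (n + 1) := by
    ext v; constructor
    · rintro ⟨s, -, hs, rfl⟩; exact mem_seg_of (by omega) (by omega)
    · rintro ⟨s, h1, h2, rfl⟩
      exact ⟨n - s, by omega, by omega, by dsimp only; congr 1; omega⟩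
  rwa [e] at this

/-- Two neighbours of `z` with none in between, and not adjacent, bound a hole through `z`. -/
theorem Probe.even_gap (hG : Good G) (H : Probe G a z c f n R) {i j : ℕ} (hij : i + 2 ≤ j)
    (hj : j ≤ n) (hzi : G.Adj z (f i)) (hzj : G.Adj z (f j))
    (hgap : ∀ s, i < s → s < j → ¬ G.Adj z (f s)) : Even (deg G c (seg f i (j + 1))) := by
  have hh : HoleOn G z (fun s => f (i + s)) (j - i) := by
    refine ⟨H.hole.path.sub i (by omega), by omega, fun s hs => H.ne_path _ (by omega),
      fun s hs => ⟨fun e => ?_, ?_⟩⟩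
    · by_contra hne
      exact hgap (i + s) (by omega) (by omega) e
    · rintro (rfl | rfl)
      · exact hzi
      · rwa [show i + (j - i) = j by omega]
  have := hh.even_deg_of_link_or hG (c := c) (fun s hs => H.ne_path' _ (by omega)) (fun e => ?_)
    (H.not_adj_path i (by omega) hzi)
    (by rw [show i + (j - i) = j by omega]; exact H.not_adj_path j hj hzj)
    (fun r hr s hs => H.awayR_path r hr _ (by omega)) H.link
  · rwa [seg_shift, show i + (j - i + 1) = j + 1 by omega] at this
  · exact H.not_adj_path i (by omega) hzi (e ▸ hzi)

theorem Probe.even_between (hG : Good G) (H : Probe G a z c f n R) {i j : ℕ} (hij : i ≤ j)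
    (hj : j ≤ n) (hzi : G.Adj z (f i)) (hzj : G.Adj z (f j)) :
    Even (deg G c (seg f i (j + 1))) := by
  have := (H.hole.path.sub i (k := j - i) (by omega)).even_deg_of_sectors (c := c)
    (A := fun s => G.Adj z (f (i + s))) (k := 0) (by omega) hzi
    (fun s hs => H.not_adj_path _ (by omega)) ?_ ?_ ?_
  · rwa [seg_shift, show i + (j - i + 1) = j + 1 by omega] at this
  · intro s hs h1 h2
    obtain rfl : s = 0 := by
      by_contra h
      exact h2 0 (by omega) hzi
    rw [seg_one, deg_singleton (H.not_adj_path _ (by omega) h1)]; exact Even.zero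
  · intro s hs h1 h2
    obtain rfl : s = j - i := by
      by_contra h
      exact h2 (j - i) (by omega) le_rfl (by rwa [show i + (j - i) = j by omega])
    rw [seg_one, deg_singleton (H.not_adj_path _ (by omega) h1)]; exact Even.zero
  · intro s t hst ht h1 h2 h3
    have e : seg (fun s => f (i + s)) s (t + 1) = seg f (i + s) (i + t + 1) := by
      ext v; constructor
      · rintro ⟨r, h1, h2, rfl⟩; exact mem_seg_of (by omega) (by omega)
      · rintro ⟨r, h1, h2, rfl⟩
        exact ⟨r - i, by omega, by omega, by dsimp only; congr 1; omega⟩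
    rw [e]
    refine H.even_gap hG (by omega) (by omega) h1 h2 fun r r1 r2 => ?_
    have := h3 (r - i) (by omega) (by omega)
    rwa [show i + (r - i) = r by omega] at this

/-- The sector through `a`. -/
theorem Probe.even_wrap (hG : Good G) (H : Probe G a z c f n R) (hza : ¬ G.Adj z a) {i j : ℕ}
    (hij : i + 2 ≤ j) (hj : j ≤ n) (hzi : G.Adj z (f i)) (hzj : G.Adj z (f j))
    (hmin : ∀ s < i, ¬ G.Adj z (f s)) (hmax : ∀ s, j < s → s ≤ n → ¬ G.Adj z (f s)) :
    Even (deg G c (seg f 0 (i + 1)) + deg G c (seg f j (n + 1))) := by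
  have hr := H.range j hj hzj
  -- The hole rotated to `f (i + 1)`, which lies strictly between `f i` and `f j`, and cut off at `f
  -- j`: the path `f i, …, f 0, a, f n, …, f j`.
  set π : ℕ → V := fun s => if s < i + 1 then f (i + 1 - 1 - s) else if s = i + 1 then a
    else f (n + (i + 1) + 1 - s) with hπ
  have hp : IndPath G π (n + i + 2 - j) :=
    (H.hole.rotate (k := i + 1) (by omega) (by omega)).path.le (by omega)
  have e0 : π 0 = f i := by simp [π]
  have e1 : π (n + i + 2 - j) = f j := by
    simp only [π]; rw [if_neg (by omega), if_neg (by omega)]; congr 1; omega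
  have hval : ∀ Q : V → Prop, Q a → (∀ s ≤ n, Q (f s)) → ∀ s ≤ n + i + 2 - j, Q (π s) := by
    intro Q q1 q2 s hs
    simp only [π]; split_ifs
    · exact q2 _ (by omega)
    · exact q1
    · exact q2 _ (by omega)
  have hh : HoleOn G z π (n + i + 2 - j) := by
    refine ⟨hp, by omega, hval (fun v => z ≠ v) H.ne H.ne_path, fun s hs => ⟨fun e => ?_, ?_⟩⟩
    · simp only [π] at e; split_ifs at e
      · by_contra hne
        exact hmin _ (by omega) e
      · exact absurd e hza
      · by_contra hne
        exact hmax _ (by omega) (by omega) e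
    · rintro (rfl | rfl)
      · rwa [e0]
      · rwa [e1]
  have := hh.even_deg_of_link_or hG (c := c) (hval (fun v => c ≠ v) H.ne' H.ne_path') (fun e => ?_)
    (by rw [e0]; exact H.not_adj_path i (by omega) hzi)
    (by rw [e1]; exact H.not_adj_path j hj hzj)
    (fun r hr => hval (fun v => r ≠ v ∧ ¬ G.Adj r v) (H.awayR r hr) (H.awayR_path r hr)) H.link
  · rw [← deg_union, ← deg_insert_not_adj H.not_adj]
    · have e : seg π 0 (n + i + 2 - j + 1) = insert a (seg f 0 (i + 1) ∪ seg f j (n + 1)) := by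
        ext v; constructor
        · rintro ⟨s, -, hs, rfl⟩
          simp only [π]; split_ifs
          · exact .inr (.inl (mem_seg_of (by omega) (by omega)))
          · exact .inl rfl
          · exact .inr (.inr (mem_seg_of (by omega) (by omega)))
        · rintro (rfl | ⟨s, -, hs, rfl⟩ | ⟨s, h1, hs, rfl⟩)
          · exact ⟨i + 1, by omega, by omega, by simp [π]⟩
          · refine ⟨i - s, by omega, by omega, ?_⟩
            simp only [π]; rw [if_pos (by omega)]; congr 1; omega
          · refine ⟨n + i + 2 - s, by omega, by omega, ?_⟩
            simp only [π]; rw [if_neg (by omega), if_neg (by omega)]; congr 1; omega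
      rwa [← e]
    · rintro _ ⟨s, -, hs, rfl⟩ ⟨t, h1, h2, e⟩
      have := H.hole.path.inj (by omega) (by omega) e; omega
  · exact H.not_adj_path i (by omega) hzi (e ▸ hzi)

omit [Finite V] in
/-- The only neighbour of `z` in the hole is `f k`. -/
theorem Probe.even_single (hG : Good G) (H : Probe G a z c f n R) (hza : ¬ G.Adj z a) {k : ℕ}
    (hk : k ≤ n) (hzk : ∀ s ≤ n, G.Adj z (f s) ↔ s = k) (h₀ : ¬ G.Adj c (f (k - 1)))
    (h₁ : ¬ G.Adj c (f (k + 1))) : Even (deg G c (seg f 0 (n + 1))) := by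
  have hr := H.range k hk ((hzk k hk).2 rfl)
  -- With a single neighbour, `z` closes no sector to a hole. The hole is based at `f k` instead and
  -- `z` joins the link from `f k` to `c`; this is why `c` must not see the neighbours of `f k`.
  have hh := H.hole.rotate (k := k) (by omega) (by omega)
  set π : ℕ → V := fun s => if s < k then f (k - 1 - s) else if s = k then a
    else f (n + k + 1 - s) with hπ
  have hcz : c ≠ f k := H.ne_path' k hk
  have hck : ¬ G.Adj c (f k) := H.not_adj_path k hk ((hzk k hk).2 rfl)
  have hval : ∀ Q : V → Prop, Q a → (∀ s ≤ n, s ≠ k → Q (f s)) → ∀ s ≤ n, Q (π s) := by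
    intro Q q1 q2 s hs
    simp only [π]; split_ifs
    · exact q2 _ (by omega) (by omega)
    · exact q1
    · exact q2 _ (by omega) (by omega)
  have := hh.even_deg_of_link hG (c := c) (R := insert z R)
    (hval (fun v => c ≠ v) H.ne' fun s hs _ => H.ne_path' s hs) hcz hck
    (by simp only [π]; rw [if_pos (by omega)]; exact h₀)
    (by simp only [π]; rw [if_neg (by omega), if_neg (by omega), show n + k + 1 - n = k + 1 by omega]
        exact h₁) ?_ ?_
  · have e : insert (f k) (seg π 0 (n + 1)) = insert a (seg f 0 (n + 1)) := by
      ext v; constructor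
      · rintro (rfl | ⟨s, -, hs, rfl⟩)
        · exact .inr (mem_seg_of (by omega) (by omega))
        · simp only [π]; split_ifs
          · exact .inr (mem_seg_of (by omega) (by omega))
          · exact .inl rfl
          · exact .inr (mem_seg_of (by omega) (by omega))
      · rintro (rfl | ⟨s, -, hs, rfl⟩)
        · refine .inr ⟨k, by omega, by omega, ?_⟩
          simp [π]
        · rcases lt_trichotomy s k with h | rfl | h
          · refine .inr ⟨k - 1 - s, by omega, by omega, ?_⟩
            simp only [π]; rw [if_pos (by omega)]; congr 1; omega
          · exact .inl rfl
          · refine .inr ⟨n + k + 1 - s, by omega, by omega, ?_⟩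
            simp only [π]; rw [if_neg (by omega), if_neg (by omega)]; congr 1; omega
    rw [← deg_insert_not_adj H.not_adj, ← e, deg_insert_not_adj hck]
    exact this
  · rintro r (rfl | hr)
    · exact hval (fun v => r ≠ v ∧ ¬ G.Adj r v) ⟨H.ne, hza⟩ fun s hs hsk =>
        ⟨H.ne_path s hs, fun e => hsk ((hzk s hs).1 e)⟩
    · exact hval (fun v => r ≠ v ∧ ¬ G.Adj r v) (H.awayR r hr) fun s hs _ => H.awayR_path r hr s hs
  · refine (Link.of_adj ((hzk k hk).2 rfl).symm (by simp) (by simp)).trans (H.link.mono ?_)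
    rintro v (rfl | rfl | hv)
    · simp
    · simp
    · simp [hv]

/-- Summing over the sectors shows that `c` has an even number of neighbours on the hole. The sum
fails when `z` is not adjacent to `a` and sees just the ends of an edge, for then the cycle through
`z` and `a` has that edge as a chord; `hedge` excludes this. A single neighbour is the case of
`hsingle`. -/
theorem Probe.exists_atEdge (hG : Good G) (H : Probe G a z c f n R) {i₀ k₁ : ℕ} (hi₀ : i₀ ≤ n)
    (hzi₀ : G.Adj z (f i₀)) (hk₁ : k₁ ≤ n) (hck₁ : G.Adj c (f k₁))
    (hedge : ∀ k, ¬ AtEdge G z f n k ∨ G.Adj z a)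
    (hsingle : ∀ k ≤ n, (∀ s ≤ n, G.Adj z (f s) ↔ s = k) →
      ¬ G.Adj c (f (k - 1)) ∧ ¬ G.Adj c (f (k + 1))) : ∃ b, AtEdge G c f n b := by
  refine H.hole.exists_atEdge hG H.ne' H.ne_path' H.not_adj ?_ hk₁ hck₁
  obtain ⟨i, j, h1, h2, h3, h4, h5, h6⟩ := exists_first_last (P := fun s => G.Adj z (f s)) hi₀ hzi₀
  have hmin : ∀ s < i, ¬ G.Adj z (f s) := fun s hs e => by have := h6 s (by omega) e; omega
  have hmax : ∀ s, j < s → s ≤ n → ¬ G.Adj z (f s) := fun s hs hs' e => by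
    have := h6 s (by omega) e; omega
  have s1 := H.hole.path.deg_seg_split c (Nat.zero_le i) (show i ≤ n + 1 by omega) le_rfl
  have s2 := H.hole.path.deg_seg_split c (Nat.zero_le i) (show i ≤ i + 1 by omega) (by omega)
  have s3 := H.hole.path.deg_seg_split c (show i ≤ j by omega) (show j ≤ n + 1 by omega) (by omega)
  have s4 := H.hole.path.deg_seg_split c (show i ≤ j by omega) (show j ≤ j + 1 by omega) (by omega)
  rw [seg_one, deg_singleton (H.not_adj_path i (by omega) h4)] at s2
  rw [seg_one, deg_singleton (H.not_adj_path j (by omega) h5)] at s4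
  have hb := H.even_between hG (show i ≤ j by omega) h3 h4 h5
  by_cases hza : G.Adj z a
  · have hlo := H.even_low hG hza (by omega) h4 hmin
    have hhi := H.even_high hG hza h3 h5 hmax
    rw [Nat.even_iff] at *; omega
  · rcases Nat.lt_or_ge j (i + 2) with h | h
    · obtain rfl | rfl : j = i ∨ j = i + 1 := by omega
      · have hz : ∀ s ≤ n, G.Adj z (f s) ↔ s = j := fun s hs =>
          ⟨fun e => by have := h6 s hs e; omega, by rintro rfl; exact h4⟩
        obtain ⟨c1, c2⟩ := hsingle j h3 hz
        exact H.even_single hG hza h3 hz c1 c2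
      · rcases hedge i with h' | h'
        · refine absurd ⟨h3, fun s hs => ⟨fun e => ?_, ?_⟩⟩ h'
          · have := h6 s hs e; omega
          · rintro (rfl | rfl)
            · exact h4
            · exact h5
        · exact absurd h' hza
    · have hw := H.even_wrap hG hza h h3 h4 h5 hmin hmax
      rw [Nat.even_iff] at *; omega

end

end Kaleidoscope

/-! ### Two holes through `a` with untouched neighbours of `z`. -/

namespace Kaleidoscope

variable {V : Type*} {G : SimpleGraph V}

/-- Two holes through `a` whose paths share only their ends, and a vertex `z` whose neighbours in
either path are not adjacent to the other path. -/
structure TwoHoles (G : SimpleGraph V) (a z : V) (f : ℕ → V) (n : ℕ) (g : ℕ → V) (m : ℕ) : Prop where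
  hole : HoleOn G a f n
  hole' : HoleOn G a g m
  start : f 0 = g 0
  finish : f n = g m
  eq : ∀ s ≤ n, ∀ t ≤ m, f s = g t → (s = 0 ∧ t = 0) ∨ (s = n ∧ t = m)
  ne : z ≠ a
  ne_path : ∀ s ≤ n, z ≠ f s
  ne_path' : ∀ s ≤ m, z ≠ g s
  range : ∀ s ≤ n, G.Adj z (f s) → 2 ≤ s ∧ s + 2 ≤ n
  range' : ∀ s ≤ m, G.Adj z (g s) → 2 ≤ s ∧ s + 2 ≤ m
  exists_adj : ∃ s ≤ n, G.Adj z (f s)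
  exists_adj' : ∃ s ≤ m, G.Adj z (g s)
  touch : ∀ s ≤ n, G.Adj z (f s) → ∀ t ≤ m, ¬ G.Adj (f s) (g t)
  touch' : ∀ s ≤ m, G.Adj z (g s) → ∀ t ≤ n, ¬ G.Adj (g s) (f t)
  edge : ∀ k, ¬ AtEdge G z f n k ∨ G.Adj z a
  edge' : ∀ k, ¬ AtEdge G z g m k ∨ G.Adj z a
  single : ∀ k ≤ n, (∀ s ≤ n, G.Adj z (f s) ↔ s = k) → ∀ t ≤ m,
    ¬ G.Adj (g t) (f (k - 1)) ∧ ¬ G.Adj (g t) (f (k + 1))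
  single' : ∀ k ≤ m, (∀ s ≤ m, G.Adj z (g s) ↔ s = k) → ∀ t ≤ n,
    ¬ G.Adj (f t) (g (k - 1)) ∧ ¬ G.Adj (f t) (g (k + 1))

variable {a z : V} {f g : ℕ → V} {n m : ℕ}

theorem TwoHoles.symm (H : TwoHoles G a z f n g m) : TwoHoles G a z g m f n :=
  ⟨H.hole', H.hole, H.start.symm, H.finish.symm, fun s hs t ht e => by
    have := H.eq t ht s hs e.symm; omega, H.ne, H.ne_path', H.ne_path, H.range', H.range,
    H.exists_adj', H.exists_adj, H.touch', H.touch, H.edge', H.edge, H.single', H.single⟩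

/-- A path of the hole from a vertex off the edge `g b`, `g (b + 1)` to that edge. -/
theorem IndPath.exists_link_edge (hg : IndPath G g m) {b k : ℕ} (hb : b + 1 ≤ m) (hk : k ≤ m)
    (h₀ : k ≠ b) (h₁ : k ≠ b + 1) : ∃ q S, (q = b ∨ q = b + 1) ∧ g k ∈ S ∧
      (∀ v ∈ S, ∃ t ≤ m, t ≠ b ∧ t ≠ b + 1 ∧ v = g t) ∧ Link G (insert (g q) S) (g k) (g q) := by
  rcases Nat.lt_or_ge k b with h | h
  · refine ⟨b, seg g k b, .inl rfl, mem_seg_of le_rfl h, ?_, ?_⟩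
    · rintro _ ⟨t, h1, h2, rfl⟩; exact ⟨t, by omega, by omega, by omega, rfl⟩
    · refine hg.link_le h.le (by omega) fun s h1 h2 => ?_
      rcases Nat.eq_or_lt_of_le h2 with rfl | h2
      · exact .inl rfl
      · exact .inr (mem_seg_of h1 h2)
  · refine ⟨b + 1, seg g (b + 2) (k + 1), .inr rfl, mem_seg_of (by omega) (by omega), ?_, ?_⟩
    · rintro _ ⟨t, h1, h2, rfl⟩; exact ⟨t, by omega, by omega, by omega, rfl⟩
    · refine hg.link_ge (by omega) hk fun s h1 h2 => ?_
      rcases Nat.eq_or_lt_of_le h1 with rfl | h1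
      · exact .inl rfl
      · exact .inr (mem_seg_of (by omega) (by omega))

theorem deg_singleton_adj {c v : V} (h : G.Adj c v) : deg G c {v} = 1 :=
  deg_eq_one (by rintro _ rfl; simp [h]) rfl

variable [Finite V]

/-- The stretch of `f` from `f i` to `f l` links `z` to `f l` away from the other hole, which makes
`f l` a probe. -/
theorem TwoHoles.atEdge (hG : Good G) (H : TwoHoles G a z f n g m) {l i : ℕ} (hl : 1 ≤ l)
    (hln : l + 1 ≤ n) (hi : i ≤ n) (hzi : G.Adj z (f i))
    (hfree : ∀ s, (l < s ∧ s ≤ i ∨ i ≤ s ∧ s < l) → ∀ t ≤ m, ¬ G.Adj (f s) (g t))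
    {t : ℕ} (ht : t ≤ m) (hlt : G.Adj (f l) (g t)) : ∃ b, AtEdge G (f l) g m b := by
  obtain ⟨i₀, hi₀, hzi₀⟩ := H.exists_adj'
  have hir := H.range i hi hzi
  have hint : ∀ s, 1 ≤ s → s + 1 ≤ n → f s ≠ a ∧ ¬ G.Adj (f s) a ∧ ∀ t ≤ m, f s ≠ g t := by
    intro s h1 h2
    refine ⟨(H.hole.ne s (by omega)).symm, ?_, fun t ht e => ?_⟩
    · rw [G.adj_comm, H.hole.adj s (by omega)]; omega
    · have := H.eq s (by omega) t ht e; omega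
  obtain ⟨l1, l2, l3⟩ := hint l hl hln
  have hP : Probe G a z (f l) g m {v | ∃ s, (l < s ∧ s ≤ i ∨ i ≤ s ∧ s < l) ∧ v = f s} := by
    refine ⟨H.hole', H.ne, H.ne_path', l1, l2, l3,
      fun s hs h e => H.touch' s hs h l (by omega) e.symm, ?_, ?_, ?_, H.range'⟩
    · rintro _ ⟨s, hs, rfl⟩
      exact ⟨(hint s (by omega) (by omega)).1, (hint s (by omega) (by omega)).2.1⟩
    · rintro _ ⟨s, hs, rfl⟩ t ht
      exact ⟨(hint s (by omega) (by omega)).2.2 t ht, hfree s hs t ht⟩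
    · have hne : i ≠ l := by rintro rfl; exact H.touch i hi hzi t ht hlt
      have hi' : f i ∈ {v | ∃ s, (l < s ∧ s ≤ i ∨ i ≤ s ∧ s < l) ∧ v = f s} :=
        ⟨i, by omega, rfl⟩
      refine (Link.of_adj hzi (by simp) (.inr (.inr hi'))).trans ?_
      rcases Nat.lt_or_ge i l with h | h
      · refine H.hole.path.link_le h.le (by omega) fun s h1 h2 => ?_
        rcases Nat.eq_or_lt_of_le h2 with rfl | h2
        · exact .inr (.inl rfl)
        · exact .inr (.inr ⟨s, by omega, rfl⟩)
      · refine H.hole.path.link_ge h hi fun s h1 h2 => ?_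
        rcases Nat.eq_or_lt_of_le h1 with rfl | h1
        · exact .inr (.inl rfl)
        · exact .inr (.inr ⟨s, by omega, rfl⟩)
  exact hP.exists_atEdge hG hi₀ hzi₀ ht hlt H.edge' fun k hk hz => H.single' k hk hz l (by omega)

/-- The neighbours of `z` in either path come in consecutive pairs. -/
theorem TwoHoles.runs (hG : Good G) (H : TwoHoles G a z f n g m) {i₀ : ℕ} (hi₀ : i₀ ≤ n)
    (hzi₀ : G.Adj z (f i₀)) : ∃ i, (i₀ = i ∨ i₀ = i + 1) ∧ 1 ≤ i ∧ i + 2 ≤ n ∧ G.Adj z (f i) ∧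
      G.Adj z (f (i + 1)) ∧ ¬ G.Adj z (f (i - 1)) ∧ ¬ G.Adj z (f (i + 2)) := by
  have hr := H.range i₀ hi₀ hzi₀
  have hC1 : ∃ t ≤ m, G.Adj (f 1) (g t) := ⟨0, by omega, by
    rw [← H.start]; exact ((H.hole.path.pair (i := 1) (j := 0) (by omega) (by omega)).2.2 (by omega))⟩
  have hC2 : ∃ t ≤ m, G.Adj (f (n - 1)) (g t) := ⟨m, le_rfl, by
    rw [← H.finish]
    exact ((H.hole.path.pair (i := n - 1) (j := n) (by omega) (by omega)).2.2 (by omega))⟩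
  have hC0 : ¬ ∃ t ≤ m, G.Adj (f i₀) (g t) := by
    rintro ⟨t, ht, e⟩; exact H.touch i₀ hi₀ hzi₀ t ht e
  -- `f l` and `f j` end the maximal stretch around `i₀` that does not touch `g`. Both attach to
  -- edges of `g`, and the stretch links them, so the edges are equal.
  obtain ⟨l, l1, l2, ⟨t, ht, l3⟩, l4⟩ := exists_last (P := fun s => ∃ t ≤ m, G.Adj (f s) (g t)) (k := 1)
    (m := i₀) (by omega) hC1
  have l5 : l ≠ i₀ := by rintro rfl; exact hC0 ⟨t, ht, l3⟩
  obtain ⟨j, j1, ⟨j2, t', ht', j3⟩, j4⟩ := exists_first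
    (P := fun s => i₀ ≤ s ∧ ∃ t ≤ m, G.Adj (f s) (g t)) (k := n - 1) ⟨by omega, hC2⟩
  have j5 : j ≠ i₀ := by rintro rfl; exact hC0 ⟨t', ht', j3⟩
  have hno : ∀ s, l < s → s < j → ∀ t ≤ m, ¬ G.Adj (f s) (g t) := by
    intro s h1 h2 t ht e
    rcases Nat.lt_or_ge i₀ s with h | h
    · exact j4 s h2 ⟨by omega, t, ht, e⟩
    · exact l4 s h1 h ⟨t, ht, e⟩
  obtain ⟨b, hb⟩ := H.atEdge hG l1 (by omega) hi₀ hzi₀ (fun s hs => hno s (by omega) (by omega)) ht l3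
  obtain ⟨b', hb'⟩ := H.atEdge hG (by omega) (by omega) hi₀ hzi₀
    (fun s hs => hno s (by omega) (by omega)) ht' j3
  have hint : ∀ s, 1 ≤ s → s + 1 ≤ n → f s ≠ a ∧ ¬ G.Adj (f s) a ∧ ∀ t ≤ m, f s ≠ g t := by
    intro s h1 h2
    refine ⟨(H.hole.ne s (by omega)).symm, ?_, fun t ht e => ?_⟩
    · rw [G.adj_comm, H.hole.adj s (by omega)]; omega
    · have := H.eq s (by omega) t ht e; omega
  obtain rfl : b = b' := by
    have c1 := hint l l1 (by omega)
    have c2 := hint j (by omega) (by omega)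
    refine H.hole'.atEdge_eq hG (S := seg f (l + 1) j) c1.2.2 c2.2.2 ⟨c1.1, c1.2.1⟩ ⟨c2.1, c2.2.1⟩
      hb hb' ?_ ?_ ?_
    · rintro _ ⟨s, s1, s2, rfl⟩
      have := hint s (by omega) (by omega); exact ⟨this.1, this.2.1⟩
    · rintro _ ⟨s, s1, s2, rfl⟩ t ht
      exact ⟨(hint s (by omega) (by omega)).2.2 t ht, hno s (by omega) s2 t ht⟩
    · exact H.hole.path.link (by omega) (by omega) (fun v hv => .inr (.inr hv)) (by simp) (by simp)
  obtain ⟨k, hk, hzk⟩ := H.exists_adj'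
  have hbf := hb.facts
  have hzb : ¬ G.Adj z (g b) ∧ ¬ G.Adj z (g (b + 1)) :=
    ⟨fun e => H.touch' b (by omega) e l (by omega) hbf.2.1.symm,
     fun e => H.touch' (b + 1) hbf.1 e l (by omega) hbf.2.2.1.symm⟩
  -- A route along `g` from a neighbour of `z` to the nearer end `g q` of that edge; `f l` and `f j`
  -- see `g q` and nothing else of the route.
  obtain ⟨q, S, hq, hkS, hS, hlS⟩ := H.hole'.path.exists_link_edge hbf.1 hk
    (by rintro rfl; exact hzb.1 hzk) (by rintro rfl; exact hzb.2 hzk)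
  have hqm : q ≤ m := by omega
  have hlq : G.Adj (f l) (g q) := (hb.2 q hqm).2 hq
  have hjq : G.Adj (f j) (g q) := (hb'.2 q hqm).2 hq
  have hzq : ¬ G.Adj z (g q) := by rcases hq with rfl | rfl <;> [exact hzb.1; exact hzb.2]
  have hzl : ¬ G.Adj z (f l) := fun e => H.touch l (by omega) e q hqm hlq
  have hzj : ¬ G.Adj z (f j) := fun e => H.touch j (by omega) e q hqm hjq
  obtain ⟨i, i', h1, h2, h3, ⟨h4, h4'⟩, ⟨h5, h5'⟩, h6⟩ := exists_first_last
    (P := fun s => l < s ∧ G.Adj z (f s)) (k := i₀) (m := j - 1) (by omega) ⟨by omega, hzi₀⟩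
  have hzs : ∀ s, l ≤ s → s ≤ j → G.Adj z (f s) → i ≤ s ∧ s ≤ i' := by
    intro s s1 s2 e
    rcases Nat.eq_or_lt_of_le s1 with rfl | s1
    · exact absurd e hzl
    · rcases Nat.eq_or_lt_of_le s2 with rfl | s2
      · exact absurd e hzj
      · exact h6 s (by omega) ⟨s1, e⟩
  have hSf : ∀ s, l ≤ s → s ≤ j → ∀ v ∈ S, f s ≠ v ∧ ¬ G.Adj (f s) v := by
    intro s s1 s2 v hv
    obtain ⟨t, t1, t2, t3, rfl⟩ := hS v hv
    refine ⟨(hint s (by omega) (by omega)).2.2 t t1, fun e => ?_⟩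
    rcases Nat.eq_or_lt_of_le s1 with rfl | s1
    · have := (hb.2 t t1).1 e; omega
    · rcases Nat.eq_or_lt_of_le s2 with rfl | s2
      · have := (hb'.2 t t1).1 e; omega
      · exact hno s s1 s2 t t1 e
  -- For the first and last neighbours `f i`, `f i'` of `z` in the stretch: if they coincide, there
  -- is a theta with ends `f i` and `g q`; if they are further apart than one step, one with ends
  -- `z` and `g q`. The third path uses the route `S`.
  have hcase : i' = i + 1 := by
    by_contra hne
    rcases Nat.lt_or_ge i' (i + 2) with hlt | hge
    · obtain rfl : i = i' := by omega
      refine hG.theta (hasTheta_of_link (s := f i) (t := g q) (S₁ := seg f l i)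
        (S₂ := seg f (i + 1) (j + 1)) (S₃ := insert z S)
        ((hint i (by omega) (by omega)).2.2 q hqm) (hno i h4 (by omega) q hqm)
        (H.hole.path.ac_seg (by omega) (by omega)) ?_ ?_ ?_ ?_ ?_)
      · rintro _ ⟨s, s1, s2, rfl⟩ v (rfl | hv)
        · refine ⟨(H.ne_path s (by omega)).symm, fun e => ?_⟩
          have := hzs s s1 (by omega) e.symm; omega
        · exact hSf s s1 (by omega) v hv
      · rintro _ ⟨s, s1, s2, rfl⟩ v (rfl | hv)
        · refine ⟨(H.ne_path s (by omega)).symm, fun e => ?_⟩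
          have := hzs s (by omega) (by omega) e.symm; omega
        · exact hSf s (by omega) (by omega) v hv
      · refine (H.hole.path.link_ge (i := l) (j := i) (by omega) (by omega) fun s s1 s2 => ?_).trans
          (Link.of_adj hlq (.inr (.inr (mem_seg_of le_rfl h4))) (by simp))
        rcases Nat.eq_or_lt_of_le s2 with rfl | s2
        · exact .inl rfl
        · exact .inr (.inr (mem_seg_of s1 s2))
      · refine (H.hole.path.link_le (i := i) (j := j) (by omega) (by omega) fun s s1 s2 => ?_).trans
          (Link.of_adj hjq (.inr (.inr (mem_seg_of (by omega) (by omega)))) (by simp))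
        rcases Nat.eq_or_lt_of_le s1 with rfl | s1
        · exact .inl rfl
        · exact .inr (.inr (mem_seg_of s1 (by omega)))
      · refine ((Link.of_adj h4'.symm (by simp) (by simp)).trans
          (Link.of_adj hzk (by simp) (.inr (.inr (.inr hkS))))).trans (hlS.mono ?_)
        rintro v (rfl | hv)
        · simp
        · exact .inr (.inr (.inr hv))
    · refine hG.theta (hasTheta_of_link (s := z) (t := g q) (S₁ := seg f l (i + 1))
        (S₂ := seg f i' (j + 1)) (S₃ := S) (H.ne_path' q hqm) hzq
        (H.hole.path.ac_seg (by omega) (by omega)) ?_ ?_ ?_ ?_ ?_)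
      · rintro _ ⟨s, s1, s2, rfl⟩ v hv
        exact hSf s s1 (by omega) v hv
      · rintro _ ⟨s, s1, s2, rfl⟩ v hv
        exact hSf s (by omega) (by omega) v hv
      · refine ((Link.of_adj h4' (by simp) (.inr (.inr (mem_seg_of h4.le (by omega))))).trans
          (H.hole.path.link_ge (i := l) (j := i) (by omega) (by omega) fun s s1 s2 => ?_)).trans
          (Link.of_adj hlq (.inr (.inr (mem_seg_of le_rfl (by omega)))) (by simp))
        exact .inr (.inr (mem_seg_of s1 (by omega)))
      · refine ((Link.of_adj h5' (by simp) (.inr (.inr (mem_seg_of le_rfl (by omega))))).trans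
          (H.hole.path.link_le (i := i') (j := j) (by omega) (by omega) fun s s1 s2 => ?_)).trans
          (Link.of_adj hjq (.inr (.inr (mem_seg_of (by omega) (by omega)))) (by simp))
        exact .inr (.inr (mem_seg_of s1 (by omega)))
      · refine (Link.of_adj hzk (by simp) (.inr (.inr hkS))).trans (hlS.mono ?_)
        rintro v (rfl | hv)
        · simp
        · exact .inr (.inr hv)
  subst hcase
  refine ⟨i, by omega, by omega, by omega, h4', h5', fun e => ?_, fun e => ?_⟩
  · have := hzs (i - 1) (by omega) (by omega) e; omega
  · have := hzs (i + 2) (by omega) (by omega) e; omega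

/-- If the neighbours of `z` in a path come in consecutive pairs, their number is even up to any
vertex that is not a neighbour. -/
theorem IndPath.even_deg_of_runs (hf : IndPath G f n)
    (hruns : ∀ i₀ ≤ n, G.Adj z (f i₀) → ∃ i, (i₀ = i ∨ i₀ = i + 1) ∧ 1 ≤ i ∧ i + 2 ≤ n ∧ G.Adj z (f i) ∧
      G.Adj z (f (i + 1)) ∧ ¬ G.Adj z (f (i - 1)) ∧ ¬ G.Adj z (f (i + 2))) (t : ℕ) :
    t ≤ n → ¬ G.Adj z (f t) → Even (deg G z (seg f 0 (t + 1))) := by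
  induction t using Nat.strong_induction_on with
  | _ t ih =>
    intro ht hzt
    rcases Nat.eq_zero_or_pos t with rfl | hpos
    · rw [seg_one, deg_singleton hzt]; exact Even.zero
    have s1 := hf.deg_seg_split z (Nat.zero_le t) (show t ≤ t + 1 by omega) (by omega)
    rw [seg_one, deg_singleton hzt] at s1
    by_cases h : G.Adj z (f (t - 1))
    · obtain ⟨i, h1, h2, h3, h4, h5, h6, h7⟩ := hruns (t - 1) (by omega) h
      obtain rfl : t = i + 2 := by
        rcases h1 with h1 | h1
        · obtain rfl : t = i + 1 := by omega
          exact absurd h5 hzt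
        · omega
      have := ih (i - 1) (by omega) (by omega) h6
      rw [show i - 1 + 1 = i by omega] at this
      have s2 := hf.deg_seg_split z (Nat.zero_le i) (show i ≤ i + 2 by omega) (by omega)
      have s3 := hf.deg_seg_split z (show i ≤ i + 1 by omega) (show i + 1 ≤ i + 1 + 1 by omega) (by omega)
      rw [seg_one, seg_one, deg_singleton_adj h4, deg_singleton_adj h5, show i + 1 + 1 = i + 2 from rfl] at s3
      rw [Nat.even_iff] at *; omega
    · have := ih (t - 1) (by omega) (by omega) h
      rw [show t - 1 + 1 = t by omega] at this
      rwa [s1, Nat.add_zero]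

theorem TwoHoles.even_deg (hG : Good G) (H : TwoHoles G a z f n g m) {t : ℕ} (ht : t ≤ n)
    (hzt : ¬ G.Adj z (f t)) : Even (deg G z (seg f 0 (t + 1))) :=
  H.hole.path.even_deg_of_runs
    (fun i₀ hi₀ h => H.runs hG hi₀ h) t ht hzt

/-- The path is cut after the first neighbour `f k` of `z`; by `runs` the next vertex is a neighbour
as well. Discarding `f k` turns the even counts of `even_deg` into the odd ones that `Arms` demands.
-/
theorem TwoHoles.exists_arms (hG : Good G) (H : TwoHoles G a z f n g m) :
    ∃ k, 2 ≤ k ∧ k + 3 ≤ n ∧ G.Adj z (f k) ∧ Arms G z (f 0) (f n) (armData f n k).A (armData f n k).α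
      (armData f n k).B (armData f n k).β := by
  obtain ⟨k', hk', hzk'⟩ := H.exists_adj
  obtain ⟨k, hk, hzk, hmin⟩ := exists_first (P := fun s => G.Adj z (f s)) hzk'
  have hr := H.range k (by omega) hzk
  obtain ⟨i, h1, h2, h3, h4, h5, h6, h7⟩ := H.runs hG (by omega) hzk
  obtain rfl : k = i := by
    rcases h1 with h1 | rfl
    · exact h1
    · exact absurd h4 (hmin i (by omega))
  have hr' := H.range (k + 1) (by omega) h5
  refine ⟨k, by omega, by omega, hzk, Arms.of_path H.hole.path H.ne_path (by omega) (by omega) hzk h5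
    hmin (fun e => by have := H.range n le_rfl e; omega) ?_⟩
  intro t ht htn hzt
  have e1 := H.even_deg hG htn hzt
  have s1 := H.hole.path.deg_seg_split z (Nat.zero_le (k + 1)) (show k + 1 ≤ t + 1 by omega) (by omega)
  have s2 := H.hole.path.deg_seg_split z (Nat.zero_le k) (show k ≤ k + 1 by omega) (by omega)
  rw [seg_one, deg_singleton_adj hzk, deg_eq_zero (S := seg f 0 k)
    (by rintro _ ⟨s, -, hs, rfl⟩; exact hmin s hs)] at s2
  rw [Nat.even_iff] at e1
  rw [Nat.odd_iff]; omega

/-- The vertex `a` joins `z` to `f 0` directly. It is a bypass for a clean pair, and if there is no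
clean pair it is the interior of the third path of a theta. -/
theorem TwoHoles.false_of_adj (hG : Good G) (H : TwoHoles G a z f n g m) (hza : G.Adj z a) :
    False := by
  obtain ⟨k, k1, k2, hzk, hA⟩ := H.exists_arms hG
  obtain ⟨l, l1, l2, hzl, hA'⟩ := H.symm.exists_arms hG
  rw [← H.start, ← H.finish] at hA'
  have T : TwoArms G z (f 0) (f n) (armData f n k) (armData g m l) :=
    ⟨hA, hA', Half.of_path (by omega) (by omega) H.eq hzk H.touch,
      Half.of_path (by omega) (by omega) H.symm.eq hzl H.touch'⟩
  have ha : ∀ s ≤ n, a ≠ f s := H.hole.ne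
  have ha' : ∀ s ≤ m, a ≠ g s := H.hole'.ne
  have hadj : ∀ s, 1 ≤ s → s + 1 ≤ n → ¬ G.Adj a (f s) := fun s h1 h2 => by
    rw [H.hole.adj s (by omega)]; omega
  have hadj' : ∀ s, 1 ≤ s → s + 1 ≤ m → ¬ G.Adj a (g s) := fun s h1 h2 => by
    rw [H.hole'.adj s (by omega)]; omega
  have hax : G.Adj a (f 0) := (H.hole.adj 0 (by omega)).2 (.inl rfl)
  by_cases hC : ∃ p q, Clean G (armData f n k) (armData g m l) p q
  · obtain ⟨p, q, C⟩ := hC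
    have hp := C.p_lt
    have hq := C.q_lt
    refine Bypass.false hG T C (o := a) (R := {a}) ?_
    simp only [armData] at hp hq
    refine ⟨rfl, hza, H.ne, fun r hr _ => hr, ?_, ?_, ?_, ?_, ?_, ?_,
      Link.of_adj hax (by simp) (by simp), ?_, ?_, ?_, ?_⟩ <;> simp only [armData]
    · rintro _ rfl s hs; exact hadj _ (by omega) (by omega)
    · rintro _ rfl s hs; exact hadj' _ (by omega) (by omega)
    · rintro _ rfl s hs; exact ha _ (by omega)
    · rintro _ rfl s hs; exact ha' _ (by omega)
    · rintro _ rfl s hs; exact ha _ (by omega)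
    · rintro _ rfl s hs; exact ha' _ (by omega)
    · intro s hs; exact hadj _ (by omega) (by omega)
    · intro s hs; exact hadj' _ (by omega) (by omega)
    · rintro s hs - _ rfl; exact hadj _ (by omega) (by omega)
    · rintro s hs - _ rfl; exact hadj' _ (by omega) (by omega)
  · push Not at hC
    have hac := T.ac hC
    refine hG.theta (hasTheta_of_link (s := z) (t := f 0) (S₃ := {a}) (H.ne_path 0 (by omega))
      (fun e => by have := H.range 0 (by omega) e; omega) hac ?_ ?_
      (T.arms.link (by simp) (by simp) fun s hs => .inr (.inr (mem_seg_of (by omega) hs)))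
      (T.arms'.link (by simp) (by simp) fun s hs => .inr (.inr (mem_seg_of (by omega) hs)))
      ((Link.of_adj hza (by simp) (by simp)).trans (Link.of_adj hax (by simp) (by simp))))
    · rintro _ ⟨s, -, hs, rfl⟩ _ rfl
      simp only [armData] at hs ⊢
      exact ⟨(ha _ (by omega)).symm, fun e => hadj (k - s) (by omega) (by omega) e.symm⟩
    · rintro _ ⟨s, -, hs, rfl⟩ _ rfl
      simp only [armData] at hs ⊢
      exact ⟨(ha' _ (by omega)).symm, fun e => hadj' (l - s) (by omega) (by omega) e.symm⟩

/-- If `z` is not adjacent to `a`, evenness makes it attach to an edge of the first hole, contrary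
to `edge`. -/
theorem TwoHoles.false (hG : Good G) (H : TwoHoles G a z f n g m) : False := by
  by_cases hza : G.Adj z a
  · exact H.false_of_adj hG hza
  · obtain ⟨k, hk, hzk⟩ := H.exists_adj
    obtain ⟨b, hb⟩ := H.hole.exists_atEdge hG H.ne H.ne_path hza
      (H.even_deg hG le_rfl fun e => by have := H.range n le_rfl e; omega) hk hzk
    rcases H.edge b with h | h
    · exact h hb
    · exact hza h

end Kaleidoscope

/-! ### Bounding families whose paths contain few neighbours of `z`. -/

namespace Kaleidoscope

variable {V : Type*} {G : SimpleGraph V}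

/-- The pigeonhole principle, as Ramsey's theorem for a colouring that ignores the larger index; the
additional term gives every index a partner. -/
theorem exists_uniform (K : Type*) [Finite K] (n : ℕ) : ∃ N : ℕ, ∀ c : ℕ → K, ∃ (e : ℕ → ℕ) (k : K),
    (∀ i < n, e i < N ∧ c (e i) = k) ∧ ∀ i j, i < j → j < n → e i < e j := by
  obtain ⟨N, hN⟩ := exists_homogeneous K (n + 1)
  refine ⟨N, fun c => ?_⟩
  obtain ⟨e, k, he, hek⟩ := hN fun i _ => c i
  exact ⟨e, k, fun i hi => ⟨he i (by omega), (hek i n hi (by omega)).2⟩,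
    fun i j hij hj => (hek i j hij (by omega)).1⟩

/-- `z` has at least one and at most `d` neighbours in the path, all far from its ends. -/
structure Meets (G : SimpleGraph V) (d : ℕ) (z : V) (f : ℕ → V) (n : ℕ) : Prop where
  ne_path : ∀ s ≤ n, z ≠ f s
  range : ∀ s ≤ n, G.Adj z (f s) → 2 ≤ s ∧ s + 2 ≤ n
  exists_adj : ∃ s ≤ n, G.Adj z (f s)
  deg_le : deg G z (seg f 0 (n + 1)) ≤ d

/-- `f k` is the only neighbour of `z` in the path. -/
def OnlyAt (G : SimpleGraph V) (z : V) (f : ℕ → V) (n k : ℕ) : Prop :=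
  k ≤ n ∧ ∀ s ≤ n, G.Adj z (f s) ↔ s = k

/-- One vertex of `S` serves for many of the paths and attaches to an edge of each, so
`exists_bound_edge` applies with it in the role of `z`. Not seeing `f i 1` and `f i (n i - 1)` keeps
these edges away from the ends. -/
theorem exists_bound_touched (t s : ℕ) : ∃ M : ℕ, ∀ {V : Type*} [Finite V] {G : SimpleGraph V}
    {a x y z : V} {f : ℕ → ℕ → V} {n : ℕ → ℕ} {d : ℕ} {S : Set V}, Good G → G.CliqueFree t →
    Family G a x y f n M → S.Nonempty → S.ncard ≤ s → (∀ i < M, Meets G d z (f i) (n i)) →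
    (∀ i < M, ∀ k, ¬ AtEdge G z (f i) (n i) k ∨ G.Adj z a) →
    (∀ i < M, ∃ v ∈ S, ∃ R, Probe G a z v (f i) (n i) R ∧ (∃ s ≤ n i, G.Adj v (f i s)) ∧
      ¬ G.Adj v (f i 1) ∧ ¬ G.Adj v (f i (n i - 1)) ∧ ∀ k, OnlyAt G z (f i) (n i) k →
        ¬ G.Adj v (f i (k - 1)) ∧ ¬ G.Adj v (f i (k + 1))) → False := by
  obtain ⟨N, hN⟩ := exists_bound_edge t
  obtain ⟨M, hM⟩ := exists_uniform (Fin (s + 1)) (N + 1)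
  refine ⟨M, ?_⟩
  intro V _ G a x y z f n d S hG ht F hne hcard hz hedge hS
  obtain ⟨p, hpS, hp⟩ := exists_enum S.toFinite hne hcard
  have hc : ∀ i, ∃ r : Fin (s + 1), i < M → ∃ R, Probe G a z (p r) (f i) (n i) R ∧
      (∃ s ≤ n i, G.Adj (p r) (f i s)) ∧
      ¬ G.Adj (p r) (f i 1) ∧ ¬ G.Adj (p r) (f i (n i - 1)) ∧ ∀ k, OnlyAt G z (f i) (n i) k →
        ¬ G.Adj (p r) (f i (k - 1)) ∧ ¬ G.Adj (p r) (f i (k + 1)) := by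
    intro i
    by_cases hi : i < M
    · obtain ⟨v, hv, h⟩ := hS i hi
      obtain ⟨r, hr, rfl⟩ := hp v hv
      exact ⟨⟨r, by omega⟩, fun _ => h⟩
    · exact ⟨0, fun h => absurd h hi⟩
  choose c hc using hc
  obtain ⟨e, r, he, hlt⟩ := hM c
  have key : ∀ i, ∃ b, i < N + 1 → AtEdge G (p r) (f (e i)) (n (e i)) b ∧ 2 ≤ b ∧ b + 3 ≤ n (e i) := by
    intro i
    by_cases hi : i < N + 1
    · obtain ⟨h1, h2⟩ := he i hi
      obtain ⟨R, hP, ⟨k₁, hk₁, hck₁⟩, h3, h4, h5⟩ := hc (e i) h1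
      rw [h2] at hP hck₁ h3 h4 h5
      obtain ⟨i₀, hi₀, hzi₀⟩ := (hz _ h1).exists_adj
      obtain ⟨b, hb⟩ := hP.exists_atEdge hG hi₀ hzi₀ hk₁ hck₁ (hedge _ h1)
        fun k hk hk' => h5 k ⟨hk, hk'⟩
      have hr := (hz _ h1).range i₀ hi₀ hzi₀
      have hbn := hb.1
      have hb1 : ¬ (1 = b ∨ 1 = b + 1) := fun h => h3 ((hb.2 1 (by omega)).2 h)
      have hb2 : ¬ (n (e i) - 1 = b ∨ n (e i) - 1 = b + 1) := fun h =>
        h4 ((hb.2 _ (by omega)).2 h)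
      exact ⟨b, fun _ => ⟨hb, by omega, by omega⟩⟩
    · exact ⟨0, fun h => absurd h hi⟩
  choose b hb using key
  obtain ⟨R, hP, -⟩ := hc (e 0) (he 0 (by omega)).1
  rw [(he 0 (by omega)).2] at hP
  refine hN (z := p r) (k := b) hG ht (F.reindex (M := N) (e := e) (fun i hi => (he i (by omega)).1)
    fun i j hij hj => hlt i j hij (by omega)) hP.ne' hP.not_adj fun i hi => ?_
  obtain ⟨h1, h2, h3⟩ := hb i (by omega)
  refine ⟨h2, h3, fun s hs => ⟨?_, h1.2 s hs⟩⟩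
  obtain ⟨R, hP, -⟩ := hc (e i) (he i (by omega)).1
  rw [(he i (by omega)).2] at hP
  exact hP.ne_path' s hs

/-- The neighbours of `z` in the path, the neighbours of its ends, and the neighbours of `f k`. -/
def core (G : SimpleGraph V) (z : V) (f : ℕ → V) (n k : ℕ) : Set V :=
  nbrsIn G z (seg f 0 (n + 1)) ∪ {f 1, f (n - 1), f (k - 1), f (k + 1)}

theorem Meets.mem_core {d : ℕ} {z : V} {f : ℕ → V} {n k : ℕ} (H : Meets G d z f n) (hk : k ≤ n)
    (hzk : G.Adj z (f k)) {v : V} (hv : v ∈ core G z f n k) :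
    ∃ s, 1 ≤ s ∧ s + 1 ≤ n ∧ v = f s := by
  have hr := H.range k hk hzk
  rcases hv with ⟨⟨s, -, hs, rfl⟩, hzs⟩ | rfl | rfl | rfl | rfl
  · have := H.range s (by omega) hzs
    exact ⟨s, by omega, by omega, rfl⟩
  · exact ⟨1, by omega, by omega, rfl⟩
  · exact ⟨n - 1, by omega, by omega, rfl⟩
  · exact ⟨k - 1, by omega, by omega, rfl⟩
  · exact ⟨k + 1, by omega, by omega, rfl⟩

theorem Meets.ncard_core {d : ℕ} {z : V} {f : ℕ → V} {n : ℕ} (H : Meets G d z f n) (k : ℕ) :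
    (core G z f n k).ncard ≤ d + 4 := by
  refine (Set.ncard_union_le _ _).trans (add_le_add H.deg_le ?_)
  refine (Set.ncard_insert_le _ _).trans (Nat.succ_le_succ ?_)
  refine (Set.ncard_insert_le _ _).trans (Nat.succ_le_succ ?_)
  exact (Set.ncard_insert_le _ _).trans (by simp)

theorem mem_core_of_adj {z : V} {f : ℕ → V} {n k s : ℕ} (hs : s ≤ n) (h : G.Adj z (f s)) :
    f s ∈ core G z f n k :=
  .inl ⟨mem_seg_of (by omega) (by omega), h⟩

/-- A family all of whose paths meet the neighbourhood of `z`, with anticomplete cores. -/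
structure CoreFamily (G : SimpleGraph V) (d : ℕ) (a x y z : V) (f : ℕ → ℕ → V) (n k : ℕ → ℕ) (N : ℕ) :
    Prop where
  family : Family G a x y f n N
  ne : z ≠ a
  meets : ∀ i < N, Meets G d z (f i) (n i)
  edge : ∀ i < N, ∀ k, ¬ AtEdge G z (f i) (n i) k ∨ G.Adj z a
  le : ∀ i < N, k i ≤ n i
  adj : ∀ i < N, G.Adj z (f i (k i))
  core : ∀ i < N, ∀ j < N, i ≠ j → ∀ v ∈ core G z (f i) (n i) (k i),
    ∀ w ∈ core G z (f j) (n j) (k j), ¬ G.Adj v w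

variable {a x y z : V} {f : ℕ → ℕ → V} {n k : ℕ → ℕ} {N d : ℕ}

/-- A core consists of the vertices that a probe coming from another path must not see, so
anticomplete cores supply these conditions. -/
theorem CoreFamily.probe (H : CoreFamily G d a x y z f n k N) {i j : ℕ} (hi : i < N) (hj : j < N)
    (hij : i ≠ j) {v : V} (hv : v ∈ Kaleidoscope.core G z (f i) (n i) (k i)) {R : Set V}
    (hRa : ∀ r ∈ R, r ≠ a ∧ ¬ G.Adj r a) (hR : ∀ r ∈ R, ∀ s ≤ n j, r ≠ f j s ∧ ¬ G.Adj r (f j s))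
    (hl : Link G (insert z (insert v R)) z v) :
    Probe G a z v (f j) (n j) R ∧ ¬ G.Adj v (f j 1) ∧ ¬ G.Adj v (f j (n j - 1)) ∧
      ∀ k, OnlyAt G z (f j) (n j) k → ¬ G.Adj v (f j (k - 1)) ∧ ¬ G.Adj v (f j (k + 1)) := by
  have Mi := H.meets i hi
  have Mj := H.meets j hj
  obtain ⟨s, h1, h2, rfl⟩ := Mi.mem_core (H.le i hi) (H.adj i hi) hv
  have hc := H.core i hi j hj hij _ hv
  refine ⟨⟨H.family.hole j hj, H.ne, Mj.ne_path, ((H.family.hole i hi).ne s (by omega)).symm, ?_, ?_,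
    fun t ht hzt => hc _ (mem_core_of_adj ht hzt), hRa, hR, hl, Mj.range⟩, hc _ (.inr (by simp)),
    hc _ (.inr (by simp)), fun k' hk' => ?_⟩
  · rw [G.adj_comm, (H.family.hole i hi).adj s (by omega)]; omega
  · intro t ht e
    have := H.family.eq i hi j hj hij s (by omega) t ht e; omega
  · obtain rfl : k j = k' := (hk'.2 _ (H.le j hj)).1 (H.adj j hj)
    exact ⟨hc _ (.inr (by simp)), hc _ (.inr (by simp))⟩

/-- Ramsey's theorem makes the relations `T` and `U`, which say that a path touches another near a
neighbour of `z`, constant in both directions. If one of them holds, the core of a single path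
touches `M` others, against `exists_bound_touched`; if none does, two paths satisfy `TwoHoles`. -/
theorem exists_bound_coreFamily (t d : ℕ) : ∃ N : ℕ, ∀ {V : Type*} [Finite V] {G : SimpleGraph V}
    {a x y z : V} {f : ℕ → ℕ → V} {n k : ℕ → ℕ}, Good G → G.CliqueFree t →
    CoreFamily G d a x y z f n k N → False := by
  obtain ⟨M, hM⟩ := exists_bound_touched t (d + 4)
  obtain ⟨N, hN⟩ := exists_homogeneous (Prop × Prop × Prop × Prop) (M + 2)
  refine ⟨N, ?_⟩
  intro V _ G a x y z f n k hG ht H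
  set T : ℕ → ℕ → Prop := fun i j => ∃ s ≤ n i, G.Adj z (f i s) ∧ ∃ t ≤ n j, G.Adj (f i s) (f j t)
    with hT
  set U : ℕ → ℕ → Prop := fun i j => OnlyAt G z (f i) (n i) (k i) ∧ ∃ t ≤ n j,
    G.Adj (f i (k i - 1)) (f j t) ∨ G.Adj (f i (k i + 1)) (f j t) with hU
  have hr : ∀ i < N, 2 ≤ k i ∧ k i + 2 ≤ n i := fun i hi =>
    (H.meets i hi).range _ (H.le i hi) (H.adj i hi)
  have hTno : ∀ i < N, ∀ ι : ℕ → ℕ, (∀ j < M, ι j < N ∧ ι j ≠ i) →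
      (∀ j j', j < j' → j' < M → ι j < ι j') → (∀ j < M, T i (ι j)) → False := by
    intro i hi ι hι hlt hTi
    refine hM (S := core G z (f i) (n i) (k i)) hG ht (H.family.reindex (fun j hj => (hι j hj).1) hlt)
      ⟨_, mem_core_of_adj (H.le i hi) (H.adj i hi)⟩ ((H.meets i hi).ncard_core _)
      (fun j hj => H.meets _ (hι j hj).1) (fun j hj => H.edge _ (hι j hj).1) fun j hj => ?_
    obtain ⟨s, hs, hzs, t, ht, hst⟩ := hTi j hj
    obtain ⟨hP, h1⟩ := H.probe (R := ∅) hi (hι j hj).1 (hι j hj).2.symm (mem_core_of_adj hs hzs)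
      (by simp) (by simp) (Link.of_adj hzs (by simp) (by simp))
    exact ⟨_, mem_core_of_adj hs hzs, ∅, hP, ⟨t, ht, hst⟩, h1⟩
  have hUno : ∀ i < N, ∀ ι : ℕ → ℕ, (∀ j < M, ι j < N ∧ ι j ≠ i) →
      (∀ j j', j < j' → j' < M → ι j < ι j') → (∀ j < M, ¬ T i (ι j)) → (∀ j < M, U i (ι j)) →
      False := by
    intro i hi ι hι hlt hnT hUi
    refine hM (S := core G z (f i) (n i) (k i)) hG ht (H.family.reindex (fun j hj => (hι j hj).1) hlt)
      ⟨_, mem_core_of_adj (H.le i hi) (H.adj i hi)⟩ ((H.meets i hi).ncard_core _)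
      (fun j hj => H.meets _ (hι j hj).1) (fun j hj => H.edge _ (hι j hj).1) fun j hj => ?_
    obtain ⟨ho, t, ht, hor⟩ := hUi j hj
    have hri := hr i hi
    have hh := H.family.hole i hi
    have key : ∀ s, (s = k i - 1 ∨ s = k i + 1) → G.Adj (f i s) (f (ι j) t) → ∃ v ∈ core G z (f i)
        (n i) (k i), ∃ R, Probe G a z v (f (ι j)) (n (ι j)) R ∧ (∃ s ≤ n (ι j), G.Adj v (f (ι j) s)) ∧
        ¬ G.Adj v (f (ι j) 1) ∧ ¬ G.Adj v (f (ι j) (n (ι j) - 1)) ∧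
        ∀ k, OnlyAt G z (f (ι j)) (n (ι j)) k →
          ¬ G.Adj v (f (ι j) (k - 1)) ∧ ¬ G.Adj v (f (ι j) (k + 1)) := by
      intro s hs hst
      have hsc : f i s ∈ core G z (f i) (n i) (k i) := by
        rcases hs with rfl | rfl <;> exact .inr (by simp)
      -- The probe reaches `f i s` from `z` through `f i (k i)`, which does not touch the other path
      -- because `T` fails.
      obtain ⟨hP, h1⟩ := H.probe (R := {f i (k i)}) hi (hι j hj).1 (hι j hj).2.symm hsc
        (by
          rintro _ rfl
          refine ⟨(hh.ne _ (by omega)).symm, ?_⟩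
          rw [G.adj_comm, hh.adj _ (by omega)]; omega)
        (by
          rintro _ rfl s' hs'
          refine ⟨fun e => ?_, fun e => hnT j hj ⟨_, H.le i hi, H.adj i hi, s', hs', e⟩⟩
          have := H.family.eq i hi _ (hι j hj).1 (hι j hj).2.symm _ (by omega) _ hs' e; omega)
        ((Link.of_adj (H.adj i hi) (by simp) (by simp)).trans (Link.of_adj
          ((hh.path.pair (i := k i) (j := s) (by omega) (by omega)).2.2 (by omega)) (by simp) (by simp)))
      exact ⟨_, hsc, _, hP, ⟨t, ht, hst⟩, h1⟩
    rcases hor with h | h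
    · exact key _ (.inl rfl) h
    · exact key _ (.inr rfl) h
  obtain ⟨e, K, he, hK⟩ := hN fun i j => (T i j, T j i, U i j, U j i)
  have hK' := fun i j hij hj => (hK i j hij hj).2
  have hι : ∀ j < M, e (j + 1) < N ∧ e (j + 1) ≠ e 0 := fun j hj =>
    ⟨he _ (by omega), (hK 0 (j + 1) (by omega) (by omega)).1.ne'⟩
  have hι' : ∀ j < M, e j < N ∧ e j ≠ e M := fun j hj =>
    ⟨he _ (by omega), (hK j M (by omega) (by omega)).1.ne⟩
  have hlt : ∀ j j', j < j' → j' < M → e (j + 1) < e (j' + 1) := fun j j' h1 h2 =>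
    (hK _ _ (by omega) (by omega)).1
  have hlt' : ∀ j j', j < j' → j' < M → e j < e j' := fun j j' h1 h2 =>
    (hK _ _ (by omega) (by omega)).1
  have k1 : ¬ K.1 := fun h => hTno (e 0) (he 0 (by omega)) (fun j => e (j + 1)) hι hlt fun j hj => by
    rw [← hK' 0 (j + 1) (by omega) (by omega)] at h; exact h
  have k2 : ¬ K.2.1 := fun h => hTno (e M) (he M (by omega)) e hι' hlt' fun j hj => by
    rw [← hK' j M (by omega) (by omega)] at h; exact h
  have k3 : ¬ K.2.2.1 := fun h => hUno (e 0) (he 0 (by omega)) (fun j => e (j + 1)) hι hlt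
    (fun j hj h' => k1 (by rw [← hK' 0 (j + 1) (by omega) (by omega)]; exact h')) fun j hj => by
      rw [← hK' 0 (j + 1) (by omega) (by omega)] at h; exact h
  have k4 : ¬ K.2.2.2 := fun h => hUno (e M) (he M (by omega)) e hι' hlt'
    (fun j hj h' => k2 (by rw [← hK' j M (by omega) (by omega)]; exact h')) fun j hj => by
      rw [← hK' j M (by omega) (by omega)] at h; exact h
  rw [← hK' 0 1 (by omega) (by omega)] at k1 k2 k3 k4
  have i0 := he 0 (by omega)
  have i1 := he 1 (by omega)
  have ne01 := (hK 0 1 (by omega) (by omega)).1.ne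
  have F := H.family
  refine TwoHoles.false (f := f (e 0)) (g := f (e 1)) (n := n (e 0)) (m := n (e 1)) (a := a) (z := z) hG
    ⟨F.hole _ i0, F.hole _ i1, by rw [F.start _ i0, F.start _ i1], by rw [F.finish _ i0, F.finish _ i1],
    F.eq _ i0 _ i1 ne01, H.ne, (H.meets _ i0).ne_path, (H.meets _ i1).ne_path, (H.meets _ i0).range,
    (H.meets _ i1).range, (H.meets _ i0).exists_adj, (H.meets _ i1).exists_adj,
    fun s hs hzs t ht h => k1 ⟨s, hs, hzs, t, ht, h⟩, fun s hs hzs t ht h => k2 ⟨s, hs, hzs, t, ht, h⟩,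
    H.edge _ i0, H.edge _ i1, ?_, ?_⟩
  · intro k' hk hz t ht
    obtain rfl : k (e 0) = k' := (hz _ (H.le _ i0)).1 (H.adj _ i0)
    exact ⟨fun h => k3 ⟨⟨hk, hz⟩, t, ht, .inl h.symm⟩, fun h => k3 ⟨⟨hk, hz⟩, t, ht, .inr h.symm⟩⟩
  · intro k' hk hz t ht
    obtain rfl : k (e 1) = k' := (hz _ (H.le _ i1)).1 (H.adj _ i1)
    exact ⟨fun h => k4 ⟨⟨hk, hz⟩, t, ht, .inl h.symm⟩, fun h => k4 ⟨⟨hk, hz⟩, t, ht, .inr h.symm⟩⟩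

theorem exists_bound_meets_of_not_edge (t d : ℕ) : ∃ N : ℕ, ∀ {V : Type*} [Finite V]
    {G : SimpleGraph V} {a x y z : V} {f : ℕ → ℕ → V} {n : ℕ → ℕ}, Good G → G.CliqueFree t →
    Family G a x y f n N → z ≠ a → (∀ i < N, Meets G d z (f i) (n i)) →
    (∀ i < N, ∀ k, ¬ AtEdge G z (f i) (n i) k ∨ G.Adj z a) → False := by
  obtain ⟨M, hM⟩ := exists_bound_coreFamily t d
  obtain ⟨N, hN⟩ := exists_anticomplete t (d + 4) M
  refine ⟨N, ?_⟩
  intro V _ G a x y z f n hG ht F hza hz hedge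
  have hk : ∀ i, ∃ k, i < N → k ≤ n i ∧ G.Adj z (f i k) := by
    intro i
    by_cases hi : i < N
    · obtain ⟨k, hk⟩ := (hz i hi).exists_adj
      exact ⟨k, fun _ => hk⟩
    · exact ⟨0, fun h => absurd h hi⟩
  choose k hk using hk
  obtain ⟨e, he, hac⟩ := hN (fun i => core G z (f i) (n i) (k i)) hG ht
    (fun i hi => ⟨⟨_, mem_core_of_adj (hk i hi).1 (hk i hi).2⟩, (hz i hi).ncard_core _⟩) (by
      intro i hi j hj hij
      rw [Set.disjoint_left]
      intro v hv hv'
      obtain ⟨s, s1, s2, rfl⟩ := (hz i hi).mem_core (hk i hi).1 (hk i hi).2 hv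
      obtain ⟨r, r1, r2, e⟩ := (hz j hj).mem_core (hk j hj).1 (hk j hj).2 hv'
      have := F.eq i hi j hj hij s (by omega) r (by omega) e; omega)
  refine hM hG ht (k := fun i => k (e i)) ⟨F.reindex he fun i j hij hj => (hac i j hij hj).1, hza,
    fun i hi => hz _ (he i hi), fun i hi => hedge _ (he i hi), fun i hi => (hk _ (he i hi)).1,
    fun i hi => (hk _ (he i hi)).2, fun i hi j hj hij v hv w hw h => ?_⟩
  rcases Nat.lt_or_ge i j with h' | h'
  · exact (hac i j h' hj).2 v hv w hw h
  · exact (hac j i (by omega) hi).2 w hw v hv h.symm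

/-- A family whose paths all contain at least one and at most `d` neighbours of `z` has bounded
size. -/
theorem exists_bound_meets (t d : ℕ) : ∃ N : ℕ, ∀ {V : Type*} [Finite V]
    {G : SimpleGraph V} {a x y z : V} {f : ℕ → ℕ → V} {n : ℕ → ℕ}, Good G → G.CliqueFree t →
    Family G a x y f n N → z ≠ a → (∀ i < N, Meets G d z (f i) (n i)) → False := by
  obtain ⟨M, hM⟩ := exists_bound_meets_of_not_edge t d
  obtain ⟨M', hM'⟩ := exists_bound_edge t
  -- The length covers either outcome; the extra index guarantees a path from which `¬ G.Adj z a`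
  -- can be read off.
  obtain ⟨N, hN⟩ := exists_uniform Prop (M + M' + 1)
  refine ⟨N, ?_⟩
  intro V _ G a x y z f n hG ht F hza hz
  obtain ⟨e, K, he, hlt⟩ := hN fun i => ∃ k, AtEdge G z (f i) (n i) k ∧ ¬ G.Adj z a
  by_cases hK : K
  · have hk : ∀ i, ∃ k, i < M + M' + 1 → AtEdge G z (f (e i)) (n (e i)) k ∧ ¬ G.Adj z a := by
      intro i
      by_cases hi : i < M + M' + 1
      · have h := (he i hi).2
        obtain ⟨k, hk⟩ : ∃ k, AtEdge G z (f (e i)) (n (e i)) k ∧ ¬ G.Adj z a := by rw [h]; exact hK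
        exact ⟨k, fun _ => hk⟩
      · exact ⟨0, fun h => absurd h hi⟩
    choose k hk using hk
    refine hM' (k := k) hG ht (F.reindex (M := M') (e := e) (fun i hi => (he i (by omega)).1)
      fun i j hij hj => hlt i j hij (by omega)) hza (hk 0 (by omega)).2 fun i hi => ?_
    obtain ⟨h1, h2⟩ := hk i (by omega)
    have Mi := hz _ (he i (by omega)).1
    have h3 := h1.facts
    have r1 := Mi.range _ (by omega) h3.2.1
    have r2 := Mi.range _ h3.1 h3.2.2.1
    exact ⟨by omega, by omega, fun s hs => ⟨Mi.ne_path s hs, h1.2 s hs⟩⟩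
  · refine hM hG ht (F.reindex (M := M) (e := e) (fun i hi => (he i (by omega)).1)
      fun i j hij hj => hlt i j hij (by omega)) hza (fun i hi => hz _ (he i (by omega)).1) fun i hi k => ?_
    by_contra h
    push Not at h
    exact hK ((he i (by omega)).2 ▸ ⟨k, h⟩)

end Kaleidoscope

/-! ### From kaleidoscopes to families of holes, and the theorem. -/

namespace Kaleidoscope

variable {V : Type*} {G : SimpleGraph V}

theorem IsInducedPath.indPath {u v : V} {p : G.Walk u v} (hp : IsInducedPath p) :
    IndPath G p.getVert p.length := by
  have hinj : ∀ {i j}, i ≤ p.length → j ≤ p.length → p.getVert i = p.getVert j → i = j :=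
    fun hi hj e => hp.1.getVert_injOn hi hj e
  refine IndPath.of_iff (fun i j hij hj e => by have := hinj (by omega) hj e; omega)
    fun i j hij hj => ⟨fun e => ?_, ?_⟩
  · have := (SimpleGraph.Walk.isChordless_iff_forall_mem_edges.1 hp.2) (p.getVert_mem_support i)
      (p.getVert_mem_support j) e
    obtain ⟨k, hk, h⟩ := (SimpleGraph.Walk.mk_mem_edges_iff_exists p).1 this
    rcases Sym2.eq_iff.1 h with ⟨h1, h2⟩ | ⟨h1, h2⟩
    · have := hinj (by omega) (by omega) h1
      have := hinj (by omega) (by omega) h2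
      omega
    · have := hinj (by omega) (by omega) h1
      have := hinj (by omega) (by omega) h2
      omega
  · rintro rfl
    exact p.adj_getVert_succ (by omega)

theorem vertices_eq_seg {u v : V} (p : G.Walk u v) : vertices p = seg p.getVert 0 (p.length + 1) := by
  ext w
  simp only [vertices, Set.mem_ofPred_eq, SimpleGraph.Walk.mem_support_iff_exists_getVert]
  constructor
  · rintro ⟨i, rfl, hi⟩; exact mem_seg_of (by omega) (by omega)
  · rintro ⟨i, -, hi, rfl⟩; exact ⟨i, rfl, by omega⟩

namespace IsKaleidoscope

variable {a x y : V} {w : ℕ} {𝒲 : Finset (G.Walk x y)}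

theorem getVert_mem_pathInterior (H : IsKaleidoscope G w a x y 𝒲) {W : G.Walk x y} (hW : W ∈ 𝒲) {s : ℕ}
    (hs : s ≤ W.length) : W.getVert s ∈ pathInterior W ↔ s ≠ 0 ∧ s ≠ W.length := by
  have hp := (H.isInducedPath W hW).indPath
  simp only [pathInterior, Set.mem_ofPred_eq, W.getVert_mem_support, true_and]
  have h1 := (hp.pair hs (Nat.zero_le _)).1
  have h2 := (hp.pair hs le_rfl).1
  rw [W.getVert_zero] at h1
  rw [W.getVert_length] at h2
  rw [Ne, h1, Ne, h2]

theorem holeOn (H : IsKaleidoscope G w a x y 𝒲) {W : G.Walk x y} (hW : W ∈ 𝒲) :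
    HoleOn G a W.getVert W.length := by
  refine ⟨(H.isInducedPath W hW).indPath, ?_, ?_, ?_⟩
  · by_contra h
    obtain h | h : W.length = 0 ∨ W.length = 1 := by omega
    · exact H.ne (SimpleGraph.Walk.eq_of_length_eq_zero h)
    · exact H.not_adj (SimpleGraph.Walk.adj_of_length_eq_one h)
  · rintro i hi rfl
    exact H.notMem W hW (W.getVert_mem_support i)
  · intro i hi
    constructor
    · intro e
      by_contra h
      push Not at h
      exact (H.anticomplete W hW).2 a rfl _ ((H.getVert_mem_pathInterior hW hi).2 h) e
    · rintro (rfl | rfl)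
      · rw [W.getVert_zero]; exact H.adj_left.symm
      · rw [W.getVert_length]; exact H.adj_right

theorem subset (H : IsKaleidoscope G w a x y 𝒲) {𝒲' : Finset (G.Walk x y)} (h : 𝒲' ⊆ 𝒲) :
    IsKaleidoscope G 𝒲'.card a x y 𝒲' :=
  ⟨H.adj_left, H.adj_right, H.ne, H.not_adj, rfl, fun W hW => H.isInducedPath W (h hW),
    fun W hW => H.notMem W (h hW), fun W hW W' hW' => H.disjoint_interior W (h hW) W' (h hW'),
    fun W hW => H.anticomplete W (h hW)⟩

theorem family (H : IsKaleidoscope G w a x y 𝒲) {W : ℕ → G.Walk x y} {N : ℕ} (hW : ∀ i < N, W i ∈ 𝒲)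
    (hne : ∀ i < N, ∀ j < N, i ≠ j → W i ≠ W j) :
    Family G a x y (fun i => (W i).getVert) (fun i => (W i).length) N := by
  refine ⟨fun i hi => H.holeOn (hW i hi), fun i hi => (W i).getVert_zero,
    fun i hi => (W i).getVert_length, ?_⟩
  intro i hi j hj hij s hs t ht e
  have hdis := Set.disjoint_left.1 (H.disjoint_interior _ (hW i hi) _ (hW j hj) (hne i hi j hj hij))
  have hpi := (H.isInducedPath _ (hW i hi)).indPath
  have hpj := (H.isInducedPath _ (hW j hj)).indPath
  by_cases h : s ≠ 0 ∧ s ≠ (W i).length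
  · have hm := (H.getVert_mem_pathInterior (hW i hi) hs).2 h
    refine absurd ?_ (hdis hm)
    obtain ⟨-, h1, h2⟩ := hm
    rw [e] at h1 h2 ⊢
    exact ⟨(W j).getVert_mem_support t, h1, h2⟩
  · obtain rfl | rfl : s = 0 ∨ s = (W i).length := by omega
    · refine .inl ⟨rfl, ?_⟩
      exact (hpj.inj (Nat.zero_le _) ht
        ((W j).getVert_zero.trans ((W i).getVert_zero.symm.trans e))).symm
    · refine .inr ⟨rfl, ?_⟩
      exact (hpj.inj le_rfl ht
        ((W j).getVert_length.trans ((W i).getVert_length.symm.trans e))).symm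

/-- Being `1`-mirrored supplies a neighbour on the path, and having none among the first two and
last two vertices is the condition `range`. -/
theorem meets (H : IsKaleidoscope G w a x y 𝒲) {z : V} (hz : IsMirrored G 1 z a x y 𝒲) {W : G.Walk x y}
    (hW : W ∈ 𝒲) {d : ℕ} (hd : (nbrsIn G z (vertices W)).ncard ≤ d) :
    Meets G d z W.getVert W.length := by
  have hh := H.holeOn hW
  have hm := hh.two_le
  have hac := (hz.anticomplete z rfl W hW).2 z rfl
  have hmem : ∀ s, W.getVert s ∈ vertices W := fun s => W.getVert_mem_support s
  have h0 : ¬ G.Adj z (W.getVert 0) := hac _ (.inl (by rw [W.getVert_zero]; exact .inl rfl))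
  have h1 : ¬ G.Adj z (W.getVert 1) := hac _ (.inl (.inr ⟨hmem 1, by
    have := (hh.path.pair (i := 0) (j := 1) (by omega) (by omega)).2.2 (by omega)
    rwa [W.getVert_zero] at this⟩))
  have hn : ¬ G.Adj z (W.getVert W.length) := hac _ (.inr (by rw [W.getVert_length]; exact .inl rfl))
  have hn1 : ¬ G.Adj z (W.getVert (W.length - 1)) := hac _ (.inr (.inr ⟨hmem _, by
    have := (hh.path.pair (i := W.length) (j := W.length - 1) (by omega) (by omega)).2.2 (by omega)
    rwa [W.getVert_length] at this⟩))
  refine ⟨?_, fun s hs e => ?_, ?_, by rwa [deg, ← vertices_eq_seg]⟩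
  · rintro s hs rfl
    exact Set.disjoint_left.1 hz.disjoint rfl (.inl (Set.mem_biUnion hW (hmem s)))
  · have : s ≠ 0 := by rintro rfl; exact h0 e
    have : s ≠ 1 := by rintro rfl; exact h1 e
    have : s ≠ W.length := by rintro rfl; exact hn e
    have : s ≠ W.length - 1 := by rintro rfl; exact hn1 e
    omega
  · have := hz.le_ncard z rfl W hW
    obtain ⟨v, hv, hzv⟩ := Set.nonempty_of_ncard_ne_zero (s := nbrsIn G z (vertices W)) (by omega)
    rw [vertices_eq_seg] at hv
    obtain ⟨s, -, hs, rfl⟩ := hv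
    exact ⟨s, by omega, hzv⟩

end IsKaleidoscope

theorem SetIsMirrored.subset {a x y : V} {d d' : ℕ} {Z : Set V} {𝒲 𝒲' : Finset (G.Walk x y)}
    (H : SetIsMirrored G d Z a x y 𝒲) (h : 𝒲' ⊆ 𝒲)
    (hd : ∀ z ∈ Z, ∀ W ∈ 𝒲', d' ≤ (nbrsIn G z (vertices W)).ncard) : SetIsMirrored G d' Z a x y 𝒲' := by
  refine ⟨H.disjoint.mono_right ?_, H.subsingleton, fun z hz W hW => H.anticomplete z hz W (h hW), hd⟩
  exact Set.union_subset_union_left _ (Set.biUnion_subset_biUnion_left h)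

end Kaleidoscope

theorem theorem4p1 (d t w : ℕ) (hd : 1 ≤ d) (ht : 1 ≤ t) (hw : 1 ≤ w) :
    ∃ κ : ℕ, 1 ≤ κ ∧
      ∀ (V : Type*) [Finite V] (G : SimpleGraph V),
        ¬ Kaleidoscope.HasTheta G → ¬ Kaleidoscope.HasPrism G →
        ¬ Kaleidoscope.HasEvenWheel G → G.CliqueFree t →
        ∀ (a x y : V) (𝒲 : Finset (G.Walk x y)),
          Kaleidoscope.IsKaleidoscope G κ a x y 𝒲 →
          ∀ z : V, Kaleidoscope.IsMirrored G 1 z a x y 𝒲 →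
            ∃ 𝒲' : Finset (G.Walk x y), 𝒲' ⊆ 𝒲 ∧ 𝒲'.card = w ∧
              Kaleidoscope.IsKaleidoscope G w a x y 𝒲' ∧
              Kaleidoscope.IsMirrored G d z a x y 𝒲' := by
  classical
  obtain ⟨N, hN⟩ := Kaleidoscope.exists_bound_meets t d
  -- Fewer than `w` paths with `d` neighbours of `z` would leave more than `N` without.
  refine ⟨w + N, by omega, ?_⟩
  intro V _ G hθ hP hE hK a x y 𝒲 H z hz
  by_cases hcard : w ≤ (𝒲.filter fun W => d ≤ (Kaleidoscope.nbrsIn G z (Kaleidoscope.vertices W)).ncard).card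
  · obtain ⟨𝒲', h1, h2⟩ := Finset.exists_subset_card_eq hcard
    have h3 := h1.trans (Finset.filter_subset _ _)
    refine ⟨𝒲', h3, h2, h2 ▸ H.subset h3, hz.subset h3 ?_⟩
    rintro _ rfl W hW
    exact (Finset.mem_filter.1 (h1 hW)).2
  · exfalso
    have hsum := Finset.card_filter_add_card_filter_not (s := 𝒲)
      (fun W => d ≤ (Kaleidoscope.nbrsIn G z (Kaleidoscope.vertices W)).ncard)
    have hc := H.card_eq
    set 𝓑 := 𝒲.filter fun W => ¬ d ≤ (Kaleidoscope.nbrsIn G z (Kaleidoscope.vertices W)).ncard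
      with hB
    have hNB : N < 𝓑.card := by omega
    have hmem : ∀ W ∈ 𝓑, W ∈ 𝒲 ∧ ¬ d ≤ (Kaleidoscope.nbrsIn G z (Kaleidoscope.vertices W)).ncard :=
      fun W hW => Finset.mem_filter.1 hW
    obtain ⟨W₀, -⟩ := Finset.card_pos.1 (show 0 < 𝓑.card by omega)
    -- An enumeration of the poor paths; only indices below `N` are used, where the default `W₀`
    -- does not occur.
    let W : ℕ → G.Walk x y := fun i => if h : i < 𝓑.card then 𝓑.equivFin.symm ⟨i, h⟩ else W₀
    have hW : ∀ i (h : i < N), W i = 𝓑.equivFin.symm ⟨i, by omega⟩ := fun i h => dif_pos (by omega)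
    have hWB : ∀ i < N, W i ∈ 𝓑 := fun i hi => by rw [hW i hi]; exact (𝓑.equivFin.symm _).2
    have hne : ∀ i < N, ∀ j < N, i ≠ j → W i ≠ W j := by
      intro i hi j hj hij e
      rw [hW i hi, hW j hj] at e
      exact hij (congrArg Fin.val (𝓑.equivFin.symm.injective (Subtype.ext e)))
    refine hN ⟨hθ, hP, hE⟩ hK (H.family (fun i hi => (hmem _ (hWB i hi)).1) hne) ?_ fun i hi =>
      H.meets hz (hmem _ (hWB i hi)).1 (by have := (hmem _ (hWB i hi)).2; omega)
    rintro rfl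
    exact Set.disjoint_left.1 hz.disjoint rfl (.inr rfl)
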